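/- **Duality Theorem.** Let $k$ be a field, $B$ a finite-dimensional Hopf algebra over $k$, and ${}^B_B\mathcal{YD}$ the category of left-left Yetter–Drinfeld modules over $B$, with braiding $C_{V,W}(v\otimes w)=\sum v_{(-1)}\cdot w\otimes v_{(0)}$. Let $H$ be a braided Hopf algebra in ${}^B_B\mathcal{YD}$ with $C_{H,H}=C_{H,H}^{-1}$ and bijective antipode $S_H$. The dual $H^*$ carries the action $(b\cdot f)(x)=f(S(b)\cdot x)$ and the coaction determined by $\sum f_{(-1)}f_{(0)}(x)=\sum S^{-1}(x_{(-1)})f(x_{(0)})$. The finite dual $H^\circ$ consists of the $f\in H^*$ whose kernel contains a two-sided ideal of $H$ of finite codimension that is also a $B$-submodule and a $B$-subcomodule. With the pairing $\langle f\otimes g,\,x\otimes y\rangle=\sum f(g_{(-1)}\cdot x)\,g_{(0)}(y)$, its structure maps are $\langle fg,x\rangle=\langle f\otimes g,\Delta x\rangle$, unit $\varepsilon_H$, $\langle\Delta f,x\otimes y\rangle=f(xy)$, counit $f\mapsto f(1)$, antipode $f\mapsto f\circ S_H$. Let $U$ be a braided Hopf subalgebra of $H^\circ$ (a subspace to which all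 these structure maps, including action and coaction, restrict), and let $\langle\,,\rangle$ be the evaluation $U\otimes H\to k$. Assume the RL-condition: for every $f\in U$ the map $\rho(f\# 1)\in\mathrm{End}_k(H)$, $x\mapsto\sum\langle f,x_1\rangle x_2$, lies in the image of $\lambda:H\otimes U\to \mathrm{End}_k(H)$, $\lambda(h\#f)(x)=\sum h\,(f_{(-1)}\cdot x_1)\,\langle f_{(0)},x_2\rangle$. For an algebra $A$ in ${}^B_B\mathcal{YD}$ on which a braided Hopf algebra $X$ acts by $\triangleright$ as a module algebra, $A\#X$ is the object $A\otimes X$ with product $(a\#x)(b\#y)=\sum a\,(x_1\triangleright(x_{2(-1)}\cdot b))\#x_{2(0)}\,y$. Let $U$ act on $H$ by $f\rightharpoonup h=\sum (f_{(-1)}\cdot h_1)\langle f_{(0)},h_2\rangle$. Let $(R,\psi)$ be a right $U$-comodule algebra in ${}^B_B\mathcal{YD}$. Then $R$ is a left $H$-module algebra in ${}^B_B\mathcal{YD}$ via $$(R\otimes\langle\,,\rangle)(R\otimes C_{H,U})(C_{H,R}\otimes U)(H\otimes\psi),$$ and $R\#H$ is a left $U$-module algebra in ${}^B_B\mathcal{YD}$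 under the action that is trivial on $R$ and $\rightharpoonup$ on $H$, i.e. $(R\otimes\rightharpoonup)(C_{U,R}\otimes H)$. Consequently $(R\#H)\#U$ and the braided tensor product $R\otimes(H\#U)$, with product $(r\otimes a)(s\otimes b)=\sum r\,(a_{(-1)}\cdot s)\otimes a_{(0)}b$, are algebras in ${}^B_B\mathcal{YD}$. There is an isomorphism of $k$-algebras $$(R\#H)\#U\;\cong\;R\otimes(H\#U).$$ Moreover, if $B$ is commutative and cocommutative, then this isomorphism is an isomorphism of algebras in ${}^B_B\mathcal{YD}$. -/

import Mathlib

open TensorProduct Coalgebra HopfAlgebra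
open LinearMap (mul')

noncomputable section

namespace BraidedDuality

/-! ### The antipode of a finite-dimensional Hopf algebra is bijective -/

section Antipode

variable (k B : Type*) [Field k] [Ring B] [HopfAlgebra k B]

/-- The action `(b · w) (x) = w (S(b) x)` of `B` on its dual. -/
def auxAct : B →ₗ[k] Module.Dual k B →ₗ[k] Module.Dual k B :=
  Module.Dual.transpose ∘ₗ LinearMap.mul k B ∘ₗ antipode k

theorem auxAct_mul (a b : B) (w : Module.Dual k B) :
    auxAct k B (a * b) w = auxAct k B a (auxAct k B b w) := by
  ext x
  simp [auxAct, Module.Dual.transpose_apply, antipode_mul_antidistrib, mul_assoc]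

theorem auxAct_one (w : Module.Dual k B) : auxAct k B 1 w = w := by
  ext x
  simp [auxAct, Module.Dual.transpose_apply]

/-- `b ⊗ w ↦ ∑ b₁ ⊗ b₂ · w`. -/
def auxGalois : B ⊗[k] Module.Dual k B →ₗ[k] B ⊗[k] Module.Dual k B :=
  (lift (auxAct k B)).lTensor B ∘ₗ
    (TensorProduct.assoc k B B (Module.Dual k B)).toLinearMap ∘ₗ comul.rTensor (Module.Dual k B)

theorem auxGalois_surjective : Function.Surjective (auxGalois k B) := by
  have key : ∀ (b : B) (w : Module.Dual k B), ∃ z, auxGalois k B z = b ⊗ₜ w := by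
    intro b w
    let g : B →ₗ[k] Module.Dual k B := (auxAct k B).flip w
    have h1 : auxGalois k B ∘ₗ (g ∘ₗ antipode k).lTensor B =
        (g ∘ₗ mul' k B ∘ₗ (antipode k).lTensor B).lTensor B ∘ₗ
          (TensorProduct.assoc k B B B).toLinearMap ∘ₗ comul.rTensor B := by
      apply TensorProduct.ext'
      intro x y
      simp only [auxGalois, LinearMap.comp_apply, LinearMap.lTensor_tmul, LinearMap.rTensor_tmul,
        LinearEquiv.coe_coe]
      generalize (comul x : B ⊗[k] B) = q
      induction q with
      | zero => simp
      | add p q hp hq => simp only [add_tmul, map_add, hp, hq]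
      | tmul u v => simp [g, auxAct_mul]
    refine ⟨(g ∘ₗ antipode k).lTensor B (comul b), ?_⟩
    have h2 := LinearMap.congr_fun h1 (comul b)
    simp only [LinearMap.comp_apply, LinearEquiv.coe_coe] at h2
    rw [h2, Coalgebra.coassoc_apply, ← LinearMap.comp_apply, ← LinearMap.lTensor_comp]
    have h3 : (g ∘ₗ mul' k B ∘ₗ (antipode k).lTensor B) ∘ₗ comul =
        (g ∘ₗ Algebra.linearMap k B) ∘ₗ counit := by
      rw [LinearMap.comp_assoc, LinearMap.comp_assoc, mul_antipode_lTensor_comul,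
        LinearMap.comp_assoc]
    rw [h3, LinearMap.lTensor_comp, LinearMap.comp_apply, Coalgebra.lTensor_counit_comul]
    simp [g, auxAct_one]
  intro z
  induction z with
  | zero => exact ⟨0, map_zero _⟩
  | tmul b w => exact key b w
  | add x y hx hy =>
    obtain ⟨x', rfl⟩ := hx
    obtain ⟨y', rfl⟩ := hy
    exact ⟨x' + y', map_add _ _ _⟩

/-- The diagonal action `a · (x ⊗ w) = ∑ a₁ x ⊗ a₂ · w`. -/
def auxDiag : B →ₗ[k] B ⊗[k] Module.Dual k B →ₗ[k] B ⊗[k] Module.Dual k B :=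
  TensorProduct.homTensorHomMap (RingHom.id k) B (Module.Dual k B) B (Module.Dual k B) ∘ₗ
    map (LinearMap.mul k B) (auxAct k B) ∘ₗ comul

theorem auxGalois_mul (a : B) (z : B ⊗[k] Module.Dual k B) :
    auxGalois k B ((LinearMap.mul k B a).rTensor _ z) = auxDiag k B a (auxGalois k B z) := by
  induction z with
  | zero => simp
  | add x y hx hy => simp only [map_add, hx, hy]
  | tmul x w =>
    simp only [auxGalois, auxDiag, LinearMap.comp_apply, LinearMap.rTensor_tmul,
      LinearMap.mul_apply', Bialgebra.comul_mul, LinearEquiv.coe_coe]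
    generalize (comul x : B ⊗[k] B) = q
    generalize (comul a : B ⊗[k] B) = p
    induction q with
    | zero => simp
    | add q q' hq hq' => simp only [mul_add, add_tmul, map_add, hq, hq']
    | tmul u v =>
      induction p with
      | zero => simp
      | add p p' hp hp' => simp only [add_mul, add_tmul, map_add, hp, hp', LinearMap.add_apply]
      | tmul s t => simp [auxAct_mul]

theorem comul_twist (a : B) :
    mul' k (B ⊗[k] B) (map ((TensorProduct.mk k B B).flip 1 ∘ₗ antipode k) comul (comul a)) =
      1 ⊗ₜ a := by
  have h : mul' k (B ⊗[k] B) ∘ₗ map ((TensorProduct.mk k B B).flip 1 ∘ₗ antipode k) LinearMap.id =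
      (mul' k B ∘ₗ (antipode k).rTensor B).rTensor B ∘ₗ
        (TensorProduct.assoc k B B B).symm.toLinearMap := by
    apply TensorProduct.ext'
    intro x q
    induction q with
    | zero => simp
    | add p q hp hq => simp only [tmul_add, map_add, hp, hq]
    | tmul u v => simp
  have h1 := LinearMap.congr_fun h (comul.lTensor B (comul a))
  simp only [LinearMap.comp_apply, LinearEquiv.coe_coe, Coalgebra.coassoc_symm_apply] at h1
  rw [← LinearMap.comp_apply (LinearMap.rTensor B _), ← LinearMap.rTensor_comp,
    LinearMap.comp_assoc, mul_antipode_rTensor_comul, LinearMap.rTensor_comp, LinearMap.comp_apply,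
    Coalgebra.rTensor_counit_comul] at h1
  rw [LinearMap.lTensor, ← LinearMap.comp_apply (map _ _), ← TensorProduct.map_comp] at h1
  simpa using h1

variable [Module.Finite k B]

theorem coev_spec (x : B) :
    dualTensorHom k B B (TensorProduct.comm k _ _ (coevaluation k B 1)) x = x := by
  simp only [coevaluation_apply_one, map_sum, TensorProduct.comm_tmul, LinearMap.sum_apply,
    dualTensorHom_apply]
  exact (Module.Basis.ofVectorSpace k B).sum_repr x

theorem auxDiag_coev (a : B) :
    auxDiag k B a (coevaluation k B 1) = counit (R := k) a • coevaluation k B 1 := by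
  have hinj : Function.Injective (dualTensorHom k B B ∘ₗ
      (TensorProduct.comm k B (Module.Dual k B)).toLinearMap) := by
    rw [LinearMap.coe_comp]
    exact (dualTensorHomEquiv k B B).injective.comp (LinearEquiv.injective _)
  have h1 : ∀ (u v : B) (z : B ⊗[k] Module.Dual k B) (x : B),
      dualTensorHom k B B (TensorProduct.comm k _ _
        (map (LinearMap.mul k B u) (auxAct k B v) z)) x =
      u * dualTensorHom k B B (TensorProduct.comm k _ _ z) (antipode k v * x) := by
    intro u v z x
    induction z with
    | zero => simp
    | add p q hp hq => simp only [map_add, LinearMap.add_apply, mul_add, hp, hq]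
    | tmul b w => simp [auxAct, Module.Dual.transpose_apply]
  apply hinj
  ext x
  have h2 : ∀ p : B ⊗[k] B, dualTensorHom k B B (TensorProduct.comm k _ _
      (TensorProduct.homTensorHomMap (RingHom.id k) B (Module.Dual k B) B (Module.Dual k B)
        (map (LinearMap.mul k B) (auxAct k B) p) (coevaluation k B 1))) x =
      mul' k B ((antipode k).lTensor B p) * x := by
    intro p
    induction p with
    | zero => simp
    | add p q hp hq => simp only [map_add, LinearMap.add_apply, add_mul, hp, hq]
    | tmul u v =>
      simp only [map_tmul, homTensorHomMap_apply, LinearMap.lTensor_tmul, LinearMap.mul'_apply]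
      rw [h1, coev_spec, mul_assoc]
  have h3 := h2 (comul a)
  simp only [LinearMap.comp_apply, LinearEquiv.coe_coe, map_smul, LinearMap.smul_apply, coev_spec]
  rw [mul_antipode_lTensor_comul_apply, ← Algebra.smul_def] at h3
  exact h3

theorem exists_left_integral [Nontrivial B] :
    ∃ Λ : B, Λ ≠ 0 ∧ ∀ a : B, a * Λ = counit (R := k) a • Λ := by
  classical
  have hinj : Function.Injective (auxGalois k B) :=
    LinearMap.injective_iff_surjective.2 (auxGalois_surjective k B)
  obtain ⟨Θ, hΘ⟩ := auxGalois_surjective k B (coevaluation k B 1)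
  have h1 : ∀ a : B, (LinearMap.mul k B a).rTensor _ Θ = counit (R := k) a • Θ := by
    intro a
    apply hinj
    rw [auxGalois_mul, hΘ, auxDiag_coev, map_smul, hΘ]
  have hΘ0 : Θ ≠ 0 := by
    rintro rfl
    have := coev_spec k B (1 : B)
    rw [← hΘ] at this
    simp at this
  let 𝒞 := Module.Basis.ofVectorSpace k (Module.Dual k B)
  obtain ⟨i, hi⟩ : ∃ i, equivFinsuppOfBasisRight 𝒞 Θ i ≠ 0 := by
    by_contra! h
    apply hΘ0
    apply (equivFinsuppOfBasisRight 𝒞 (M := B)).injective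
    ext i
    simpa using h i
  refine ⟨_, hi, fun a => ?_⟩
  have h2 : ∀ z : B ⊗[k] Module.Dual k B,
      equivFinsuppOfBasisRight 𝒞 ((LinearMap.mul k B a).rTensor _ z) i =
        a * equivFinsuppOfBasisRight 𝒞 z i := by
    intro z
    induction z with
    | zero => simp
    | add p q hp hq => simp only [map_add, Finsupp.add_apply, mul_add, hp, hq]
    | tmul b w => simp
  rw [← h2, h1, map_smul, Finsupp.smul_apply]

theorem antipode_injective : Function.Injective (antipode k : B →ₗ[k] B) := by
  classical
  rcases subsingleton_or_nontrivial B with _ | _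
  · exact Function.injective_of_subsingleton _
  obtain ⟨Λ, hΛ0, hΛ⟩ := exists_left_integral k B
  have h1 : ∀ a : B, (1 ⊗ₜ a) * (comul Λ : B ⊗[k] B) = (antipode k a ⊗ₜ 1) * comul Λ := by
    intro a
    rw [← comul_twist k B a]
    have h : ∀ p : B ⊗[k] B,
        mul' k (B ⊗[k] B) (map ((TensorProduct.mk k B B).flip 1 ∘ₗ antipode k) comul p) *
          comul Λ = (antipode k (TensorProduct.rid k B (counit.lTensor B p)) ⊗ₜ 1) * comul Λ := by
      intro p
      induction p with
      | zero => simp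
      | add p q hp hq => simp only [map_add, add_mul, add_tmul, hp, hq]
      | tmul u v =>
        simp only [map_tmul, LinearMap.mul'_apply, mul_assoc, ← Bialgebra.comul_mul, hΛ]
        simp [← smul_tmul']
    rw [h, Coalgebra.lTensor_counit_comul]
    simp
  rw [injective_iff_map_eq_zero]
  intro a ha
  have h2 : ∀ y : B, (LinearMap.mul k B (a * y)).lTensor B (comul Λ) = 0 := by
    intro y
    have h3 : ∀ z : B ⊗[k] B, (LinearMap.mul k B (a * y)).lTensor B z = (1 ⊗ₜ (a * y)) * z := by
      intro z
      induction z with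
      | zero => simp
      | add p q hp hq => simp only [map_add, mul_add, hp, hq]
      | tmul u v => simp
    rw [h3, h1, antipode_mul_antidistrib, ha]
    simp
  let 𝒞 := Module.Basis.ofVectorSpace k B
  have h3 : ∀ i y, a * y * equivFinsuppOfBasisLeft 𝒞 (comul Λ : B ⊗[k] B) i = 0 := by
    intro i y
    have h4 : ∀ z : B ⊗[k] B, equivFinsuppOfBasisLeft 𝒞 ((LinearMap.mul k B (a * y)).lTensor B z) i
        = a * y * equivFinsuppOfBasisLeft 𝒞 z i := by
      intro z
      induction z with
      | zero => simp
      | add p q hp hq => simp only [map_add, Finsupp.add_apply, mul_add, hp, hq]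
      | tmul u v => simp
    rw [← h4, h2]
    simp
  let G : B ⊗[k] B →ₗ[k] B ⊗[k] B := (LinearMap.mul k B a ∘ₗ mul' k B ∘ₗ
    (antipode k).rTensor B).lTensor B ∘ₗ (TensorProduct.assoc k B B B).toLinearMap ∘ₗ
    comul.rTensor B
  have hG1 : G (comul Λ) = Λ ⊗ₜ a := by
    simp only [G, LinearMap.comp_apply, LinearEquiv.coe_coe, Coalgebra.coassoc_apply]
    rw [← LinearMap.comp_apply (LinearMap.lTensor B _), ← LinearMap.lTensor_comp,
      LinearMap.comp_assoc, LinearMap.comp_assoc, mul_antipode_rTensor_comul,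
      ← LinearMap.comp_assoc, LinearMap.lTensor_comp, LinearMap.comp_apply,
      Coalgebra.lTensor_counit_comul]
    simp
  have hG2 : G (comul Λ) = 0 := by
    rw [← (equivFinsuppOfBasisLeft 𝒞).symm_apply_apply (comul Λ : B ⊗[k] B),
      equivFinsuppOfBasisLeft_symm_apply, Finsupp.sum, map_sum]
    refine Finset.sum_eq_zero fun i _ => ?_
    simp only [G, LinearMap.comp_apply, LinearEquiv.coe_coe, LinearMap.rTensor_tmul]
    generalize (comul (𝒞 i) : B ⊗[k] B) = q
    induction q with
    | zero => simp
    | add p q hp hq => simp only [add_tmul, map_add, hp, hq, add_zero]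
    | tmul u v => simp [← mul_assoc, h3]
  obtain ⟨i, hi⟩ : ∃ i, 𝒞.repr Λ i ≠ 0 := by
    by_contra! h
    exact hΛ0 (𝒞.repr.injective (Finsupp.ext (by simpa using h)))
  have h5 := congrArg (fun z => equivFinsuppOfBasisLeft 𝒞 z i) (hG1.symm.trans hG2)
  simpa [hi] using h5

/-- The antipode of a finite-dimensional Hopf algebra as a linear automorphism. -/
def antipodeEquiv : B ≃ₗ[k] B :=
  LinearEquiv.ofInjectiveEndo (antipode k) (antipode_injective k B)

/-- The inverse `S⁻¹` of the antipode of a finite-dimensional Hopf algebra. -/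
def antipodeInv : B →ₗ[k] B := (antipodeEquiv k B).symm.toLinearMap

end Antipode

end BraidedDuality

namespace BraidedDuality

/-! ### Yetter-Drinfeld modules -/

section YetterDrinfeld

variable (k B : Type*) [Field k] [Ring B] [HopfAlgebra k B]

/-- A left `B`-action and a left `B`-coaction on a `k`-vector space `V` (data only; the axioms of a
left-left Yetter-Drinfeld module are in `IsYD`). -/
class YDData (V : Type*) [AddCommMonoid V] [Module k V] where
  /-- the action, `act b v = b · v` -/
  act : B →ₗ[k] V →ₗ[k] V
  /-- the coaction, `coact v = v₍₋₁₎ ⊗ v₍₀₎` -/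
  coact : V →ₗ[k] B ⊗[k] V

variable (V W : Type*) [AddCommMonoid V] [Module k V] [AddCommMonoid W] [Module k W]
  [YDData k B V] [YDData k B W]

/-- The action as a map `B ⊗ V → V`. -/
def actMap : B ⊗[k] V →ₗ[k] V :=
  lift (YDData.act (k := k) (B := B) (V := V))

/-- The coaction as a map `V → B ⊗ V`. -/
def coactMap : V →ₗ[k] B ⊗[k] V :=
  YDData.coact (k := k) (B := B) (V := V)

/-- `V` is an object of the category `^B_B YD` of left-left Yetter-Drinfeld modules: a left
`B`-module and a left `B`-comodule such that
`∑ b₁ v₍₋₁₎ ⊗ b₂ · v₍₀₎ = ∑ (b₁ · v)₍₋₁₎ b₂ ⊗ (b₁ · v)₍₀₎`, equivalently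
`δ (b · v) = ∑ b₁ v₍₋₁₎ S(b₃) ⊗ b₂ · v₍₀₎`. -/
structure IsYD : Prop where
  one_act : ∀ v : V, actMap k B V (1 ⊗ₜ v) = v
  mul_act : ∀ (a b : B) (v : V),
    actMap k B V ((a * b) ⊗ₜ v) = actMap k B V (a ⊗ₜ actMap k B V (b ⊗ₜ v))
  coassoc : (TensorProduct.assoc k B B V).toLinearMap ∘ₗ comul.rTensor V ∘ₗ coactMap k B V =
    (coactMap k B V).lTensor B ∘ₗ coactMap k B V
  counit_coact : (TensorProduct.lid k V).toLinearMap ∘ₗ counit.rTensor V ∘ₗ coactMap k B V =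
    LinearMap.id
  compat : map (mul' k B) (actMap k B V) ∘ₗ (tensorTensorTensorComm k B B B V).toLinearMap ∘ₗ
      map comul (coactMap k B V) =
    (mul' k B).rTensor V ∘ₗ (TensorProduct.rightComm k B V B).toLinearMap ∘ₗ
      (coactMap k B V ∘ₗ actMap k B V).rTensor B ∘ₗ
      (TensorProduct.rightComm k B B V).toLinearMap ∘ₗ comul.rTensor V

variable {V W} in
/-- Morphisms of `^B_B YD`: linear maps that are `B`-linear and `B`-colinear. -/
structure IsYDHom (f : V →ₗ[k] W) : Prop where
  map_act : ∀ (b : B) (v : V), f (actMap k B V (b ⊗ₜ v)) = actMap k B W (b ⊗ₜ f v)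
  map_coact : ∀ v : V, coactMap k B W (f v) = f.lTensor B (coactMap k B V v)

/-- The unit object: `b · c = ε(b) c` and `δ(c) = 1 ⊗ c`. -/
instance : YDData k B k where
  act := LinearMap.lsmul k k ∘ₗ counit
  coact := TensorProduct.mk k B k 1

/-- The tensor product: `b · (v ⊗ w) = ∑ b₁ · v ⊗ b₂ · w` and
`δ (v ⊗ w) = ∑ v₍₋₁₎ w₍₋₁₎ ⊗ (v₍₀₎ ⊗ w₍₀₎)`. -/
instance : YDData k B (V ⊗[k] W) where
  act := TensorProduct.curry
    (map (actMap k B V) (actMap k B W) ∘ₗ (tensorTensorTensorComm k B B V W).toLinearMap ∘ₗ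
      comul.rTensor (V ⊗[k] W))
  coact := (mul' k B).rTensor (V ⊗[k] W) ∘ₗ (tensorTensorTensorComm k B V B W).toLinearMap ∘ₗ
    map (coactMap k B V) (coactMap k B W)

/-- The braiding `C : V ⊗ W → W ⊗ V`, `C (v ⊗ w) = ∑ v₍₋₁₎ · w ⊗ v₍₀₎`. -/
def braid : V ⊗[k] W →ₗ[k] W ⊗[k] V :=
  (actMap k B W).rTensor V ∘ₗ (TensorProduct.rightComm k B V W).toLinearMap ∘ₗ
    (coactMap k B V).rTensor W

/-- The left action of `B^*` on the dual space `V^*` of a `B`-comodule: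
`(b^* · f) (x) = ∑ b^*(x₍₋₁₎) f (x₍₀₎)` (here as a function of `f`, then of `b^*`). -/
def dualStar : Module.Dual k V →ₗ[k] Module.Dual k B →ₗ[k] Module.Dual k V :=
  LinearMap.mk₂ k (fun f b => mul' k k ∘ₗ map b f ∘ₗ coactMap k B V)
    (fun f g b => by simp only [TensorProduct.map_add_right, LinearMap.add_comp,
      LinearMap.comp_add])
    (fun c f b => by simp only [TensorProduct.map_smul_right, LinearMap.smul_comp,
      LinearMap.comp_smul])
    (fun f b b' => by simp only [TensorProduct.map_add_left, LinearMap.add_comp,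
      LinearMap.comp_add])
    (fun c f b => by simp only [TensorProduct.map_smul_left, LinearMap.smul_comp,
      LinearMap.comp_smul])

/-- The dual space `V^*` of a Yetter-Drinfeld module over a finite-dimensional `B`:
`(b · f) (x) = f (S(b) · x)`, and `δ f = ∑ S⁻¹(eᵢ) ⊗ (eᵢ^* · f)` where `∑ eᵢ ⊗ eᵢ^*` is the
coevaluation of `B`; that is, `∑ f₍₋₁₎ f₍₀₎(x) = ∑ S⁻¹(x₍₋₁₎) f (x₍₀₎)`. -/
instance [Module.Finite k B] : YDData k B (Module.Dual k V) where
  act := Module.Dual.transpose ∘ₗ YDData.act (k := k) (B := B) (V := V) ∘ₗ antipode k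
  coact := LinearMap.applyₗ (coevaluation k B 1) ∘ₗ
    TensorProduct.mapBilinear (RingHom.id k) B (Module.Dual k B) B (Module.Dual k V)
      (antipodeInv k B) ∘ₗ dualStar k B V

end YetterDrinfeld

/-! ### Algebras in the category -/

section Algebras

variable {k : Type*} (B : Type*) [Field k] [Ring B] [HopfAlgebra k B]
variable {A V W D X Y Z : Type*} [AddCommMonoid A] [Module k A] [AddCommMonoid V] [Module k V]
  [AddCommMonoid W] [Module k W] [AddCommMonoid D] [Module k D] [AddCommMonoid X] [Module k X]
  [AddCommMonoid Y] [Module k Y] [AddCommMonoid Z] [Module k Z]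

variable (A D) in
/-- `A ⊗ χ ⊗ D : A ⊗ V ⊗ W ⊗ D → A ⊗ W ⊗ V ⊗ D` for a map `χ : V ⊗ W → W ⊗ V`. -/
def mid (χ : V ⊗[k] W →ₗ[k] W ⊗[k] V) : (A ⊗[k] V) ⊗[k] (W ⊗[k] D) →ₗ[k]
    (A ⊗[k] W) ⊗[k] (V ⊗[k] D) :=
  (TensorProduct.assoc k A W (V ⊗[k] D)).symm.toLinearMap ∘ₗ
    ((TensorProduct.assoc k W V D).toLinearMap ∘ₗ χ.rTensor D ∘ₗ
      (TensorProduct.assoc k V W D).symm.toLinearMap).lTensor A ∘ₗ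
    (TensorProduct.assoc k A V (W ⊗[k] D)).toLinearMap

variable (A) in
/-- `(A ⊗ g) (C_{X,A} ⊗ Y) : X ⊗ A ⊗ Y → A ⊗ Z` for a map `g : X ⊗ Y → Z`. -/
def pass [YDData k B A] [YDData k B X] (g : X ⊗[k] Y →ₗ[k] Z) :
    X ⊗[k] (A ⊗[k] Y) →ₗ[k] A ⊗[k] Z :=
  g.lTensor A ∘ₗ (TensorProduct.assoc k A X Y).toLinearMap ∘ₗ (braid k B X A).rTensor Y ∘ₗ
    (TensorProduct.assoc k X A Y).symm.toLinearMap

/-- The multiplication of the braided tensor product of two algebras,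
`(m ⊗ m) (A ⊗ C_{D,A} ⊗ D)`. -/
def tensorMul [YDData k B A] [YDData k B D] (mA : A ⊗[k] A →ₗ[k] A) (mD : D ⊗[k] D →ₗ[k] D) :
    (A ⊗[k] D) ⊗[k] (A ⊗[k] D) →ₗ[k] A ⊗[k] D :=
  map mA mD ∘ₗ mid A D (braid k B D A)

/-- The multiplication of the smash product `A # X`, where `X` acts on `A` by `act` and has
comultiplication `Δ`: `(m ⊗ m) (A ⊗ act ⊗ X ⊗ X) (A ⊗ X ⊗ C_{X,A} ⊗ X) (A ⊗ Δ ⊗ A ⊗ X)`, that is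
`(a # x) (b # y) = ∑ a (x₁ · (x₂₍₋₁₎ · b)) # x₂₍₀₎ y`. The underlying object is `A ⊗ X`. -/
def smashMul [YDData k B A] [YDData k B X] (mA : A ⊗[k] A →ₗ[k] A) (mX : X ⊗[k] X →ₗ[k] X)
    (Δ : X →ₗ[k] X ⊗[k] X) (act : X ⊗[k] A →ₗ[k] A) :
    (A ⊗[k] X) ⊗[k] (A ⊗[k] X) →ₗ[k] A ⊗[k] X :=
  map mA mX ∘ₗ mid A X
    (act.rTensor X ∘ₗ (TensorProduct.assoc k X A X).symm.toLinearMap ∘ₗ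
      (braid k B X A).lTensor X ∘ₗ (TensorProduct.assoc k X X A).toLinearMap ∘ₗ Δ.rTensor A)

/-- `(A, m, e)` is an (associative, unital) algebra in `^B_B YD`. -/
structure IsYDAlgebra [YDData k B A] (m : A ⊗[k] A →ₗ[k] A) (e : A) : Prop where
  isYD : IsYD k B A
  assoc : ∀ a b c : A, m (m (a ⊗ₜ b) ⊗ₜ c) = m (a ⊗ₜ m (b ⊗ₜ c))
  one_mul : ∀ a : A, m (e ⊗ₜ a) = a
  mul_one : ∀ a : A, m (a ⊗ₜ e) = a
  mul_hom : IsYDHom k B m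
  unit_hom : IsYDHom k B (LinearMap.toSpanSingleton k A e)

/-- For a Hopf algebra `(X, mX, eX, Δ, ε)` in `^B_B YD` and an algebra `(A, mA, eA)` in `^B_B YD`:
`act` makes `A` a left `X`-module algebra in `^B_B YD`. -/
structure IsModuleAlgebra [YDData k B A] [YDData k B X] (mX : X ⊗[k] X →ₗ[k] X) (eX : X)
    (Δ : X →ₗ[k] X ⊗[k] X) (ε : X →ₗ[k] k) (mA : A ⊗[k] A →ₗ[k] A) (eA : A)
    (act : X ⊗[k] A →ₗ[k] A) : Prop where
  act_hom : IsYDHom k B act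
  one_act : ∀ a : A, act (eX ⊗ₜ a) = a
  mul_act : ∀ (x y : X) (a : A), act (mX (x ⊗ₜ y) ⊗ₜ a) = act (x ⊗ₜ act (y ⊗ₜ a))
  act_one : ∀ x : X, act (x ⊗ₜ eA) = ε x • eA
  act_mul : act ∘ₗ mA.lTensor X = mA ∘ₗ map act act ∘ₗ mid X A (braid k B X A) ∘ₗ
    Δ.rTensor (A ⊗[k] A)

end Algebras

/-! ### Braided Hopf algebras, the finite dual and its Hopf subalgebras -/

section Hopf

variable (k B H : Type*) [Field k] [Ring B] [HopfAlgebra k B]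
  [Ring H] [Algebra k H] [Coalgebra k H] [YDData k B H]

/-- A braided Hopf algebra in `^B_B YD`: the object `H` is a Yetter-Drinfeld module, an algebra and
a coalgebra with structure maps in `^B_B YD`, the comultiplication and the counit are algebra maps
(for the braided tensor product algebra `H ⊗ H`), and there is an antipode in `^B_B YD`. -/
class BraidedHopfAlgebra where
  isYDAlgebra : IsYDAlgebra B (mul' k H) (1 : H)
  comul_hom : IsYDHom k B (comul : H →ₗ[k] H ⊗[k] H)
  counit_hom : IsYDHom k B (counit : H →ₗ[k] k)
  comul_one : (comul : H →ₗ[k] H ⊗[k] H) 1 = 1 ⊗ₜ 1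
  comul_mul : (comul : H →ₗ[k] H ⊗[k] H) ∘ₗ mul' k H =
    tensorMul B (mul' k H) (mul' k H) ∘ₗ map comul comul
  counit_one : (counit : H →ₗ[k] k) 1 = 1
  counit_mul : ∀ x y : H, (counit : H →ₗ[k] k) (x * y) = counit x * counit y
  /-- the antipode of `H` -/
  S : H →ₗ[k] H
  S_hom : IsYDHom k B S
  S_left : mul' k H ∘ₗ S.rTensor H ∘ₗ comul = Algebra.linearMap k H ∘ₗ counit
  S_right : mul' k H ∘ₗ S.lTensor H ∘ₗ comul = Algebra.linearMap k H ∘ₗ counit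

/-- The antipode of a braided Hopf algebra. -/
def braidedAntipode [h : BraidedHopfAlgebra k B H] : H →ₗ[k] H := h.S

/-- The finite dual `H°` of the algebra `H` in `^B_B YD`: the functionals whose kernel contains a
two-sided ideal of finite codimension that is a `B`-submodule and a `B`-subcomodule. -/
def finiteDual : Set (Module.Dual k H) :=
  {f | ∃ I : Submodule k H, (∀ x, ∀ y ∈ I, x * y ∈ I ∧ y * x ∈ I) ∧
    (∀ b : B, ∀ y ∈ I, actMap k B H (b ⊗ₜ y) ∈ I) ∧
    (∀ y ∈ I, coactMap k B H y ∈ LinearMap.range (I.subtype.lTensor B)) ∧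
    Module.Finite k (H ⧸ I) ∧ I ≤ LinearMap.ker f}

variable [Module.Finite k B]

/-- The pairing of `H^* ⊗ H^*` with `H ⊗ H` given by `(ev ⊗ ev) (H^* ⊗ C_{H^*,H} ⊗ H)`:
`⟨f ⊗ g, x ⊗ y⟩ = ∑ f (g₍₋₁₎ · x) g₍₀₎(y)`. -/
def dualPairing : Module.Dual k H ⊗[k] Module.Dual k H →ₗ[k] H ⊗[k] H →ₗ[k] k :=
  TensorProduct.curry (mul' k k ∘ₗ map (contractLeft k H) (contractLeft k H) ∘ₗ
    mid (Module.Dual k H) H (braid k B (Module.Dual k H) H))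

/-- The multiplication of `H^*` (and of `H°`): `⟨f g, x⟩ = ⟨f ⊗ g, Δ x⟩`. Its unit is `ε`. -/
def dualMul : Module.Dual k H ⊗[k] Module.Dual k H →ₗ[k] Module.Dual k H :=
  LinearMap.lcomp k k comul ∘ₗ dualPairing k B H

/-- A braided Hopf subalgebra `U` of the finite dual `H°`: a subspace of `H°` containing the unit
`ε`, stable under the antipode `f ↦ f ∘ S`, and such that the action, the coaction, the
multiplication and the comultiplication of `H°` restrict to `U`. (The comultiplication of `H°` is
the transpose of the multiplication of `H`: `f (x y) = ⟨Δ f, x ⊗ y⟩`. The counit is `f ↦ f 1`.)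
The maps `act`, `coact`, `mul`, `comul` are these restrictions; each of them is uniquely determined
by `carrier`. -/
structure BraidedHopfSubalgebra [BraidedHopfAlgebra k B H] where
  /-- the underlying subspace -/
  carrier : Submodule k (Module.Dual k H)
  subset_finiteDual : (carrier : Set (Module.Dual k H)) ⊆ finiteDual k B H
  /-- the restricted action -/
  act : B →ₗ[k] carrier →ₗ[k] carrier
  act_spec : ∀ (b : B) (f : carrier), (act b f : Module.Dual k H) =
    actMap k B (Module.Dual k H) (b ⊗ₜ (f : Module.Dual k H))
  /-- the restricted coaction -/
  coact : carrier →ₗ[k] B ⊗[k] carrier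
  coact_spec : ∀ f : carrier, carrier.subtype.lTensor B (coact f) =
    coactMap k B (Module.Dual k H) (f : Module.Dual k H)
  /-- the restricted multiplication -/
  mul : carrier ⊗[k] carrier →ₗ[k] carrier
  mul_spec : ∀ f g : carrier, (mul (f ⊗ₜ g) : Module.Dual k H) =
    dualMul k B H ((f : Module.Dual k H) ⊗ₜ (g : Module.Dual k H))
  counit_mem : (counit : H →ₗ[k] k) ∈ carrier
  /-- the restricted comultiplication -/
  comul : carrier →ₗ[k] carrier ⊗[k] carrier
  comul_spec : ∀ (f : carrier) (x y : H),
    dualPairing k B H (map carrier.subtype carrier.subtype (comul f)) (x ⊗ₜ y) =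
      (f : Module.Dual k H) (x * y)
  antipode_mem : ∀ f ∈ carrier, f ∘ₗ braidedAntipode k B H ∈ carrier

end Hopf

namespace BraidedHopfSubalgebra

variable {k B H : Type*} [Field k] [Ring B] [HopfAlgebra k B] [Module.Finite k B]
  [Ring H] [Algebra k H] [Coalgebra k H] [YDData k B H] [BraidedHopfAlgebra k B H]
  (U : BraidedHopfSubalgebra k B H)

instance : YDData k B U.carrier where
  act := U.act
  coact := U.coact

/-- The unit of `U`. -/
def one : U.carrier := ⟨Coalgebra.counit, U.counit_mem⟩

/-- The counit `f ↦ f 1` of `U`. -/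
def counit : U.carrier →ₗ[k] k := (Module.Dual.eval k H 1) ∘ₗ U.carrier.subtype

/-- The evaluation `⟨ , ⟩ : U ⊗ H → k`. -/
def ev : U.carrier ⊗[k] H →ₗ[k] k := contractLeft k H ∘ₗ U.carrier.subtype.rTensor H

/-- The action `⇀` of `U` on `H`: `(H ⊗ ⟨ , ⟩) (C_{U,H} ⊗ H) (U ⊗ Δ)`. -/
def hit : U.carrier ⊗[k] H →ₗ[k] H :=
  (TensorProduct.rid k H).toLinearMap ∘ₗ pass B H U.ev ∘ₗ
    (Coalgebra.comul : H →ₗ[k] H ⊗[k] H).lTensor U.carrier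

/-- `λ : H # U → End H`, `λ (h # f) = (m ⊗ ⟨ , ⟩) (H ⊗ C_{U,H} ⊗ H) (h ⊗ f ⊗ Δ(-))`. -/
def lam : H ⊗[k] U.carrier →ₗ[k] H →ₗ[k] H :=
  TensorProduct.curry ((TensorProduct.rid k H).toLinearMap ∘ₗ map (mul' k H) U.ev ∘ₗ
    mid H H (braid k B U.carrier H) ∘ₗ
    (Coalgebra.comul : H →ₗ[k] H ⊗[k] H).lTensor (H ⊗[k] U.carrier))

/-- `ρ : U # H → End H`, `ρ (f # h) = m (⟨ , ⟩ ⊗ C_{H,H}) (U ⊗ C_{H,H} ⊗ H) (f ⊗ h ⊗ Δ(-))`. -/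
def rho : U.carrier ⊗[k] H →ₗ[k] H →ₗ[k] H :=
  TensorProduct.curry ((TensorProduct.lid k H).toLinearMap ∘ₗ
    map U.ev (mul' k H ∘ₗ braid k B H H) ∘ₗ mid U.carrier H (braid k B H H) ∘ₗ
    (Coalgebra.comul : H →ₗ[k] H ⊗[k] H).lTensor (U.carrier ⊗[k] H))

/-- The RL-condition on `H` and `U` under evaluation: `ρ (U # 1) ⊆ λ (H # U)`. -/
def RLCondition : Prop :=
  ∀ f : U.carrier, U.rho (f ⊗ₜ 1) ∈ LinearMap.range U.lam

variable {R : Type*} [Ring R] [Algebra k R] [YDData k B R] (ψ : R →ₗ[k] R ⊗[k] U.carrier)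

/-- `(R, ψ)` is a right `U`-comodule algebra in `^B_B YD`. -/
structure IsComoduleAlgebra : Prop where
  isYDAlgebra : IsYDAlgebra B (mul' k R) (1 : R)
  hom : IsYDHom k B ψ
  coassoc : (TensorProduct.assoc k R U.carrier U.carrier).toLinearMap ∘ₗ ψ.rTensor U.carrier ∘ₗ ψ =
    U.comul.lTensor R ∘ₗ ψ
  counit : (TensorProduct.rid k R).toLinearMap ∘ₗ U.counit.lTensor R ∘ₗ ψ = LinearMap.id
  map_one : ψ 1 = 1 ⊗ₜ U.one
  map_mul : ψ ∘ₗ mul' k R = tensorMul B (mul' k R) U.mul ∘ₗ map ψ ψ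

/-- The action of `H` on a `U`-comodule algebra `R`:
`α = (R ⊗ ⟨ , ⟩) (R ⊗ C_{H,U}) (C_{H,R} ⊗ U) (H ⊗ ψ)`. -/
def alpha : H ⊗[k] R →ₗ[k] R :=
  (TensorProduct.rid k R).toLinearMap ∘ₗ pass B R (U.ev ∘ₗ braid k B H U.carrier) ∘ₗ ψ.lTensor H

/-- The multiplication of `R # H`. -/
def mulRH : (R ⊗[k] H) ⊗[k] (R ⊗[k] H) →ₗ[k] R ⊗[k] H :=
  smashMul B (mul' k R) (mul' k H) Coalgebra.comul (U.alpha ψ)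

variable (R) in
/-- The action of `U` on `R # H`, trivial on `R` and `⇀` on `H`: `(R ⊗ ⇀) (C_{U,R} ⊗ H)`. -/
def hitRH : U.carrier ⊗[k] (R ⊗[k] H) →ₗ[k] R ⊗[k] H :=
  pass B R U.hit

/-- The multiplication of `(R # H) # U`. -/
def mulRHU : ((R ⊗[k] H) ⊗[k] U.carrier) ⊗[k] ((R ⊗[k] H) ⊗[k] U.carrier) →ₗ[k]
    (R ⊗[k] H) ⊗[k] U.carrier :=
  smashMul B (U.mulRH ψ) U.mul U.comul (U.hitRH R)

/-- The multiplication of `H # U`. -/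
def mulHU : (H ⊗[k] U.carrier) ⊗[k] (H ⊗[k] U.carrier) →ₗ[k] H ⊗[k] U.carrier :=
  smashMul B (mul' k H) U.mul U.comul U.hit

variable (R) in
/-- The multiplication of the braided tensor product algebra `R ⊗ (H # U)`. -/
def mulRtensorHU : (R ⊗[k] (H ⊗[k] U.carrier)) ⊗[k] (R ⊗[k] (H ⊗[k] U.carrier)) →ₗ[k]
    R ⊗[k] (H ⊗[k] U.carrier) :=
  tensorMul B (mul' k R) U.mulHU

end BraidedHopfSubalgebra

end BraidedDuality

end

set_option linter.unusedSectionVars false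
set_option linter.unusedSimpArgs false

noncomputable section

namespace BraidedDuality

/-! The argument is carried out inside the braided category of Yetter–Drinfeld modules; the formulas
below suppress the braidings.

Let ρ(f)(x) = ∑ ⟨f, x₁⟩ x₂ be the right regular action of U on H. In R # H one has h r = ∑ r₀
ρ(r₁)(h) (`st_smashTwist`), so (R # H) # U is a twisted product of R with the algebra H # U, and the
theorem untwists it. The isomorphism is Φ(r # h # f) = ∑ r₀ ⊗ γ(r₁)(h # f), for a map γ : U → H # U
that is multiplicative, convolution invertible, and satisfies ∑ γ(f₁)(ρ(f₂)(h) # g) = (h # g) γ(f).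

To find γ, let H # U act on H by λ. This action is multiplicative (`st_lam_mulHU`) and faithful
(`ext_lam`), because h⟨f, x⟩ = ∑ λ(h # f)(x₂) S⁻¹(x₁). Hence the RL-condition provides a unique map
w : U → H # U with λ(w f) = ρ(f) (`rightToLeft`), and one puts γ(f) = w(f ∘ S⁻¹). The required
properties of γ become identities between operators on H. They follow from three facts: ρ reverses
products, ρ commutes with ⇀, and H is a module algebra for both actions in the appropriate sense.

The definition of γ needs U to be stable under f ↦ f ∘ S⁻¹, whereas only stability under f ↦ f ∘ S
is given. The missing stability comes from the RL-condition. The map w is a left H-coaction on U,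
left translation (f · a)(x) = f(a x) is a right H-action, and the two satisfy a Yetter–Drinfeld
compatibility over H (`st_rightToLeft_leftTrans`). So the map D(f) = ∑ f₍₀₎ · S⁻¹(f₍₋₁₎), built from
the coaction w, behaves like the action of a Drinfeld element: D(f · a) = D(f) · S⁻²(a), and D is
onto. If f = D(g), then f(S⁻²(a)) = D(g · a)(1), which as a function of a lies in U
(`antipodeSymm_sq_mem`); composing with S gives f ∘ S⁻¹.

The involutive braiding of H passes to the pairs (U, H) and (U, U) by evaluation. It also makes the
opposite comultiplication, with antipode S⁻¹, a second braided Hopf structure on H.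

Diagrams are encoded as elements of right-nested tensor products: a structure map acts on the head
of the tensor, `𝖫` moves one strand to the right, and `cr` is the braiding at the head. Diagrammatic
identities are then rewriting rules. Equations in U are tested by evaluation (`ext_ev`), equations
in H ⊗ U by λ (`ext_lam`).

The inverse of Φ uses w in place of γ. Multiplicativity is `coactBy_twistedMul`, Φ is a morphism
because it is composed of morphisms, and the algebra axioms for (R # H) # U are pulled back along Φ.
-/

section Instances

variable {k V W : Type*} [CommSemiring k] [AddCommMonoid V] [Module k V] [AddCommMonoid W]
  [Module k W]

/-! Shortcut instances: `map_zero` and `map_add` are slow on nested tensor products without them. -/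

instance : ZeroHomClass (V →ₗ[k] W) V W := inferInstance

instance : AddHomClass (V →ₗ[k] W) V W := inferInstance

instance : ZeroHomClass (V ≃ₗ[k] W) V W := inferInstance

instance : AddHomClass (V ≃ₗ[k] W) V W := inferInstance

end Instances

section Strict

variable {k : Type*} [CommSemiring k]
variable {U V W X Y Z Z' : Type*} [AddCommMonoid U] [Module k U] [AddCommMonoid V] [Module k V]
  [AddCommMonoid W] [Module k W]
  [AddCommMonoid X] [Module k X] [AddCommMonoid Y] [Module k Y] [AddCommMonoid Z] [Module k Z]
  [AddCommMonoid Z'] [Module k Z']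

/-! ### Maps acting on the head of a right-nested tensor product -/

variable (Z) in
/-- `f : V ⊗ W → X` acting on the head of `V ⊗ (W ⊗ Z)`. -/
def head21 (f : V ⊗[k] W →ₗ[k] X) : V ⊗[k] (W ⊗[k] Z) →ₗ[k] X ⊗[k] Z :=
  f.rTensor Z ∘ₗ (TensorProduct.assoc k V W Z).symm.toLinearMap

variable (Z) in
/-- `f : V → W ⊗ X` acting on the head of `V ⊗ Z`. -/
def head12 (f : V →ₗ[k] W ⊗[k] X) : V ⊗[k] Z →ₗ[k] W ⊗[k] (X ⊗[k] Z) :=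
  (TensorProduct.assoc k W X Z).toLinearMap ∘ₗ f.rTensor Z

variable (Z) in
/-- `f : V ⊗ W → X ⊗ Y` acting on the head of `V ⊗ (W ⊗ Z)`. -/
def head22 (f : V ⊗[k] W →ₗ[k] X ⊗[k] Y) : V ⊗[k] (W ⊗[k] Z) →ₗ[k] X ⊗[k] (Y ⊗[k] Z) :=
  (TensorProduct.assoc k X Y Z).toLinearMap ∘ₗ f.rTensor Z ∘ₗ
    (TensorProduct.assoc k V W Z).symm.toLinearMap

variable (Z) in
/-- `f : V ⊗ W → k` acting on the head of `V ⊗ (W ⊗ Z)`. -/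
def head20 (f : V ⊗[k] W →ₗ[k] k) : V ⊗[k] (W ⊗[k] Z) →ₗ[k] Z :=
  (TensorProduct.lid k Z).toLinearMap ∘ₗ f.rTensor Z ∘ₗ
    (TensorProduct.assoc k V W Z).symm.toLinearMap

variable (Z) in
/-- `f : V → k` acting on the head of `V ⊗ Z`. -/
def head10 (f : V →ₗ[k] k) : V ⊗[k] Z →ₗ[k] Z :=
  (TensorProduct.lid k Z).toLinearMap ∘ₗ f.rTensor Z

@[simp] theorem head21_tmul (f : V ⊗[k] W →ₗ[k] X) (v : V) (w : W) (z : Z) :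
    head21 Z f (v ⊗ₜ (w ⊗ₜ z)) = f (v ⊗ₜ w) ⊗ₜ z := rfl

theorem head12_tmul (f : V →ₗ[k] W ⊗[k] X) (v : V) (z : Z) :
    head12 Z f (v ⊗ₜ z) = TensorProduct.assoc k W X Z (f v ⊗ₜ z) := rfl

theorem head22_tmul (f : V ⊗[k] W →ₗ[k] X ⊗[k] Y) (v : V) (w : W) (z : Z) :
    head22 Z f (v ⊗ₜ (w ⊗ₜ z)) = TensorProduct.assoc k X Y Z (f (v ⊗ₜ w) ⊗ₜ z) := rfl

@[simp] theorem head20_tmul (f : V ⊗[k] W →ₗ[k] k) (v : V) (w : W) (z : Z) :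
    head20 Z f (v ⊗ₜ (w ⊗ₜ z)) = f (v ⊗ₜ w) • z := rfl

@[simp] theorem head10_tmul (f : V →ₗ[k] k) (v : V) (z : Z) :
    head10 Z f (v ⊗ₜ z) = f v • z := rfl

/-- This and its companions are the interchange law: operations on disjoint strands commute. They
serve to bring the head operations of a long composite next to each other. -/
theorem head21_lTensor (f : V ⊗[k] W →ₗ[k] X) (g : Z →ₗ[k] Z') (t : V ⊗[k] (W ⊗[k] Z)) :
    head21 Z' f ((g.lTensor W).lTensor V t) = g.lTensor X (head21 Z f t) := by
  induction t with
  | zero => simp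
  | add p q hp hq => simp only [map_add, hp, hq]
  | tmul v s =>
    induction s with
    | zero => simp
    | add p q hp hq => simp only [map_add, tmul_add, hp, hq]
    | tmul w z => simp

theorem assoc_lTensor (g : Z →ₗ[k] Z') (t : (V ⊗[k] W) ⊗[k] Z) :
    TensorProduct.assoc k V W Z' (g.lTensor (V ⊗[k] W) t) =
      (g.lTensor W).lTensor V (TensorProduct.assoc k V W Z t) := by
  induction t with
  | zero => simp
  | add p q hp hq => simp only [map_add, hp, hq]
  | tmul s z =>
    induction s with
    | zero => simp
    | add p q hp hq => simp only [map_add, add_tmul, hp, hq]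
    | tmul v w => simp

theorem head12_lTensor (f : V →ₗ[k] W ⊗[k] X) (g : Z →ₗ[k] Z') (t : V ⊗[k] Z) :
    head12 Z' f (g.lTensor V t) = (g.lTensor X).lTensor W (head12 Z f t) := by
  induction t with
  | zero => simp
  | add p q hp hq => simp only [map_add, hp, hq]
  | tmul v z => simp only [LinearMap.lTensor_tmul, head12_tmul, ← assoc_lTensor]

theorem head22_lTensor (f : V ⊗[k] W →ₗ[k] X ⊗[k] Y) (g : Z →ₗ[k] Z') (t : V ⊗[k] (W ⊗[k] Z)) :
    head22 Z' f ((g.lTensor W).lTensor V t) = (g.lTensor Y).lTensor X (head22 Z f t) := by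
  induction t with
  | zero => simp
  | add p q hp hq => simp only [map_add, hp, hq]
  | tmul v s =>
    induction s with
    | zero => simp
    | add p q hp hq => simp only [map_add, tmul_add, hp, hq]
    | tmul w z => simp only [LinearMap.lTensor_tmul, head22_tmul, ← assoc_lTensor]

theorem head20_lTensor (f : V ⊗[k] W →ₗ[k] k) (g : Z →ₗ[k] Z') (t : V ⊗[k] (W ⊗[k] Z)) :
    head20 Z' f ((g.lTensor W).lTensor V t) = g (head20 Z f t) := by
  induction t with
  | zero => simp
  | add p q hp hq => simp only [map_add, hp, hq]
  | tmul v s =>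
    induction s with
    | zero => simp
    | add p q hp hq => simp only [map_add, tmul_add, hp, hq]
    | tmul w z => simp

theorem head10_lTensor (f : V →ₗ[k] k) (g : Z →ₗ[k] Z') (t : V ⊗[k] Z) :
    head10 Z' f (g.lTensor V t) = g (head10 Z f t) := by
  induction t with
  | zero => simp
  | add p q hp hq => simp only [map_add, hp, hq]
  | tmul v z => simp

theorem rTensor_lTensor_comm (f : V →ₗ[k] W) (g : Z →ₗ[k] Z') (t : V ⊗[k] Z) :
    f.rTensor Z' (g.lTensor V t) = g.lTensor W (f.rTensor Z t) := by
  rw [← LinearMap.comp_apply, ← LinearMap.comp_apply, LinearMap.rTensor_comp_lTensor,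
    LinearMap.lTensor_comp_rTensor]

/-- Induction on three-fold right-nested tensors. -/
theorem tensor3_ext {f g : V ⊗[k] (W ⊗[k] X) →ₗ[k] Y}
    (h : ∀ v w x, f (v ⊗ₜ (w ⊗ₜ x)) = g (v ⊗ₜ (w ⊗ₜ x))) (t) : f t = g t := by
  have : f = g := TensorProduct.ext_threefold' h
  rw [this]

theorem tensor4_ext {f g : V ⊗[k] (W ⊗[k] (X ⊗[k] Z)) →ₗ[k] Y}
    (h : ∀ v w x z, f (v ⊗ₜ (w ⊗ₜ (x ⊗ₜ z))) = g (v ⊗ₜ (w ⊗ₜ (x ⊗ₜ z)))) (t) : f t = g t := by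
  have : f = g := by
    apply TensorProduct.ext'
    intro v s
    exact tensor3_ext (f := f ∘ₗ TensorProduct.mk k V _ v) (g := g ∘ₗ TensorProduct.mk k V _ v)
      (fun w x z => h v w x z) s
  rw [this]

end Strict

section YDTheory

variable {k B : Type*} [Field k] [Ring B] [HopfAlgebra k B]
variable {V W X Y V' W' : Type*} [AddCommMonoid V] [Module k V] [AddCommMonoid W] [Module k W]
  [AddCommMonoid X] [Module k X] [AddCommMonoid Y] [Module k Y]
  [AddCommMonoid V'] [Module k V'] [AddCommMonoid W'] [Module k W']
  [YDData k B V] [YDData k B W] [YDData k B X] [YDData k B Y] [YDData k B V'] [YDData k B W']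

/-! ### The structure maps of Yetter-Drinfeld modules on elements -/

variable (k B V W) in
/-- `(b ⊗ v) ⊗ w ↦ b · w ⊗ v`. -/
def crossAct : (B ⊗[k] V) ⊗[k] W →ₗ[k] W ⊗[k] V :=
  (actMap k B W).rTensor V ∘ₗ (TensorProduct.rightComm k B V W).toLinearMap

@[simp] theorem crossAct_tmul (b : B) (v : V) (w : W) :
    crossAct k B V W ((b ⊗ₜ v) ⊗ₜ w) = actMap k B W (b ⊗ₜ w) ⊗ₜ v := rfl

theorem braid_tmul (v : V) (w : W) :
    braid k B V W (v ⊗ₜ w) = crossAct k B V W (coactMap k B V v ⊗ₜ w) := rfl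

variable (k B V W) in
/-- `(a ⊗ b) ⊗ (v ⊗ w) ↦ a · v ⊗ b · w`. -/
def pairAct : (B ⊗[k] B) ⊗[k] (V ⊗[k] W) →ₗ[k] V ⊗[k] W :=
  map (actMap k B V) (actMap k B W) ∘ₗ (tensorTensorTensorComm k B B V W).toLinearMap

@[simp] theorem pairAct_tmul (a b : B) (v : V) (w : W) :
    pairAct k B V W ((a ⊗ₜ b) ⊗ₜ (v ⊗ₜ w)) = actMap k B V (a ⊗ₜ v) ⊗ₜ actMap k B W (b ⊗ₜ w) := rfl

theorem actMap_tensor (b : B) (t : V ⊗[k] W) :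
    actMap k B (V ⊗[k] W) (b ⊗ₜ t) = pairAct k B V W (comul b ⊗ₜ t) := rfl

variable (k B V W) in
/-- `(a ⊗ v) ⊗ (b ⊗ w) ↦ a b ⊗ (v ⊗ w)`. -/
def pairMul : (B ⊗[k] V) ⊗[k] (B ⊗[k] W) →ₗ[k] B ⊗[k] (V ⊗[k] W) :=
  (mul' k B).rTensor (V ⊗[k] W) ∘ₗ (tensorTensorTensorComm k B V B W).toLinearMap

@[simp] theorem pairMul_tmul (a b : B) (v : V) (w : W) :
    pairMul k B V W ((a ⊗ₜ v) ⊗ₜ (b ⊗ₜ w)) = (a * b) ⊗ₜ (v ⊗ₜ w) := rfl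

theorem coactMap_tensor (v : V) (w : W) :
    coactMap k B (V ⊗[k] W) (v ⊗ₜ w) = pairMul k B V W (coactMap k B V v ⊗ₜ coactMap k B W w) := rfl

theorem actMap_unit (b : B) (c : k) : actMap k B k (b ⊗ₜ c) = counit (R := k) b * c := rfl

theorem coactMap_unit (c : k) : coactMap k B k c = 1 ⊗ₜ c := rfl

/-! ### Closure properties of Yetter-Drinfeld modules and their morphisms -/

namespace IsYD

theorem coassoc_apply (h : IsYD k B V) (v : V) :
    TensorProduct.assoc k B B V (comul.rTensor V (coactMap k B V v)) =
      (coactMap k B V).lTensor B (coactMap k B V v) := LinearMap.congr_fun h.coassoc v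

theorem counit_apply (h : IsYD k B V) (v : V) :
    TensorProduct.lid k V (counit.rTensor V (coactMap k B V v)) = v :=
  LinearMap.congr_fun h.counit_coact v

variable (k B V) in
/-- `(a ⊗ b) ⊗ (c ⊗ v) ↦ a c ⊗ b · v`. -/
def mulAct : (B ⊗[k] B) ⊗[k] (B ⊗[k] V) →ₗ[k] B ⊗[k] V :=
  map (mul' k B) (actMap k B V) ∘ₗ (tensorTensorTensorComm k B B B V).toLinearMap

@[simp] theorem mulAct_tmul (a b c : B) (v : V) :
    mulAct k B V ((a ⊗ₜ b) ⊗ₜ (c ⊗ₜ v)) = (a * c) ⊗ₜ actMap k B V (b ⊗ₜ v) := rfl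

variable (k B V) in
/-- `(a ⊗ b) ⊗ v ↦ (a · v)₍₋₁₎ b ⊗ (a · v)₍₀₎`. -/
def coactMul : (B ⊗[k] B) ⊗[k] V →ₗ[k] B ⊗[k] V :=
  (mul' k B).rTensor V ∘ₗ (TensorProduct.rightComm k B V B).toLinearMap ∘ₗ
      (coactMap k B V ∘ₗ actMap k B V).rTensor B ∘ₗ
      (TensorProduct.rightComm k B B V).toLinearMap

variable (k B V) in
/-- `b ⊗ v ⊗ c ↦ b c ⊗ v`. -/
def mulRight : (B ⊗[k] V) ⊗[k] B →ₗ[k] B ⊗[k] V :=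
  (mul' k B).rTensor V ∘ₗ (TensorProduct.rightComm k B V B).toLinearMap

@[simp] theorem mulRight_tmul (b c : B) (v : V) :
    mulRight k B V ((b ⊗ₜ v) ⊗ₜ c) = (b * c) ⊗ₜ v := rfl

@[simp] theorem coactMul_tmul (a b : B) (v : V) :
    coactMul k B V ((a ⊗ₜ b) ⊗ₜ v) = mulRight k B V (coactMap k B V (actMap k B V (a ⊗ₜ v)) ⊗ₜ b) :=
  rfl

theorem compat_apply (h : IsYD k B V) (b : B) (v : V) :
    mulAct k B V (comul b ⊗ₜ coactMap k B V v) = coactMul k B V (comul b ⊗ₜ v) :=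
  LinearMap.congr_fun h.compat (b ⊗ₜ v)

theorem unit : IsYD k B k where
  one_act v := by simp [actMap_unit]
  mul_act a b v := by simp [actMap_unit, mul_assoc]
  coassoc := by ext; simp [coactMap_unit, Algebra.TensorProduct.one_def]
  counit_coact := by ext; simp [coactMap_unit]
  compat := by
    apply TensorProduct.ext'
    intro b c
    change mulAct k B k (comul b ⊗ₜ (1 ⊗ₜ c)) = coactMul k B k (comul b ⊗ₜ c)
    have h1 : ∀ p : B ⊗[k] B, mulAct k B k (p ⊗ₜ (1 ⊗ₜ c)) =
        (TensorProduct.rid k B (counit.lTensor B p)) ⊗ₜ c := by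
      intro p
      induction p with
      | zero => simp
      | add p q hp hq => simp only [map_add, add_tmul, hp, hq]
      | tmul u v =>
        simp only [mulAct_tmul, mul_one, actMap_unit, LinearMap.lTensor_tmul,
          TensorProduct.rid_tmul, TensorProduct.smul_tmul, smul_eq_mul]
    have h2 : ∀ p : B ⊗[k] B, coactMul k B k (p ⊗ₜ c) =
        (TensorProduct.lid k B (counit.rTensor B p)) ⊗ₜ c := by
      intro p
      induction p with
      | zero => simp
      | add p q hp hq => simp only [map_add, add_tmul, hp, hq]
      | tmul u v => simp [actMap_unit, coactMap_unit, ← smul_eq_mul, tmul_smul, smul_tmul']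
    rw [h1, h2]
    simp

/-- Only the compatibility condition needs care: the action of b splits into three parts, and the
conditions for V and for W apply to overlapping pairs of them. -/
theorem tensor (hV : IsYD k B V) (hW : IsYD k B W) : IsYD k B (V ⊗[k] W) where
  one_act t := by
    rw [actMap_tensor, Bialgebra.comul_one]
    induction t with
    | zero => simp
    | add p q hp hq => simp only [map_add, tmul_add, hp, hq]
    | tmul v w => simp [Algebra.TensorProduct.one_def, hV.one_act, hW.one_act]
  mul_act a b t := by
    simp only [actMap_tensor, Bialgebra.comul_mul]
    generalize (comul a : B ⊗[k] B) = p
    generalize (comul b : B ⊗[k] B) = q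
    induction t with
    | zero => simp
    | add s t hs ht => simp only [map_add, tmul_add, hs, ht]
    | tmul v w =>
      induction p with
      | zero => simp
      | add p p' hp hp' => simp only [map_add, add_mul, add_tmul, hp, hp']
      | tmul a a' =>
        induction q with
        | zero => simp
        | add q q' hq hq' => simp only [map_add, tmul_add, mul_add, add_tmul, hq, hq']
        | tmul b b' => simp [hV.mul_act, hW.mul_act]
  coassoc := by
    apply TensorProduct.ext'
    intro v w
    simp only [LinearMap.comp_apply, LinearEquiv.coe_coe, coactMap_tensor]
    have h1 : ∀ (p : B ⊗[k] V) (q : B ⊗[k] W),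
        TensorProduct.assoc k B B (V ⊗[k] W) (comul.rTensor _ (pairMul k B V W (p ⊗ₜ q))) =
        (pairMul k B V W).lTensor B ((pairMul k B (B ⊗[k] V) (B ⊗[k] W))
          (TensorProduct.assoc k B B V (comul.rTensor V p) ⊗ₜ[k]
            TensorProduct.assoc k B B W (comul.rTensor W q))) := by
      intro p q
      induction p with
      | zero => simp
      | add p p' hp hp' => simp only [map_add, add_tmul, hp, hp']
      | tmul b v =>
        induction q with
        | zero => simp
        | add q q' hq hq' => simp only [map_add, tmul_add, hq, hq']
        | tmul c w =>
          simp only [pairMul_tmul, LinearMap.rTensor_tmul, Bialgebra.comul_mul]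
          generalize (comul b : B ⊗[k] B) = p
          generalize (comul c : B ⊗[k] B) = q
          induction p with
          | zero => simp
          | add p p' hp hp' => simp only [map_add, add_mul, add_tmul, hp, hp']
          | tmul a a' =>
            induction q with
            | zero => simp
            | add q q' hq hq' => simp only [map_add, tmul_add, mul_add, add_tmul, hq, hq']
            | tmul b b' => simp
    have h2 : ∀ (p : B ⊗[k] V) (q : B ⊗[k] W),
        (coactMap k B (V ⊗[k] W)).lTensor B (pairMul k B V W (p ⊗ₜ q)) =
        (pairMul k B V W).lTensor B ((pairMul k B (B ⊗[k] V) (B ⊗[k] W))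
          ((coactMap k B V).lTensor B p ⊗ₜ[k] (coactMap k B W).lTensor B q)) := by
      intro p q
      induction p with
      | zero => simp
      | add p p' hp hp' => simp only [map_add, add_tmul, hp, hp']
      | tmul b v =>
        induction q with
        | zero => simp
        | add q q' hq hq' => simp only [map_add, tmul_add, hq, hq']
        | tmul c w => simp [coactMap_tensor]
    rw [h1, h2, hV.coassoc_apply, hW.coassoc_apply]
  counit_coact := by
    apply TensorProduct.ext'
    intro v w
    simp only [LinearMap.comp_apply, LinearEquiv.coe_coe, coactMap_tensor, LinearMap.id_apply]
    have h1 : ∀ (p : B ⊗[k] V) (q : B ⊗[k] W),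
        TensorProduct.lid k (V ⊗[k] W) (counit.rTensor _ (pairMul k B V W (p ⊗ₜ q))) =
        TensorProduct.lid k V (counit.rTensor V p) ⊗ₜ[k]
          TensorProduct.lid k W (counit.rTensor W q) := by
      intro p q
      induction p with
      | zero => simp
      | add p p' hp hp' => simp only [map_add, add_tmul, hp, hp']
      | tmul b v =>
        induction q with
        | zero => simp
        | add q q' hq hq' => simp only [map_add, tmul_add, hq, hq']
        | tmul c w => simp [smul_tmul', tmul_smul, smul_smul, mul_comm]
    rw [h1, hV.counit_apply, hW.counit_apply]
  compat := by
    apply TensorProduct.ext'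
    intro b t
    change mulAct k B (V ⊗[k] W) (comul b ⊗ₜ coactMap k B _ t) =
      coactMul k B (V ⊗[k] W) (comul b ⊗ₜ t)
    induction t with
    | zero => simp
    | add s t hs ht => simp only [map_add, tmul_add, hs, ht]
    | tmul v w =>
      rw [coactMap_tensor]
      let F : B ⊗[k] B →ₗ[k] B ⊗[k] V :=
        mulAct k B V ∘ₗ (TensorProduct.mk k _ _).flip (coactMap k B V v)
      let F₁ : B ⊗[k] B →ₗ[k] B ⊗[k] V := coactMul k B V ∘ₗ (TensorProduct.mk k _ _).flip v
      let F₂ : B →ₗ[k] B ⊗[k] V :=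
        coactMap k B V ∘ₗ actMap k B V ∘ₗ (TensorProduct.mk k _ _).flip v
      let G : B →ₗ[k] B ⊗[k] W := mulAct k B W ∘ₗ
        (TensorProduct.mk k _ _).flip (coactMap k B W w) ∘ₗ TensorProduct.mk k B B 1
      let G₁ : B ⊗[k] B →ₗ[k] B ⊗[k] W :=
        mulAct k B W ∘ₗ (TensorProduct.mk k _ _).flip (coactMap k B W w)
      let G₂ : B ⊗[k] B →ₗ[k] B ⊗[k] W := coactMul k B W ∘ₗ (TensorProduct.mk k _ _).flip w
      have hF : F ∘ₗ comul = F₁ ∘ₗ comul := LinearMap.ext fun x => hV.compat_apply x v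
      have hG : G₁ ∘ₗ comul = G₂ ∘ₗ comul := LinearMap.ext fun x => hW.compat_apply x w
      have h1 : ∀ p : B ⊗[k] B, mulAct k B (V ⊗[k] W)
          (p ⊗ₜ pairMul k B V W (coactMap k B V v ⊗ₜ coactMap k B W w)) =
          pairMul k B V W (map F G ((TensorProduct.assoc k B B B).symm (comul.lTensor B p))) := by
        intro p
        induction p with
        | zero => simp
        | add p p' hp hp' => simp only [map_add, add_tmul, hp, hp']
        | tmul d e =>
          simp only [LinearMap.lTensor_tmul, F, G]
          generalize coactMap k B V v = p
          generalize coactMap k B W w = q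
          induction p with
          | zero => simp
          | add p p' hp hp' =>
            simp only [map_add, add_tmul, tmul_add, hp, hp', LinearMap.comp_add,
              TensorProduct.map_add_left, LinearMap.add_apply]
          | tmul x v =>
            induction q with
            | zero => simp
            | add p p' hp hp' =>
              simp only [map_add, add_tmul, tmul_add, hp, hp', LinearMap.comp_add,
                LinearMap.add_comp, TensorProduct.map_add_right, LinearMap.add_apply]
            | tmul y w =>
              rw [pairMul_tmul, mulAct_tmul, actMap_tensor]
              generalize (comul e : B ⊗[k] B) = r
              induction r with
              | zero => simp
              | add p p' hp hp' => simp only [map_add, add_tmul, tmul_add, hp, hp']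
              | tmul b c => simp [mul_assoc]
      have h2 : ∀ p : B ⊗[k] B,
          pairMul k B V W (map F₁ G ((TensorProduct.assoc k B B B).symm (comul.lTensor B p))) =
          pairMul k B V W (map F₂ (G₁ ∘ₗ comul) p) := by
        intro p
        induction p with
        | zero => simp
        | add p p' hp hp' => simp only [map_add, hp, hp']
        | tmul d e =>
          simp only [LinearMap.lTensor_tmul, map_tmul, LinearMap.comp_apply]
          generalize (comul e : B ⊗[k] B) = r
          induction r with
          | zero => simp
          | add p p' hp hp' => simp only [map_add, tmul_add, hp, hp']
          | tmul b c =>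
            simp only [G, G₁, F₁, F₂, TensorProduct.assoc_symm_tmul, map_tmul,
              LinearMap.comp_apply, LinearMap.flip_apply, TensorProduct.mk_apply, coactMul_tmul]
            generalize coactMap k B V (actMap k B V (d ⊗ₜ v)) = p
            generalize coactMap k B W w = q
            induction p with
            | zero => simp
            | add p p' hp hp' => simp only [map_add, add_tmul, hp, hp']
            | tmul x v =>
              induction q with
              | zero => simp
              | add p p' hp hp' => simp only [map_add, tmul_add, hp, hp']
              | tmul y w => simp [mul_assoc]
      have h3 : ∀ p : B ⊗[k] B, coactMul k B (V ⊗[k] W) (p ⊗ₜ (v ⊗ₜ w)) =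
          pairMul k B V W (map F₂ G₂ (TensorProduct.assoc k B B B (comul.rTensor B p))) := by
        intro p
        induction p with
        | zero => simp
        | add p p' hp hp' => simp only [map_add, add_tmul, hp, hp']
        | tmul d e =>
          rw [coactMul_tmul, actMap_tensor, LinearMap.rTensor_tmul]
          generalize (comul d : B ⊗[k] B) = r
          induction r with
          | zero => simp
          | add p p' hp hp' => simp only [map_add, add_tmul, hp, hp']
          | tmul b c =>
            simp only [G₂, F₂, TensorProduct.assoc_tmul, map_tmul, pairAct_tmul, coactMap_tensor,
              LinearMap.comp_apply, LinearMap.flip_apply, TensorProduct.mk_apply, coactMul_tmul]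
            generalize coactMap k B V (actMap k B V (b ⊗ₜ v)) = p
            generalize coactMap k B W (actMap k B W (c ⊗ₜ w)) = q
            induction p with
            | zero => simp
            | add p p' hp hp' => simp only [map_add, add_tmul, hp, hp']
            | tmul x v =>
              induction q with
              | zero => simp
              | add p p' hp hp' => simp only [map_add, add_tmul, tmul_add, hp, hp']
              | tmul y w => simp [mul_assoc]
      have h4 : ∀ (F : B ⊗[k] B →ₗ[k] B ⊗[k] V) (p : B ⊗[k] B),
          map F G (comul.rTensor B p) = map (F ∘ₗ comul) G p := by
        intro F p
        rw [LinearMap.rTensor, ← LinearMap.comp_apply, ← TensorProduct.map_comp, LinearMap.comp_id]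
      have h5 : ∀ (G : B ⊗[k] B →ₗ[k] B ⊗[k] W) (p : B ⊗[k] B),
          map F₂ G (comul.lTensor B p) = map F₂ (G ∘ₗ comul) p := by
        intro G p
        rw [LinearMap.lTensor, ← LinearMap.comp_apply, ← TensorProduct.map_comp, LinearMap.comp_id]
      -- The condition for V is used on the first two legs of the iterated comultiplication; after
      -- rebracketing, the condition for W is used on the last two.
      rw [h1, Coalgebra.coassoc_symm_apply, h4, hF, ← h4, ← Coalgebra.coassoc_symm_apply, h2, hG,
        ← h5, ← Coalgebra.coassoc_apply, h3]

end IsYD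
end YDTheory

section YDHoms

variable {k B : Type*} [Field k] [Ring B] [HopfAlgebra k B]
variable {V W X Y V' W' Z : Type*} [AddCommMonoid V] [Module k V] [AddCommMonoid W] [Module k W]
  [AddCommMonoid X] [Module k X] [AddCommMonoid Y] [Module k Y]
  [AddCommMonoid V'] [Module k V'] [AddCommMonoid W'] [Module k W'] [AddCommMonoid Z] [Module k Z]
  [YDData k B V] [YDData k B W] [YDData k B X] [YDData k B Y] [YDData k B V'] [YDData k B W']

namespace IsYDHom

theorem id : IsYDHom k B (LinearMap.id : V →ₗ[k] V) where
  map_act _ _ := rfl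
  map_coact v := by simp

theorem comp {g : W →ₗ[k] X} {f : V →ₗ[k] W} (hg : IsYDHom k B g) (hf : IsYDHom k B f) :
    IsYDHom k B (g ∘ₗ f) where
  map_act b v := by simp [hf.map_act, hg.map_act]
  map_coact v := by simp [hf.map_coact, hg.map_coact, LinearMap.lTensor_comp]

theorem tensorMap {f : V →ₗ[k] V'} {g : W →ₗ[k] W'} (hf : IsYDHom k B f) (hg : IsYDHom k B g) :
    IsYDHom k B (map f g) where
  map_act b t := by
    simp only [actMap_tensor]
    generalize (comul b : B ⊗[k] B) = p
    induction t with
    | zero => simp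
    | add s t hs ht => simp only [map_add, tmul_add, hs, ht]
    | tmul v w =>
      induction p with
      | zero => simp
      | add p p' hp hp' => simp only [map_add, add_tmul, hp, hp']
      | tmul a a' => simp [hf.map_act, hg.map_act]
  map_coact t := by
    induction t with
    | zero => simp
    | add s t hs ht => simp only [map_add, hs, ht]
    | tmul v w =>
      simp only [map_tmul, coactMap_tensor, hf.map_coact, hg.map_coact]
      generalize coactMap k B V v = p
      generalize coactMap k B W w = q
      induction p with
      | zero => simp
      | add p p' hp hp' => simp only [map_add, add_tmul, hp, hp']
      | tmul x v =>
        induction q with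
        | zero => simp
        | add p p' hp hp' => simp only [map_add, tmul_add, hp, hp']
        | tmul y w => simp

theorem lTensor {g : W →ₗ[k] W'} (hg : IsYDHom k B g) : IsYDHom k B (g.lTensor V) :=
  id.tensorMap hg

theorem rTensor {f : V →ₗ[k] V'} (hf : IsYDHom k B f) : IsYDHom k B (f.rTensor W) :=
  hf.tensorMap id

theorem symm {e : V ≃ₗ[k] W} (he : IsYDHom k B e.toLinearMap) :
    IsYDHom k B e.symm.toLinearMap where
  map_act b w := by
    apply e.injective
    have := he.map_act b (e.symm w)
    simp_all
  map_coact w := by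
    have := he.map_coact (e.symm w)
    simp only [LinearEquiv.coe_coe, LinearEquiv.apply_symm_apply] at this ⊢
    rw [this, ← LinearMap.lTensor_comp_apply]
    simp

theorem assoc : IsYDHom k B (TensorProduct.assoc k V W X).toLinearMap where
  map_act b t := by
    simp only [LinearEquiv.coe_coe]
    have h1 : ∀ (p : B ⊗[k] B) (t : (V ⊗[k] W) ⊗[k] X),
        TensorProduct.assoc k V W X (pairAct k B (V ⊗[k] W) X (p ⊗ₜ t)) =
        map (actMap k B V) (map (actMap k B W) (actMap k B X) ∘ₗ
            (tensorTensorTensorComm k B B W X).toLinearMap)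
          (tensorTensorTensorComm k B (B ⊗[k] B) V (W ⊗[k] X)
            (TensorProduct.assoc k B B B (comul.rTensor B p) ⊗ₜ
            TensorProduct.assoc k V W X t)) := by
      intro p t
      induction t with
      | zero => simp
      | add s t hs ht => simp only [map_add, tmul_add, hs, ht]
      | tmul s x =>
        induction s with
        | zero => simp
        | add s t hs ht => simp only [map_add, tmul_add, add_tmul, hs, ht]
        | tmul v w =>
          induction p with
          | zero => simp
          | add p p' hp hp' => simp only [map_add, add_tmul, hp, hp']
          | tmul a c =>
            rw [pairAct_tmul, LinearMap.rTensor_tmul, actMap_tensor]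
            generalize (comul a : B ⊗[k] B) = r
            induction r with
            | zero => simp
            | add p p' hp hp' => simp only [map_add, add_tmul, hp, hp']
            | tmul a b => simp
    have h2 : ∀ (p : B ⊗[k] B) (t : V ⊗[k] (W ⊗[k] X)),
        pairAct k B V (W ⊗[k] X) (p ⊗ₜ t) =
        map (actMap k B V) (map (actMap k B W) (actMap k B X) ∘ₗ
            (tensorTensorTensorComm k B B W X).toLinearMap)
          (tensorTensorTensorComm k B (B ⊗[k] B) V (W ⊗[k] X) (comul.lTensor B p ⊗ₜ t)) := by
      intro p t
      induction t with
      | zero => simp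
      | add s t hs ht => simp only [map_add, tmul_add, hs, ht]
      | tmul v s =>
        induction s with
        | zero => simp
        | add s t hs ht => simp only [map_add, tmul_add, hs, ht]
        | tmul w x =>
          induction p with
          | zero => simp
          | add p p' hp hp' => simp only [map_add, add_tmul, hp, hp']
          | tmul a c =>
            rw [pairAct_tmul, LinearMap.lTensor_tmul, actMap_tensor]
            rfl
    rw [actMap_tensor, actMap_tensor, h1, h2, Coalgebra.coassoc_apply]
  map_coact t := by
    simp only [LinearEquiv.coe_coe]
    induction t with
    | zero => simp
    | add s t hs ht => simp only [map_add, hs, ht]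
    | tmul s x =>
      induction s with
      | zero => simp
      | add s t hs ht => simp only [map_add, add_tmul, hs, ht]
      | tmul v w =>
        simp only [TensorProduct.assoc_tmul, coactMap_tensor]
        generalize coactMap k B V v = p
        generalize coactMap k B W w = q
        generalize coactMap k B X x = r
        induction p with
        | zero => simp
        | add p p' hp hp' => simp only [map_add, add_tmul, hp, hp']
        | tmul a v =>
          induction q with
          | zero => simp
          | add p p' hp hp' => simp only [map_add, add_tmul, tmul_add, hp, hp']
          | tmul b w =>
            induction r with
            | zero => simp
            | add p p' hp hp' => simp only [map_add, tmul_add, hp, hp']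
            | tmul c x => simp [mul_assoc]

theorem lid : IsYDHom k B (TensorProduct.lid k V).toLinearMap where
  map_act b t := by
    simp only [LinearEquiv.coe_coe]
    induction t with
    | zero => simp
    | add s t hs ht => simp only [map_add, tmul_add, hs, ht]
    | tmul c v =>
      have h : ∀ p : B ⊗[k] B, TensorProduct.lid k V (pairAct k B k V (p ⊗ₜ (c ⊗ₜ v))) =
          c • actMap k B V (TensorProduct.lid k B (counit.rTensor B p) ⊗ₜ v) := by
        intro p
        induction p with
        | zero => simp
        | add p p' hp hp' => simp only [map_add, add_tmul, smul_add, hp, hp']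
        | tmul a b => simp [actMap_unit, smul_smul, ← smul_tmul', mul_comm]
      rw [actMap_tensor, h]
      simp
  map_coact t := by
    simp only [LinearEquiv.coe_coe]
    induction t with
    | zero => simp
    | add s t hs ht => simp only [map_add, hs, ht]
    | tmul c v =>
      rw [coactMap_tensor, coactMap_unit, TensorProduct.lid_tmul, map_smul]
      generalize coactMap k B V v = p
      induction p with
      | zero => simp
      | add p p' hp hp' => simp only [map_add, tmul_add, smul_add, hp, hp']
      | tmul x v => simp

theorem rid : IsYDHom k B (TensorProduct.rid k V).toLinearMap where
  map_act b t := by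
    simp only [LinearEquiv.coe_coe]
    induction t with
    | zero => simp
    | add s t hs ht => simp only [map_add, tmul_add, hs, ht]
    | tmul v c =>
      have h : ∀ p : B ⊗[k] B, TensorProduct.rid k V (pairAct k B V k (p ⊗ₜ (v ⊗ₜ c))) =
          c • actMap k B V (TensorProduct.rid k B (counit.lTensor B p) ⊗ₜ v) := by
        intro p
        induction p with
        | zero => simp
        | add p p' hp hp' => simp only [map_add, add_tmul, smul_add, hp, hp']
        | tmul a b => simp [actMap_unit, smul_smul, ← smul_tmul', mul_comm]
      rw [actMap_tensor, h]
      simp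
  map_coact t := by
    simp only [LinearEquiv.coe_coe]
    induction t with
    | zero => simp
    | add s t hs ht => simp only [map_add, hs, ht]
    | tmul v c =>
      rw [coactMap_tensor, coactMap_unit, TensorProduct.rid_tmul, map_smul]
      generalize coactMap k B V v = p
      induction p with
      | zero => simp
      | add p p' hp hp' => simp only [map_add, add_tmul, smul_add, hp, hp']
      | tmul x v => simp

/-- Linearity comes from the Yetter–Drinfeld condition on V, colinearity from the one on W. -/
theorem braid (hV : IsYD k B V) (hW : IsYD k B W) : IsYDHom k B (braid k B V W) where
  map_act b t := by
    induction t with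
    | zero => simp
    | add s t hs ht => simp only [map_add, tmul_add, hs, ht]
    | tmul v w =>
      rw [actMap_tensor, braid_tmul, actMap_tensor]
      have h1 : ∀ p : B ⊗[k] B, BraidedDuality.braid k B V W (pairAct k B V W (p ⊗ₜ (v ⊗ₜ w))) =
          crossAct k B V W (IsYD.coactMul k B V (p ⊗ₜ v) ⊗ₜ w) := by
        intro p
        induction p with
        | zero => simp
        | add p p' hp hp' => simp only [map_add, add_tmul, hp, hp']
        | tmul a b =>
          rw [pairAct_tmul, braid_tmul, IsYD.coactMul_tmul]
          generalize coactMap k B V (actMap k B V (a ⊗ₜ v)) = q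
          induction q with
          | zero => simp
          | add p p' hp hp' => simp only [map_add, add_tmul, hp, hp']
          | tmul x v => simp [hW.mul_act]
      rw [h1, ← hV.compat_apply]
      generalize (comul b : B ⊗[k] B) = p
      generalize coactMap k B V v = q
      induction p with
      | zero => simp
      | add p p' hp hp' => simp only [map_add, add_tmul, hp, hp']
      | tmul x y =>
        induction q with
        | zero => simp
        | add p p' hp hp' => simp only [map_add, add_tmul, tmul_add, hp, hp']
        | tmul a v => simp [hW.mul_act]
  map_coact t := by
    induction t with
    | zero => simp
    | add s t hs ht => simp only [map_add, hs, ht]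
    | tmul v w =>
      rw [braid_tmul, coactMap_tensor]
      let F : B ⊗[k] B →ₗ[k] B ⊗[k] W := IsYD.coactMul k B W ∘ₗ (TensorProduct.mk k _ _).flip w
      let G : B ⊗[k] B →ₗ[k] B ⊗[k] W :=
        IsYD.mulAct k B W ∘ₗ (TensorProduct.mk k _ _).flip (coactMap k B W w)
      have hFG : F ∘ₗ comul = G ∘ₗ comul := LinearMap.ext fun x => (hW.compat_apply x w).symm
      have h1 : ∀ p : B ⊗[k] V, coactMap k B (W ⊗[k] V) (crossAct k B V W (p ⊗ₜ w)) =
          TensorProduct.assoc k B W V (map F LinearMap.id ((TensorProduct.assoc k B B V).symm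
              ((coactMap k B V).lTensor B p))) := by
        intro p
        induction p with
        | zero => simp
        | add p p' hp hp' => simp only [map_add, add_tmul, hp, hp']
        | tmul b v =>
          simp only [crossAct_tmul, coactMap_tensor, LinearMap.lTensor_tmul]
          generalize coactMap k B V v = q
          induction q with
          | zero => simp
          | add p p' hp hp' => simp only [map_add, tmul_add, hp, hp']
          | tmul c v =>
            simp only [TensorProduct.assoc_symm_tmul, map_tmul, F, LinearMap.comp_apply,
              LinearMap.flip_apply, TensorProduct.mk_apply, IsYD.coactMul_tmul]
            generalize coactMap k B W (actMap k B W (b ⊗ₜ w)) = r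
            induction r with
            | zero => simp
            | add p p' hp hp' => simp only [map_add, add_tmul, hp, hp']
            | tmul d w => simp
      have h2 : ∀ p : B ⊗[k] V, TensorProduct.assoc k B W V (map G LinearMap.id
          ((TensorProduct.assoc k B B V).symm ((coactMap k B V).lTensor B p))) =
          (BraidedDuality.braid k B V W).lTensor B (pairMul k B V W (p ⊗ₜ coactMap k B W w)) := by
        intro p
        simp only [G]
        generalize coactMap k B W w = r
        induction p with
        | zero => simp
        | add p p' hp hp' => simp only [map_add, add_tmul, hp, hp']
        | tmul b v =>
          induction r with
          | zero => simp
          | add p p' hp hp' =>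
            simp only [map_add, tmul_add, ← hp, ← hp', LinearMap.comp_add,
              TensorProduct.map_add_left, LinearMap.add_apply]
          | tmul d w =>
            simp only [pairMul_tmul, LinearMap.lTensor_tmul, braid_tmul]
            generalize coactMap k B V v = q
            induction q with
            | zero => simp
            | add p p' hp hp' => simp only [map_add, add_tmul, tmul_add, hp, hp']
            | tmul c v => simp
      have h3 : ∀ (F : B ⊗[k] B →ₗ[k] B ⊗[k] W) (p : B ⊗[k] V),
          map F LinearMap.id (comul.rTensor V p) = map (F ∘ₗ comul) LinearMap.id p := by
        intro F p
        rw [LinearMap.rTensor, ← LinearMap.comp_apply, ← TensorProduct.map_comp, LinearMap.comp_id]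
      rw [h1, ← h2, ← hV.coassoc_apply, LinearEquiv.symm_apply_apply, h3, h3, hFG]

end IsYDHom

/-! ### Naturality of the braiding and the hexagon identities. -/

theorem braid_natural {f : V →ₗ[k] V'} {g : W →ₗ[k] W'} (hf : IsYDHom k B f) (hg : IsYDHom k B g)
    (t : V ⊗[k] W) : braid k B V' W' (map f g t) = map g f (braid k B V W t) := by
  induction t with
  | zero => simp
  | add s t hs ht => simp only [map_add, hs, ht]
  | tmul v w =>
    rw [map_tmul, braid_tmul, braid_tmul, hf.map_coact]
    generalize coactMap k B V v = p
    induction p with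
    | zero => simp
    | add p p' hp hp' => simp only [map_add, add_tmul, hp, hp']
    | tmul x v => simp [hg.map_act]

/-- The hexagon for `C_{V ⊗ W, X}`. -/
theorem braid_tensor_left (hX : IsYD k B X) (t : V ⊗[k] (W ⊗[k] X)) :
    braid k B (V ⊗[k] W) X ((TensorProduct.assoc k V W X).symm t) =
      head22 W (braid k B V X) ((braid k B W X).lTensor V t) := by
  induction t with
  | zero => simp
  | add s t hs ht => simp only [map_add, hs, ht]
  | tmul v s =>
    induction s with
    | zero => simp
    | add s t hs ht => simp only [map_add, tmul_add, hs, ht]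
    | tmul w x =>
      rw [TensorProduct.assoc_symm_tmul, braid_tmul, coactMap_tensor, LinearMap.lTensor_tmul,
        braid_tmul]
      generalize coactMap k B W w = q
      induction q with
      | zero => simp
      | add p p' hp hp' => simp only [map_add, add_tmul, tmul_add, hp, hp']
      | tmul b w =>
        rw [crossAct_tmul, head22_tmul, braid_tmul]
        generalize coactMap k B V v = q
        induction q with
        | zero => simp
        | add p p' hp hp' => simp only [map_add, add_tmul, tmul_add, hp, hp']
        | tmul a w => simp [hX.mul_act]

/-- The hexagon for `C_{V, W ⊗ X}`. -/
theorem braid_tensor_right (hV : IsYD k B V) (t : V ⊗[k] (W ⊗[k] X)) :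
    TensorProduct.assoc k W X V (braid k B V (W ⊗[k] X) t) =
      (braid k B V X).lTensor W (head22 X (braid k B V W) t) := by
  induction t with
  | zero => simp
  | add s t hs ht => simp only [map_add, hs, ht]
  | tmul v s =>
    induction s with
    | zero => simp
    | add s t hs ht => simp only [map_add, tmul_add, hs, ht]
    | tmul w x =>
      have h1 : ∀ p : B ⊗[k] V, TensorProduct.assoc k W X V
          (crossAct k B V (W ⊗[k] X) (p ⊗ₜ (w ⊗ₜ x))) =
          TensorProduct.assoc k W X V (map (pairAct k B W X ∘ₗ
            (TensorProduct.mk k _ _).flip (w ⊗ₜ x)) LinearMap.id ((TensorProduct.assoc k B B V).symm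
              (TensorProduct.assoc k B B V (comul.rTensor V p)))) := by
        intro p
        induction p with
        | zero => simp
        | add p p' hp hp' => simp only [map_add, add_tmul, hp, hp']
        | tmul a v => simp [actMap_tensor]
      have h2 : ∀ p : B ⊗[k] V, TensorProduct.assoc k W X V (map (pairAct k B W X ∘ₗ
            (TensorProduct.mk k _ _).flip (w ⊗ₜ x)) LinearMap.id ((TensorProduct.assoc k B B V).symm
              ((coactMap k B V).lTensor B p))) =
          (braid k B V X).lTensor W (TensorProduct.assoc k W V X
            (crossAct k B V W (p ⊗ₜ w) ⊗ₜ x)) := by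
        intro p
        induction p with
        | zero => simp
        | add p p' hp hp' => simp only [map_add, add_tmul, hp, hp']
        | tmul a v =>
          simp only [LinearMap.lTensor_tmul, crossAct_tmul, TensorProduct.assoc_tmul, braid_tmul]
          generalize coactMap k B V v = q
          induction q with
          | zero => simp
          | add p p' hp hp' => simp only [map_add, add_tmul, tmul_add, hp, hp']
          | tmul b v => simp
      rw [braid_tmul, h1, hV.coassoc_apply, h2, head22_tmul, braid_tmul]

end YDHoms

/-! ### Crossings at the head of a nested tensor: sliding morphisms through strands. -/

section Crossing

variable {k : Type*} (B : Type*) [Field k] [Ring B] [HopfAlgebra k B]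
variable {V W X Y V' W' Z Z' : Type*} [AddCommMonoid V] [Module k V] [AddCommMonoid W] [Module k W]
  [AddCommMonoid X] [Module k X] [AddCommMonoid Y] [Module k Y]
  [AddCommMonoid V'] [Module k V'] [AddCommMonoid W'] [Module k W'] [AddCommMonoid Z] [Module k Z]
  [AddCommMonoid Z'] [Module k Z']
  [YDData k B V] [YDData k B W] [YDData k B X] [YDData k B Y] [YDData k B V'] [YDData k B W']

/-- The braiding acting on the head of `V ⊗ (W ⊗ Z)`. -/
def cr : V ⊗[k] (W ⊗[k] Z) →ₗ[k] W ⊗[k] (V ⊗[k] Z) :=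
  head22 Z (braid k B V W)

variable {B}

theorem cr_tmul (v : V) (w : W) (z : Z) :
    cr B (v ⊗ₜ[k] (w ⊗ₜ[k] z)) = TensorProduct.assoc k W V Z (braid k B V W (v ⊗ₜ w) ⊗ₜ z) := rfl

theorem cr_lTensor (g : Z →ₗ[k] Z') (t : V ⊗[k] (W ⊗[k] Z)) :
    cr B ((g.lTensor W).lTensor V t) = (g.lTensor V).lTensor W (cr B t) :=
  head22_lTensor _ _ _

theorem assoc_map_tmul (f : V →ₗ[k] V') (g : W →ₗ[k] W') (t : V ⊗[k] W) (z : Z) :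
    TensorProduct.assoc k V' W' Z (map f g t ⊗ₜ z) =
      map f (g.rTensor Z) (TensorProduct.assoc k V W Z (t ⊗ₜ z)) := by
  induction t with
  | zero => simp
  | add s t hs ht => simp only [map_add, add_tmul, hs, ht]
  | tmul v w => simp

theorem cr_left {f : V →ₗ[k] V'} (hf : IsYDHom k B f) (t : V ⊗[k] (W ⊗[k] Z)) :
    cr B (f.rTensor _ t) = (f.rTensor Z).lTensor W (cr B t) := by
  refine tensor3_ext (f := cr B ∘ₗ f.rTensor _) (g := (f.rTensor Z).lTensor W ∘ₗ cr B) ?_ t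
  intro v w z
  have := braid_natural hf (IsYDHom.id : IsYDHom k B (LinearMap.id : W →ₗ[k] W)) (v ⊗ₜ w)
  simp only [map_tmul, LinearMap.id_apply] at this
  simp only [LinearMap.comp_apply, LinearMap.rTensor_tmul, cr_tmul, this, assoc_map_tmul]
  rfl

theorem cr_right {g : W →ₗ[k] W'} (hg : IsYDHom k B g) (t : V ⊗[k] (W ⊗[k] Z)) :
    cr B ((g.rTensor Z).lTensor V t) = g.rTensor _ (cr B t) := by
  refine tensor3_ext (f := cr B ∘ₗ (g.rTensor Z).lTensor V) (g := g.rTensor _ ∘ₗ cr B) ?_ t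
  intro v w z
  have := braid_natural (IsYDHom.id : IsYDHom k B (LinearMap.id : V →ₗ[k] V)) hg (v ⊗ₜ w)
  simp only [map_tmul, LinearMap.id_apply] at this
  simp only [LinearMap.comp_apply, LinearMap.rTensor_tmul, LinearMap.lTensor_tmul, cr_tmul, this,
    assoc_map_tmul, LinearMap.rTensor_id]
  rfl

theorem cr_tensor_left (hX : IsYD k B X) (t : V ⊗[k] (W ⊗[k] (X ⊗[k] Z))) :
    cr B ((TensorProduct.assoc k V W _).symm t) =
      (TensorProduct.assoc k V W Z).symm.toLinearMap.lTensor X (cr B ((cr B).lTensor V t)) := by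
  refine tensor4_ext (f := cr B ∘ₗ (TensorProduct.assoc k V W _).symm.toLinearMap)
    (g := (TensorProduct.assoc k V W Z).symm.toLinearMap.lTensor X ∘ₗ cr B ∘ₗ
      (cr B).lTensor V) ?_ t
  intro v w x z
  simp only [LinearMap.comp_apply, LinearEquiv.coe_coe, TensorProduct.assoc_symm_tmul, cr_tmul,
    LinearMap.lTensor_tmul]
  have := braid_tensor_left (B := B) hX (v ⊗ₜ[k] (w ⊗ₜ[k] x))
  rw [TensorProduct.assoc_symm_tmul] at this
  rw [this, LinearMap.lTensor_tmul]
  generalize braid k B W X (w ⊗ₜ x) = p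
  induction p with
  | zero => simp
  | add s t hs ht => simp only [map_add, add_tmul, tmul_add, hs, ht]
  | tmul x w =>
    simp only [head22_tmul, TensorProduct.assoc_tmul, cr_tmul]
    generalize braid k B V X (v ⊗ₜ x) = p
    induction p with
    | zero => simp
    | add s t hs ht => simp only [map_add, add_tmul, tmul_add, hs, ht]
    | tmul x v => simp

theorem cr_tensor_right (hV : IsYD k B V) (t : V ⊗[k] (W ⊗[k] (X ⊗[k] Z))) :
    TensorProduct.assoc k W X _ (cr B ((TensorProduct.assoc k W X Z).symm.toLinearMap.lTensor V t)) =
      (cr B).lTensor W (cr B t) := by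
  refine tensor4_ext (f := (TensorProduct.assoc k W X _).toLinearMap ∘ₗ cr B ∘ₗ
      (TensorProduct.assoc k W X Z).symm.toLinearMap.lTensor V)
    (g := (cr B).lTensor W ∘ₗ cr B) ?_ t
  intro v w x z
  simp only [LinearMap.comp_apply, LinearEquiv.coe_coe, TensorProduct.assoc_symm_tmul, cr_tmul,
    LinearMap.lTensor_tmul]
  have h1 : ∀ p : (W ⊗[k] X) ⊗[k] V, TensorProduct.assoc k W X (V ⊗[k] Z)
      (TensorProduct.assoc k (W ⊗[k] X) V Z (p ⊗ₜ z)) =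
      (TensorProduct.assoc k X V Z ∘ₗ (TensorProduct.mk k _ _).flip z).lTensor W
        (TensorProduct.assoc k W X V p) := by
    intro p
    induction p with
    | zero => simp
    | add s t hs ht => simp only [map_add, add_tmul, tmul_add, hs, ht]
    | tmul s v =>
      induction s with
      | zero => simp
      | add s t hs ht => simp only [map_add, add_tmul, tmul_add, hs, ht]
      | tmul w x => simp
  rw [h1, braid_tensor_right hV, head22_tmul]
  generalize braid k B V W (v ⊗ₜ w) = p
  induction p with
  | zero => simp
  | add s t hs ht => simp only [map_add, add_tmul, tmul_add, hs, ht]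
  | tmul w v => simp [cr_tmul]

theorem cr_unit_left (hX : IsYD k B X) (t : k ⊗[k] (X ⊗[k] Z)) :
    (TensorProduct.lid k Z).toLinearMap.lTensor X (cr B t) = TensorProduct.lid k _ t := by
  refine tensor3_ext (f := (TensorProduct.lid k Z).toLinearMap.lTensor X ∘ₗ cr B)
    (g := (TensorProduct.lid k _).toLinearMap) ?_ t
  intro c x z
  simp [cr_tmul, braid_tmul, coactMap_unit, hX.one_act]

theorem cr_unit_right (hV : IsYD k B V) (t : V ⊗[k] (k ⊗[k] Z)) :
    TensorProduct.lid k _ (cr B t) = (TensorProduct.lid k Z).toLinearMap.lTensor V t := by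
  refine tensor3_ext (f := (TensorProduct.lid k _).toLinearMap ∘ₗ cr B)
    (g := (TensorProduct.lid k Z).toLinearMap.lTensor V) ?_ t
  intro v c z
  have h : ∀ p : B ⊗[k] V, TensorProduct.lid k (V ⊗[k] Z) (TensorProduct.assoc k k V Z
      (crossAct k B V k (p ⊗ₜ c) ⊗ₜ z)) =
      c • (TensorProduct.lid k V (counit.rTensor V p) ⊗ₜ z) := by
    intro p
    induction p with
    | zero => simp
    | add s t hs ht => simp only [map_add, add_tmul, tmul_add, smul_add, hs, ht]
    | tmul w v => simp [actMap_unit, smul_smul, mul_comm, smul_tmul']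
  simp only [LinearMap.comp_apply, LinearEquiv.coe_coe, cr_tmul, braid_tmul, h, hV.counit_apply]
  simp

/-! Naturality of the crossings, by the arity of the morphism that is moved. -/

theorem cr_left21 {f : V ⊗[k] W →ₗ[k] Y} (hf : IsYDHom k B f) (hX : IsYD k B X)
    (t : V ⊗[k] (W ⊗[k] (X ⊗[k] Z))) :
    cr B (head21 _ f t) = (head21 Z f).lTensor X (cr B ((cr B).lTensor V t)) := by
  simp only [head21, LinearMap.comp_apply, LinearEquiv.coe_coe, LinearMap.lTensor_comp, cr_left hf,
    cr_tensor_left hX]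

theorem cr_left12 {f : Y →ₗ[k] V ⊗[k] W} (hf : IsYDHom k B f) (hX : IsYD k B X)
    (t : Y ⊗[k] (X ⊗[k] Z)) :
    cr B ((cr B).lTensor V (head12 _ f t)) = (head12 Z f).lTensor X (cr B t) := by
  simp only [head12, LinearMap.comp_apply, LinearEquiv.coe_coe, LinearMap.lTensor_comp,
    ← cr_left hf]
  have := cr_tensor_left (Z := Z) hX (TensorProduct.assoc k V W _ (f.rTensor _ t))
  rw [LinearEquiv.symm_apply_apply] at this
  rw [this, ← LinearMap.lTensor_comp_apply]
  simp

theorem cr_left22 {f : V ⊗[k] W →ₗ[k] V' ⊗[k] W'} (hf : IsYDHom k B f) (hX : IsYD k B X)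
    (t : V ⊗[k] (W ⊗[k] (X ⊗[k] Z))) :
    cr B ((cr B).lTensor V' (head22 _ f t)) =
      (head22 Z f).lTensor X (cr B ((cr B).lTensor V t)) := by
  have h1 := cr_left12 (Z := Z) hf hX ((TensorProduct.assoc k V W _).symm t)
  simp only [head12, LinearMap.comp_apply, LinearEquiv.coe_coe, LinearMap.lTensor_comp,
    cr_tensor_left hX] at h1
  simp only [head22, LinearMap.comp_apply, LinearEquiv.coe_coe, LinearMap.lTensor_comp, h1]

/-- A scalar-valued morphism closes off two strands, and the braiding with the unit object is
trivial; so a strand may pass the closed pair freely. -/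
theorem cr_left20 {f : V ⊗[k] W →ₗ[k] k} (hf : IsYDHom k B f) (hX : IsYD k B X)
    (t : V ⊗[k] (W ⊗[k] (X ⊗[k] Z))) :
    (head20 Z f).lTensor X (cr B ((cr B).lTensor V t)) = head20 _ f t := by
  simp only [head20, LinearMap.comp_apply, LinearEquiv.coe_coe, LinearMap.lTensor_comp,
    ← cr_left hf, ← cr_tensor_left hX, cr_unit_left hX]

theorem cr_left10 {f : V →ₗ[k] k} (hf : IsYDHom k B f) (hX : IsYD k B X)
    (t : V ⊗[k] (X ⊗[k] Z)) :
    (head10 Z f).lTensor X (cr B t) = head10 _ f t := by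
  simp only [head10, LinearMap.comp_apply, LinearEquiv.coe_coe, LinearMap.lTensor_comp,
    ← cr_left hf, cr_unit_left hX]

theorem cr_left01 {e : V} (he : IsYDHom k B (LinearMap.toSpanSingleton k V e)) (hX : IsYD k B X)
    (t : X ⊗[k] Z) : cr B (e ⊗ₜ[k] t) = (TensorProduct.mk k V Z e).lTensor X t := by
  have h1 := cr_left he ((1 : k) ⊗ₜ[k] t)
  simp only [LinearMap.rTensor_tmul, LinearMap.toSpanSingleton_apply, one_smul] at h1
  have h2 := cr_unit_left (B := B) hX ((1 : k) ⊗ₜ[k] t)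
  rw [TensorProduct.lid_tmul, one_smul] at h2
  rw [h1]
  nth_rw 2 [← h2]
  rw [← LinearMap.lTensor_comp_apply]
  congr 2
  apply TensorProduct.ext'
  intro c z
  simp [smul_tmul']

theorem cr_right21 {g : W ⊗[k] X →ₗ[k] Y} (hg : IsYDHom k B g) (hV : IsYD k B V)
    (t : V ⊗[k] (W ⊗[k] (X ⊗[k] Z))) :
    cr B ((head21 Z g).lTensor V t) = head21 _ g ((cr B).lTensor W (cr B t)) := by
  simp only [head21, LinearMap.comp_apply, LinearEquiv.coe_coe, LinearMap.lTensor_comp,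
    cr_right hg, ← cr_tensor_right hV, LinearEquiv.symm_apply_apply]

theorem cr_right12 {g : Y →ₗ[k] W ⊗[k] X} (hg : IsYDHom k B g) (hV : IsYD k B V)
    (t : V ⊗[k] (Y ⊗[k] Z)) :
    (cr B).lTensor W (cr B ((head12 Z g).lTensor V t)) = head12 _ g (cr B t) := by
  have h : ∀ s : V ⊗[k] ((W ⊗[k] X) ⊗[k] Z),
      (TensorProduct.assoc k W X Z).symm.toLinearMap.lTensor V
        ((TensorProduct.assoc k W X Z).toLinearMap.lTensor V s) = s := by
    intro s
    rw [← LinearMap.lTensor_comp_apply]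
    simp
  simp only [head12, LinearMap.comp_apply, LinearEquiv.coe_coe, LinearMap.lTensor_comp,
    ← cr_right hg, ← cr_tensor_right hV, h]

theorem cr_right22 {g : W ⊗[k] X →ₗ[k] V' ⊗[k] W'} (hg : IsYDHom k B g) (hV : IsYD k B V)
    (t : V ⊗[k] (W ⊗[k] (X ⊗[k] Z))) :
    (cr B).lTensor V' (cr B ((head22 Z g).lTensor V t)) =
      head22 _ g ((cr B).lTensor W (cr B t)) := by
  have h1 := cr_right12 (Z := Z) hg hV
    ((TensorProduct.assoc k W X Z).symm.toLinearMap.lTensor V t)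
  rw [← LinearMap.lTensor_comp_apply] at h1
  have h2 := cr_tensor_right (B := B) hV t
  have h3 : head22 (V ⊗[k] Z) g ((cr B).lTensor W (cr B t)) =
      head12 _ g (cr B ((TensorProduct.assoc k W X Z).symm.toLinearMap.lTensor V t)) := by
    rw [← h2]
    simp [head22, head12]
  rw [h3]
  exact h1

theorem cr_right20 {g : W ⊗[k] X →ₗ[k] k} (hg : IsYDHom k B g) (hV : IsYD k B V)
    (t : V ⊗[k] (W ⊗[k] (X ⊗[k] Z))) :
    head20 _ g ((cr B).lTensor W (cr B t)) = (head20 Z g).lTensor V t := by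
  simp only [head20, LinearMap.comp_apply, LinearEquiv.coe_coe, LinearMap.lTensor_comp,
    ← cr_tensor_right hV, LinearEquiv.symm_apply_apply, ← cr_right hg, cr_unit_right hV]

theorem cr_right10 {g : W →ₗ[k] k} (hg : IsYDHom k B g) (hV : IsYD k B V)
    (t : V ⊗[k] (W ⊗[k] Z)) :
    head10 _ g (cr B t) = (head10 Z g).lTensor V t := by
  simp only [head10, LinearMap.comp_apply, LinearEquiv.coe_coe, LinearMap.lTensor_comp,
    ← cr_right hg, cr_unit_right hV]

theorem cr_right01 {e : W} (he : IsYDHom k B (LinearMap.toSpanSingleton k W e)) (hV : IsYD k B V)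
    (t : V ⊗[k] Z) : cr B ((TensorProduct.mk k W Z e).lTensor V t) = e ⊗ₜ[k] t := by
  induction t with
  | zero => simp
  | add s t hs ht => simp only [map_add, tmul_add, hs, ht]
  | tmul v z =>
    have h1 := cr_right he (v ⊗ₜ[k] ((1 : k) ⊗ₜ[k] z))
    simp only [LinearMap.lTensor_tmul, LinearMap.rTensor_tmul, LinearMap.toSpanSingleton_apply,
      one_smul] at h1
    rw [LinearMap.lTensor_tmul, TensorProduct.mk_apply, h1]
    have h2 := cr_unit_right (B := B) hV (v ⊗ₜ[k] ((1 : k) ⊗ₜ[k] z))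
    rw [LinearMap.lTensor_tmul, LinearEquiv.coe_coe, TensorProduct.lid_tmul, one_smul,
      ← LinearEquiv.eq_symm_apply] at h2
    rw [h2]
    simp

end Crossing

/-! ### The antipode of `B` and its inverse on products and coproducts. -/

section AntipodeInv

variable {k B : Type*} [Field k] [Ring B] [HopfAlgebra k B]

/-- Both sides are convolution inverses of the comultiplication in Hom(B, B ⊗ B), one visibly on the
left and the other on the right. -/
theorem comul_antipode (b : B) : comul (R := k) (antipode k b) =
    map (antipode k) (antipode k) (TensorProduct.comm k B B (comul b)) := by
  have h : WithConv.toConv (map (antipode k) (antipode k) ∘ₗ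
      (TensorProduct.comm k B B).toLinearMap ∘ₗ comul) =
      WithConv.toConv ((comul : B →ₗ[k] B ⊗[k] B) ∘ₗ antipode k) := by
    refine left_inv_eq_right_inv (a := WithConv.toConv (comul : B →ₗ[k] B ⊗[k] B)) ?_
      LinearMap.comul_right_inv
    ext x
    rw [LinearMap.convMul_apply, LinearMap.convOne_apply]
    simp only [WithConv.ofConv_toConv]
    let K : B ⊗[k] B →ₗ[k] B ⊗[k] B →ₗ[k] B ⊗[k] B := LinearMap.mul k (B ⊗[k] B) ∘ₗ
      map (antipode k) (antipode k) ∘ₗ (TensorProduct.comm k B B).toLinearMap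
    have h1 : ∀ p : B ⊗[k] B, mul' k (B ⊗[k] B) (map (map (antipode k) (antipode k) ∘ₗ
        (TensorProduct.comm k B B).toLinearMap ∘ₗ comul) comul p) =
        lift K ((TensorProduct.assoc k B B _).symm ((comul.lTensor B).lTensor B
          (TensorProduct.assoc k B B B (comul.rTensor B p)))) := by
      intro p
      induction p with
      | zero => simp
      | add s t hs ht => simp only [map_add, hs, ht]
      | tmul a b =>
        simp only [LinearMap.rTensor_tmul, map_tmul, LinearMap.comp_apply]
        generalize (comul a : B ⊗[k] B) = q
        induction q with
        | zero => simp
        | add s t hs ht => simp only [map_add, add_tmul, hs, ht]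
        | tmul c d => simp [K]
    have h2 : ∀ p : B ⊗[k] B, lift K ((TensorProduct.assoc k B B _).symm
          ((TensorProduct.assoc k B B B).toLinearMap.lTensor B
            ((comul.rTensor B).lTensor B (comul.lTensor B p)))) =
          (1 : B) ⊗ₜ[k] mul' k B ((antipode k).rTensor B (((TensorProduct.lid k B).toLinearMap ∘ₗ
            counit.rTensor B ∘ₗ comul).lTensor B p)) := by
      intro p
      induction p with
      | zero => simp
      | add s t hs ht => simp only [map_add, tmul_add, hs, ht]
      | tmul a b =>
        simp only [LinearMap.lTensor_tmul, LinearMap.comp_apply]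
        generalize (comul b : B ⊗[k] B) = q
        induction q with
        | zero => simp
        | add s t hs ht => simp only [map_add, tmul_add, hs, ht]
        | tmul c d =>
          have h3 : ∀ q : B ⊗[k] B, lift K ((TensorProduct.assoc k B B _).symm (a ⊗ₜ
              (TensorProduct.assoc k B B B (q ⊗ₜ d)))) =
              mul' k B ((antipode k).rTensor B q) ⊗ₜ (antipode k a * d) := by
            intro q
            induction q with
            | zero => simp
            | add s t hs ht => simp only [map_add, add_tmul, tmul_add, hs, ht]
            | tmul c d => simp [K]
          simp only [LinearMap.rTensor_tmul, LinearMap.lTensor_tmul, LinearEquiv.coe_coe, h3]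
          rw [mul_antipode_rTensor_comul_apply]
          simp [Algebra.algebraMap_eq_smul_one, smul_tmul]
    have h4 : (TensorProduct.lid k B).toLinearMap ∘ₗ counit.rTensor B ∘ₗ comul =
        (LinearMap.id : B →ₗ[k] B) := by ext; simp
    rw [h1, Coalgebra.coassoc_apply, ← LinearMap.lTensor_comp_apply,
      show (comul.lTensor B) ∘ₗ comul = (TensorProduct.assoc k B B B).toLinearMap ∘ₗ
        comul.rTensor B ∘ₗ (comul : B →ₗ[k] _) from Coalgebra.coassoc.symm,
      LinearMap.lTensor_comp_apply, LinearMap.lTensor_comp_apply, h2, h4]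
    simp [mul_antipode_rTensor_comul_apply, Algebra.algebraMap_eq_smul_one,
      Algebra.TensorProduct.one_def]
  exact (LinearMap.congr_fun (WithConv.toConv_injective h) b).symm

variable [Module.Finite k B]

@[simp] theorem antipode_antipodeInv (b : B) : antipode k (antipodeInv k B b) = b :=
  (antipodeEquiv k B).apply_symm_apply b

@[simp] theorem antipodeInv_antipode (b : B) : antipodeInv k B (antipode k b) = b :=
  (antipodeEquiv k B).symm_apply_apply b

/-- Most identities for the inverse antipode are obtained by applying the injective antipode, which
reverses products, and quoting the corresponding identity for the antipode. -/
theorem antipodeInv_mul (a b : B) :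
    antipodeInv k B (a * b) = antipodeInv k B b * antipodeInv k B a := by
  apply antipode_injective k B
  simp [antipode_mul_antidistrib]

theorem counit_antipodeInv (b : B) : counit (R := k) (antipodeInv k B b) = counit b := by
  rw [← counit_antipode (R := k) (antipodeInv k B b), antipode_antipodeInv]

theorem comul_antipodeInv (b : B) : comul (R := k) (antipodeInv k B b) =
    map (antipodeInv k B) (antipodeInv k B) (TensorProduct.comm k B B (comul b)) := by
  have h : ∀ q : B ⊗[k] B, map (antipodeInv k B) (antipodeInv k B) (TensorProduct.comm k B B
      (map (antipode k) (antipode k) (TensorProduct.comm k B B q))) = q := by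
    intro q
    induction q with
    | zero => simp
    | add s t hs ht => simp only [map_add, hs, ht]
    | tmul c d => simp
  have h1 := comul_antipode (k := k) (antipodeInv k B b)
  rw [antipode_antipodeInv] at h1
  rw [h1, h]

theorem mul_antipodeInv_comm (b : B) :
    mul' k B ((antipodeInv k B).rTensor B (TensorProduct.comm k B B (comul b))) =
      algebraMap k B (counit b) := by
  have h : ∀ q : B ⊗[k] B, antipode k (mul' k B ((antipodeInv k B).rTensor B
      (TensorProduct.comm k B B q))) = mul' k B ((antipode k).rTensor B q) := by
    intro q
    induction q with
    | zero => simp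
    | add s t hs ht => simp only [map_add, hs, ht]
    | tmul c d => simp [antipode_mul_antidistrib]
  apply antipode_injective k B
  rw [h, mul_antipode_rTensor_comul_apply]
  simp [Algebra.algebraMap_eq_smul_one]

theorem mul_antipodeInv_comm' (b : B) :
    mul' k B ((antipodeInv k B).lTensor B (TensorProduct.comm k B B (comul b))) =
      algebraMap k B (counit b) := by
  have h : ∀ q : B ⊗[k] B, antipode k (mul' k B ((antipodeInv k B).lTensor B
      (TensorProduct.comm k B B q))) = mul' k B ((antipode k).lTensor B q) := by
    intro q
    induction q with
    | zero => simp
    | add s t hs ht => simp only [map_add, hs, ht]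
    | tmul c d => simp [antipode_mul_antidistrib]
  apply antipode_injective k B
  rw [h, mul_antipode_lTensor_comul_apply]
  simp [Algebra.algebraMap_eq_smul_one]

end AntipodeInv

/-! ### Separating pairings. -/

section Separating

variable {k : Type*} [Field k]
variable {V P Q Y : Type*} [AddCommMonoid V] [Module k V] [AddCommMonoid P] [Module k P]
  [AddCommMonoid Q] [Module k Q]

/-- A map `e : V ⊗ P → Q` such that elements of `V` are determined by their pairings with `P`. -/
def Separating (e : V ⊗[k] P →ₗ[k] Q) : Prop :=
  ∀ v v' : V, (∀ p, e (v ⊗ₜ p) = e (v' ⊗ₜ p)) → v = v'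

/-- The map `v ↦ e (v ⊗ p)`. -/
def pairWith (e : V ⊗[k] P →ₗ[k] Q) (p : P) : V →ₗ[k] Q := e ∘ₗ (TensorProduct.mk k V P).flip p

@[simp] theorem pairWith_apply (e : V ⊗[k] P →ₗ[k] Q) (p : P) (v : V) :
    pairWith e p v = e (v ⊗ₜ p) := rfl

variable [AddCommGroup Y] [Module k Y]

/-- Expand the first factor in a basis: the pairing then tests each coefficient in V separately. -/
theorem Separating.tensor {e : V ⊗[k] P →ₗ[k] Q} (he : Separating e) {t t' : Y ⊗[k] V}
    (h : ∀ p, (pairWith e p).lTensor Y t = (pairWith e p).lTensor Y t') : t = t' := by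
  classical
  let ℬ := Module.Basis.ofVectorSpace k Y
  have h1 : ∀ (p : P) (t : Y ⊗[k] V) i, equivFinsuppOfBasisLeft ℬ ((pairWith e p).lTensor Y t) i =
      pairWith e p (equivFinsuppOfBasisLeft ℬ t i) := by
    intro p t i
    induction t with
    | zero => simp
    | add s t hs ht => simp only [map_add, Finsupp.add_apply, hs, ht]
    | tmul c d => simp
  apply (equivFinsuppOfBasisLeft ℬ).injective
  ext i
  apply he
  intro p
  rw [← pairWith_apply, ← pairWith_apply, ← h1, ← h1, h]

theorem separating_contractLeft : Separating (contractLeft k V) := fun f g h => by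
  ext x
  simpa using h x

end Separating

/-! ### The dual of a Yetter–Drinfeld module and the evaluation morphism. -/

section Dual

variable {k B : Type*} [Field k] [Ring B] [HopfAlgebra k B] [Module.Finite k B]
variable {V : Type*} [AddCommMonoid V] [Module k V] [YDData k B V]

theorem dual_act_apply (b : B) (f : Module.Dual k V) (x : V) :
    actMap k B (Module.Dual k V) (b ⊗ₜ f) x = f (actMap k B V (antipode k b ⊗ₜ x)) := rfl

theorem dualStar_apply (f : Module.Dual k V) (b : Module.Dual k B) (x : V) :
    dualStar k B V f b x = mul' k k (map b f (coactMap k B V x)) := rfl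

/-- The coevaluation sum collapses by the dual basis expansion. Later arguments use the dual
coaction only through this formula. -/
theorem dual_coact_apply (f : Module.Dual k V) (x : V) :
    TensorProduct.rid k B ((pairWith (contractLeft k V) x).lTensor B
      (coactMap k B (Module.Dual k V) f)) =
    antipodeInv k B (TensorProduct.rid k B (f.lTensor B (coactMap k B V x))) := by
  have h1 : coactMap k B (Module.Dual k V) f =
      map (antipodeInv k B) (dualStar k B V f) (coevaluation k B 1) := rfl
  rw [h1, coevaluation_apply_one]
  simp only [map_sum, map_tmul, LinearMap.lTensor_tmul, TensorProduct.rid_tmul, pairWith_apply,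
    contractLeft_apply, dualStar_apply]
  generalize coactMap k B V x = p
  induction p with
  | zero => simp
  | add s t hs ht => simp only [map_add, add_smul, Finset.sum_add_distrib, hs, ht]
  | tmul b v =>
    simp only [map_tmul, LinearMap.lTensor_tmul, TensorProduct.rid_tmul, map_smul,
      LinearMap.mul'_apply]
    conv_rhs => rw [← (Module.Basis.ofVectorSpace k B).sum_repr b, map_sum, Finset.smul_sum]
    refine Finset.sum_congr rfl fun i _ => ?_
    simp [smul_smul, mul_comm]

/-- Each coaction axiom is tested on a vector x. Through `dual_coact_apply` it becomes the same
axiom for V, read backwards by the inverse antipode, which reverses products and coproducts. -/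
theorem IsYD.dual (hV : IsYD k B V) : IsYD k B (Module.Dual k V) where
  one_act f := by
    ext x
    simp [dual_act_apply, hV.one_act]
  mul_act a b f := by
    ext x
    simp [dual_act_apply, antipode_mul_antidistrib, hV.mul_act]
  coassoc := by
    apply LinearMap.ext
    intro f
    simp only [LinearMap.comp_apply, LinearEquiv.coe_coe]
    apply (TensorProduct.assoc k B B _).symm.injective
    rw [LinearEquiv.symm_apply_apply]
    apply separating_contractLeft.tensor
    intro x
    apply (TensorProduct.rid k (B ⊗[k] B)).injective
    have h1 : ∀ t : B ⊗[k] Module.Dual k V, TensorProduct.rid k (B ⊗[k] B)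
        ((pairWith (contractLeft k V) x).lTensor (B ⊗[k] B) (comul.rTensor _ t)) =
        comul (TensorProduct.rid k B ((pairWith (contractLeft k V) x).lTensor B t)) := by
      intro t
      induction t with
      | zero => simp
      | add s t hs ht => simp only [map_add, hs, ht]
      | tmul b f => simp
    let θ : B ⊗[k] (B ⊗[k] V) →ₗ[k] B ⊗[k] B := map (antipodeInv k B) (antipodeInv k B) ∘ₗ
      (TensorProduct.comm k B B).toLinearMap ∘ₗ
      ((TensorProduct.rid k B).toLinearMap ∘ₗ f.lTensor B).lTensor B
    have h2 : ∀ t : B ⊗[k] V, comul (R := k) (antipodeInv k B (TensorProduct.rid k B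
        (f.lTensor B t))) = θ (TensorProduct.assoc k B B V (comul.rTensor V t)) := by
      intro t
      induction t with
      | zero => simp
      | add s t hs ht => simp only [map_add, hs, ht]
      | tmul b v =>
        simp only [LinearMap.lTensor_tmul, TensorProduct.rid_tmul, LinearMap.rTensor_tmul, map_smul,
          comul_antipodeInv]
        generalize (comul b : B ⊗[k] B) = q
        induction q with
        | zero => simp
        | add s t hs ht => simp only [map_add, smul_add, add_tmul, hs, ht]
        | tmul c d => simp [θ, smul_tmul']
    let Λ : B ⊗[k] V → Module.Dual k V →ₗ[k] B := fun p => antipodeInv k B ∘ₗ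
      (TensorProduct.rid k B).toLinearMap ∘ₗ LinearMap.applyₗ p ∘ₗ LinearMap.lTensorHom B
    have hΛ : ∀ p g, Λ p g = antipodeInv k B (TensorProduct.rid k B (g.lTensor B p)) :=
      fun _ _ => rfl
    have h3 : ∀ t : B ⊗[k] Module.Dual k V, TensorProduct.rid k (B ⊗[k] B)
        ((pairWith (contractLeft k V) x).lTensor (B ⊗[k] B)
          ((TensorProduct.assoc k B B _).symm ((coactMap k B _).lTensor B t))) =
        (Λ (coactMap k B V x)).lTensor B t := by
      intro t
      induction t with
      | zero => simp
      | add s t hs ht => simp only [map_add, hs, ht]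
      | tmul b g =>
        simp only [LinearMap.lTensor_tmul, hΛ, ← dual_coact_apply]
        generalize coactMap k B _ g = q
        induction q with
        | zero => simp
        | add s t hs ht => simp only [map_add, tmul_add, hs, ht]
        | tmul c h => simp
    have h4 : ∀ p : B ⊗[k] V, (Λ p).lTensor B (coactMap k B _ f) =
        θ ((coactMap k B V).lTensor B p) := by
      intro p
      induction p with
      | zero =>
        have : Λ 0 = 0 := by ext g; simp [hΛ]
        simp [this]
      | add s t hs ht =>
        have : Λ (s + t) = Λ s + Λ t := by ext g; simp [hΛ]
        simp only [this, LinearMap.lTensor_add, LinearMap.add_apply, map_add, hs, ht]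
      | tmul c y =>
        have h5 : ∀ t : B ⊗[k] Module.Dual k V, (Λ (c ⊗ₜ y)).lTensor B t =
            TensorProduct.rid k B ((pairWith (contractLeft k V) y).lTensor B t) ⊗ₜ
              antipodeInv k B c := by
          intro t
          induction t with
          | zero => simp
          | add s t hs ht => simp only [map_add, add_tmul, hs, ht]
          | tmul b g => simp [hΛ, smul_tmul']
        rw [h5, dual_coact_apply]
        simp [θ]
    rw [h1, dual_coact_apply, h2, h3, h4, hV.coassoc_apply]
  counit_coact := by
    apply LinearMap.ext
    intro f
    ext x
    simp only [LinearMap.comp_apply, LinearEquiv.coe_coe, LinearMap.id_apply]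
    have h1 : ∀ t : B ⊗[k] Module.Dual k V,
        TensorProduct.lid k (Module.Dual k V) (counit.rTensor _ t) x =
        counit (R := k) (TensorProduct.rid k B ((pairWith (contractLeft k V) x).lTensor B t)) := by
      intro t
      induction t with
      | zero => simp
      | add s t hs ht => simp only [map_add, LinearMap.add_apply, hs, ht]
      | tmul b f => simp [mul_comm]
    have h2 : ∀ t : B ⊗[k] V, counit (R := k) (TensorProduct.rid k B (f.lTensor B t)) =
        f (TensorProduct.lid k V (counit.rTensor _ t)) := by
      intro t
      induction t with
      | zero => simp
      | add s t hs ht => simp only [map_add, hs, ht]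
      | tmul b f => simp [mul_comm]
    rw [h1, dual_coact_apply, counit_antipodeInv, h2, hV.counit_apply]
  compat := by
    apply TensorProduct.ext'
    intro b f
    change IsYD.mulAct k B _ (comul b ⊗ₜ coactMap k B _ f) = IsYD.coactMul k B _ (comul b ⊗ₜ f)
    apply separating_contractLeft.tensor
    intro x
    apply (TensorProduct.rid k B).injective
    let A : B ⊗[k] V →ₗ[k] B := (TensorProduct.rid k B).toLinearMap ∘ₗ f.lTensor B
    have h1 : ∀ (p : B ⊗[k] B), TensorProduct.rid k B
        ((pairWith (contractLeft k V) x).lTensor B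
          (IsYD.mulAct k B (Module.Dual k V) (p ⊗ₜ coactMap k B _ f))) =
        antipodeInv k B (A (IsYD.coactMul k B V (map (antipode k) (antipode k)
          (TensorProduct.comm k B B p) ⊗ₜ x))) := by
      intro p
      induction p with
      | zero => simp
      | add s t hs ht => simp only [map_add, add_tmul, hs, ht]
      | tmul a b =>
        have h : ∀ t : B ⊗[k] Module.Dual k V, TensorProduct.rid k B
            ((pairWith (contractLeft k V) x).lTensor B
              (IsYD.mulAct k B (Module.Dual k V) ((a ⊗ₜ b) ⊗ₜ t))) = a * TensorProduct.rid k B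
            ((pairWith (contractLeft k V) (actMap k B V (antipode k b ⊗ₜ x))).lTensor B t) := by
          intro t
          induction t with
          | zero => simp
          | add s t hs ht => simp only [map_add, mul_add, tmul_add, hs, ht]
          | tmul b f => simp [dual_act_apply]
        rw [h, dual_coact_apply]
        simp only [TensorProduct.comm_tmul, map_tmul, IsYD.coactMul_tmul]
        generalize coactMap k B V (actMap k B V (antipode k b ⊗ₜ x)) = q
        induction q with
        | zero => simp
        | add s t hs ht => simp only [map_add, mul_add, add_tmul, hs, ht]
        | tmul c v => simp [A, antipodeInv_mul]
    have h2 : ∀ (p : B ⊗[k] B), TensorProduct.rid k B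
        ((pairWith (contractLeft k V) x).lTensor B
          (IsYD.coactMul k B (Module.Dual k V) (p ⊗ₜ f))) =
        antipodeInv k B (A (IsYD.mulAct k B V (map (antipode k) (antipode k)
          (TensorProduct.comm k B B p) ⊗ₜ coactMap k B V x))) := by
      intro p
      induction p with
      | zero => simp
      | add s t hs ht => simp only [map_add, add_tmul, hs, ht]
      | tmul a b =>
        have h : ∀ t : B ⊗[k] Module.Dual k V, TensorProduct.rid k B
            ((pairWith (contractLeft k V) x).lTensor B
              (IsYD.mulRight k B (Module.Dual k V) (t ⊗ₜ b))) = TensorProduct.rid k B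
            ((pairWith (contractLeft k V) x).lTensor B t) * b := by
          intro t
          induction t with
          | zero => simp
          | add s t hs ht => simp only [map_add, add_mul, add_tmul, hs, ht]
          | tmul b f => simp
        rw [IsYD.coactMul_tmul, h, dual_coact_apply]
        simp only [TensorProduct.comm_tmul, map_tmul]
        generalize coactMap k B V x = q
        induction q with
        | zero => simp
        | add s t hs ht => simp only [map_add, add_mul, tmul_add, hs, ht]
        | tmul c v => simp [A, antipodeInv_mul, dual_act_apply]
    -- The compatibility for f at b is the compatibility for V at S(b), with the two sides
    -- exchanged.
    rw [h1, h2, ← comul_antipode, hV.compat_apply]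

/-- Linearity is the antipode identity ∑ S(b₁) b₂ = ε(b); colinearity is the identity ∑ S⁻¹(b₂) b₁ =
ε(b). -/
theorem IsYDHom.contractLeft (hV : IsYD k B V) : IsYDHom k B (contractLeft k V) where
  map_act b t := by
    rw [actMap_tensor, actMap_unit]
    induction t with
    | zero => simp
    | add s t hs ht => simp only [map_add, tmul_add, mul_add, hs, ht]
    | tmul f x =>
      have h : ∀ p : B ⊗[k] B, _root_.contractLeft k V (pairAct k B _ V (p ⊗ₜ (f ⊗ₜ x))) =
          f (actMap k B V (mul' k B ((antipode k).rTensor B p) ⊗ₜ x)) := by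
        intro p
        induction p with
        | zero => simp
        | add s t hs ht => simp only [map_add, add_tmul, hs, ht]
        | tmul a b => simp [dual_act_apply, hV.mul_act]
      rw [h, mul_antipode_rTensor_comul_apply, Algebra.algebraMap_eq_smul_one, ← smul_tmul',
        map_smul, map_smul, hV.one_act]
      simp
  map_coact t := by
    induction t with
    | zero => simp
    | add s t hs ht => simp only [map_add, hs, ht]
    | tmul f x =>
      rw [coactMap_tensor, coactMap_unit]
      apply (TensorProduct.rid k B).injective
      let θ : B ⊗[k] (B ⊗[k] V) →ₗ[k] B := mul' k B ∘ₗ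
        (antipodeInv k B).rTensor B ∘ₗ (TensorProduct.comm k B B).toLinearMap ∘ₗ
        ((TensorProduct.rid k B).toLinearMap ∘ₗ f.lTensor B).lTensor B
      have h1 : ∀ p : B ⊗[k] V, TensorProduct.rid k B ((_root_.contractLeft k V).lTensor B
          (pairMul k B _ V (coactMap k B _ f ⊗ₜ p))) =
          θ ((coactMap k B V).lTensor B p) := by
        intro p
        induction p with
        | zero => simp
        | add s t hs ht => simp only [map_add, tmul_add, hs, ht]
        | tmul b v =>
          have h : ∀ q : B ⊗[k] Module.Dual k V, TensorProduct.rid k B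
            ((_root_.contractLeft k V).lTensor B (pairMul k B _ V (q ⊗ₜ (b ⊗ₜ v)))) =
            TensorProduct.rid k B ((pairWith (_root_.contractLeft k V) v).lTensor B q) * b := by
            intro q
            induction q with
            | zero => simp
            | add s t hs ht => simp only [map_add, add_tmul, add_mul, hs, ht]
            | tmul a f => simp
          rw [h, dual_coact_apply]
          simp [θ]
      have h2 : ∀ p : B ⊗[k] V, θ (TensorProduct.assoc k B B V (comul.rTensor V p)) =
          algebraMap k B (f (TensorProduct.lid k V (counit.rTensor V p))) := by
        intro p
        induction p with
        | zero => simp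
        | add s t hs ht => simp only [map_add, hs, ht]
        | tmul b v =>
          have h3 : ∀ q : B ⊗[k] B, θ (TensorProduct.assoc k B B V (q ⊗ₜ v)) = f v •
              mul' k B ((antipodeInv k B).rTensor B (TensorProduct.comm k B B q)) := by
            intro q
            induction q with
            | zero => simp
            | add s t hs ht => simp only [map_add, add_tmul, smul_add, hs, ht]
            | tmul a f => simp [θ]
          rw [LinearMap.rTensor_tmul, h3, mul_antipodeInv_comm]
          simp [Algebra.algebraMap_eq_smul_one, smul_smul, mul_comm]
      rw [h1, ← hV.coassoc_apply, h2, hV.counit_apply]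
      simp [Algebra.algebraMap_eq_smul_one]

end Dual

/-! ### Recognising morphisms through a separating pairing. -/

section HomTest

variable {k B : Type*} [Field k] [Ring B] [HopfAlgebra k B]
variable {V W P Q X : Type*} [AddCommMonoid V] [Module k V] [AddCommMonoid P] [Module k P]
  [AddCommMonoid Q] [Module k Q] [AddCommMonoid X] [Module k X] [AddCommMonoid W] [Module k W]
  [YDData k B V] [YDData k B P] [YDData k B Q] [YDData k B X] [YDData k B W]

/-- In Sweedler form the left side is ∑ b₁ · G(v ⊗ S(b₂) · p). Thus the action on v is expressed by
the functional G(v ⊗ -) alone, so a separating pairing can detect linearity. -/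
theorem IsYDHom.apply_act_tmul {G : V ⊗[k] P →ₗ[k] Q} (hG : IsYDHom k B G) (hP : IsYD k B P)
    (b : B) (v : V) (p : P) :
    lift (TensorProduct.curry (actMap k B Q) |>.compr₂ LinearMap.id |>.compl₂
      (G ∘ₗ TensorProduct.mk k V P v ∘ₗ actMap k B P ∘ₗ (TensorProduct.mk k B P).flip p ∘ₗ
        antipode k)) (comul b) =
    G (actMap k B V (b ⊗ₜ v) ⊗ₜ p) := by
  let K : B ⊗[k] (B ⊗[k] B) →ₗ[k] Q := G ∘ₗ map (actMap k B V ∘ₗ (TensorProduct.mk k B V).flip v)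
    (actMap k B P ∘ₗ (TensorProduct.mk k B P).flip p ∘ₗ mul' k B ∘ₗ (antipode k).lTensor B)
  have h1 : ∀ q : B ⊗[k] B, lift (TensorProduct.curry (actMap k B Q) |>.compr₂ LinearMap.id |>.compl₂
      (G ∘ₗ TensorProduct.mk k V P v ∘ₗ actMap k B P ∘ₗ (TensorProduct.mk k B P).flip p ∘ₗ
        antipode k)) q = K (TensorProduct.assoc k B B B (comul.rTensor B q)) := by
    intro q
    induction q with
    | zero => simp
    | add s t hs ht => simp only [map_add, hs, ht]
    | tmul a c =>
      simp only [lift.tmul, LinearMap.compl₂_apply, LinearMap.compr₂_apply, LinearMap.id_apply,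
        TensorProduct.curry_apply, LinearMap.comp_apply, TensorProduct.mk_apply,
        LinearMap.flip_apply, LinearMap.rTensor_tmul]
      rw [← hG.map_act, actMap_tensor]
      generalize (comul a : B ⊗[k] B) = r
      induction r with
      | zero => simp
      | add s t hs ht => simp only [map_add, add_tmul, hs, ht]
      | tmul a b => simp [K, hP.mul_act]
  have h2 : ∀ q : B ⊗[k] B, K (comul.lTensor B q) =
      G (actMap k B V (TensorProduct.rid k B (counit.lTensor B q) ⊗ₜ v) ⊗ₜ p) := by
    intro q
    induction q with
    | zero => simp
    | add s t hs ht => simp only [map_add, add_tmul, hs, ht]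
    | tmul a c =>
      simp only [K, LinearMap.lTensor_tmul, map_tmul, LinearMap.comp_apply,
        mul_antipode_lTensor_comul_apply]
      simp [Algebra.algebraMap_eq_smul_one, hP.one_act, ← smul_tmul']
  rw [h1, Coalgebra.coassoc_apply, h2, Coalgebra.lTensor_counit_comul]
  simp

variable [Module.Finite k B]

variable (k B Q) in
/-- `c ⊗ q ↦ q₍₋₁₎ S⁻¹(c) ⊗ q₍₀₎`. -/
def coactAntipodeInv : B ⊗[k] Q →ₗ[k] B ⊗[k] Q :=
  IsYD.mulRight k B Q ∘ₗ map (coactMap k B Q) (antipodeInv k B) ∘ₗ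
    (TensorProduct.comm k B Q).toLinearMap

/-- The coaction counterpart: v₍₋₁₎ is recovered from the coaction of G(v ⊗ p₍₀₎) by cancelling
p₍₋₁₎ against its inverse antipode. -/
theorem IsYDHom.lTensor_pairWith_coact {G : V ⊗[k] P →ₗ[k] Q} (hG : IsYDHom k B G)
    (hP : IsYD k B P) (v : V) (p : P) :
    (pairWith G p).lTensor B (coactMap k B V v) =
      coactAntipodeInv k B Q ((G ∘ₗ TensorProduct.mk k V P v).lTensor B (coactMap k B P p)) := by
  let K : B ⊗[k] (B ⊗[k] P) →ₗ[k] B ⊗[k] Q := G.lTensor B ∘ₗ pairMul k B V P ∘ₗ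
    TensorProduct.mk k _ _ (coactMap k B V v) ∘ₗ
    (mul' k B ∘ₗ (antipodeInv k B).lTensor B ∘ₗ (TensorProduct.comm k B B).toLinearMap).rTensor P ∘ₗ
    (TensorProduct.assoc k B B P).symm.toLinearMap
  have h1 : ∀ t : B ⊗[k] P, coactAntipodeInv k B Q
      ((G ∘ₗ TensorProduct.mk k V P v).lTensor B t) = K ((coactMap k B P).lTensor B t) := by
    intro t
    induction t with
    | zero => simp
    | add s t hs ht => simp only [map_add, hs, ht]
    | tmul c x =>
      simp only [coactAntipodeInv, LinearMap.comp_apply, LinearMap.lTensor_tmul,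
        TensorProduct.comm_tmul, map_tmul, LinearEquiv.coe_coe, TensorProduct.mk_apply,
        hG.map_coact, coactMap_tensor, K]
      generalize coactMap k B P x = q
      generalize coactMap k B V v = r
      induction q with
      | zero => simp
      | add s t hs ht => simp only [map_add, add_tmul, tmul_add, hs, ht]
      | tmul d y =>
        induction r with
        | zero => simp
        | add s t hs ht => simp only [map_add, add_tmul, hs, ht]
        | tmul a v => simp [mul_assoc]
  have h2 : ∀ t : B ⊗[k] P, K (TensorProduct.assoc k B B P (comul.rTensor P t)) =
      (pairWith G (TensorProduct.lid k P (counit.rTensor P t))).lTensor B (coactMap k B V v) := by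
    intro t
    induction t with
    | zero =>
      have : pairWith G (0 : P) = 0 := by ext; simp
      simp [this]
    | add s t hs ht =>
      have : ∀ x y, pairWith G (x + y : P) = pairWith G x + pairWith G y := by
        intro x y; ext; simp [tmul_add]
      simp only [map_add, this, LinearMap.lTensor_add, LinearMap.add_apply, hs, ht]
    | tmul c x =>
      have : ∀ (c : k) y, pairWith G (c • y : P) = c • pairWith G y := by
        intro x y; ext; simp
      simp only [LinearMap.rTensor_tmul, K, LinearMap.comp_apply, LinearEquiv.coe_coe,
        LinearEquiv.symm_apply_apply, mul_antipodeInv_comm', TensorProduct.mk_apply,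
        TensorProduct.lid_tmul, this, LinearMap.lTensor_smul, LinearMap.smul_apply]
      generalize coactMap k B V v = r
      induction r with
      | zero => simp
      | add s t hs ht => simp only [map_add, smul_add, add_tmul, hs, ht]
      | tmul a v => simp [Algebra.algebraMap_eq_smul_one, smul_tmul']
  rw [h1, ← hP.coassoc_apply, h2, hP.counit_apply]

/-- A linear map into `V` is a morphism in `^B_B YD` if its composite with a separating pairing is
one. -/
theorem IsYDHom.of_separating {e : V ⊗[k] P →ₗ[k] Q} (he : IsYDHom k B e) (hs : Separating e)
    (hP : IsYD k B P) {F : X →ₗ[k] V} (hF : IsYDHom k B (e ∘ₗ F.rTensor P)) : IsYDHom k B F where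
  map_act b x := by
    apply hs
    intro p
    rw [← he.apply_act_tmul hP]
    exact (hF.apply_act_tmul hP b x p).symm
  map_coact x := by
    apply hs.tensor
    intro p
    rw [he.lTensor_pairWith_coact hP, ← LinearMap.lTensor_comp_apply]
    exact (hF.lTensor_pairWith_coact hP x p).symm

end HomTest

/-! ### Subobjects, and `U` as a Yetter–Drinfeld module. -/

section Sub

variable {k B : Type*} [Field k] [Ring B] [HopfAlgebra k B]
variable {V W : Type*} [AddCommGroup V] [Module k V] [AddCommGroup W] [Module k W]
  [YDData k B V] [YDData k B W]

theorem IsYD.of_injective (hW : IsYD k B W) {ι : V →ₗ[k] W} (hι : IsYDHom k B ι)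
    (inj : Function.Injective ι) : IsYD k B V where
  one_act v := inj (by rw [hι.map_act, hW.one_act])
  mul_act a b v := inj (by simp only [hι.map_act, hW.mul_act])
  coassoc := by
    apply LinearMap.ext
    intro v
    simp only [LinearMap.comp_apply, LinearEquiv.coe_coe]
    apply Module.Flat.lTensor_preserves_injective_linearMap (M := B) _
      (Module.Flat.lTensor_preserves_injective_linearMap (M := B) ι inj)
    rw [← LinearMap.lTensor_comp_apply,
      show (ι.lTensor B) ∘ₗ coactMap k B V = coactMap k B W ∘ₗ ι from
        LinearMap.ext fun v => (hι.map_coact v).symm, LinearMap.lTensor_comp_apply,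
        ← hι.map_coact, ← assoc_lTensor, ← rTensor_lTensor_comm, ← hι.map_coact, hW.coassoc_apply]
  counit_coact := by
    apply LinearMap.ext
    intro v
    apply inj
    have h : ∀ t : B ⊗[k] V, ι (TensorProduct.lid k V (counit.rTensor V t)) =
        TensorProduct.lid k W (counit.rTensor W (ι.lTensor B t)) := by
      intro t
      induction t with
      | zero => simp
      | add s t hs ht => simp only [map_add, hs, ht]
      | tmul b v => simp
    simp only [LinearMap.comp_apply, LinearEquiv.coe_coe, h, ← hι.map_coact, hW.counit_apply]
    rfl
  compat := by
    apply TensorProduct.ext'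
    intro b v
    change IsYD.mulAct k B _ (comul b ⊗ₜ coactMap k B _ v) = IsYD.coactMul k B _ (comul b ⊗ₜ v)
    apply Module.Flat.lTensor_preserves_injective_linearMap (M := B) ι inj
    have h1 : ∀ (p : B ⊗[k] B) (t : B ⊗[k] V), ι.lTensor B (IsYD.mulAct k B V (p ⊗ₜ t)) =
        IsYD.mulAct k B W (p ⊗ₜ ι.lTensor B t) := by
      intro p t
      induction p with
      | zero => simp
      | add s t hs ht => simp only [map_add, add_tmul, hs, ht]
      | tmul a b =>
        induction t with
        | zero => simp
        | add s t hs ht => simp only [map_add, tmul_add, hs, ht]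
        | tmul c v => simp [hι.map_act]
    have h2 : ∀ (p : B ⊗[k] B), ι.lTensor B (IsYD.coactMul k B V (p ⊗ₜ v)) =
        IsYD.coactMul k B W (p ⊗ₜ ι v) := by
      intro p
      induction p with
      | zero => simp
      | add s t hs ht => simp only [map_add, add_tmul, hs, ht]
      | tmul a b =>
        rw [IsYD.coactMul_tmul, IsYD.coactMul_tmul, ← hι.map_act, hι.map_coact]
        generalize coactMap k B V _ = q
        induction q with
        | zero => simp
        | add s t hs ht => simp only [map_add, add_tmul, hs, ht]
        | tmul c v => simp
    rw [h1, h2, ← hι.map_coact, hW.compat_apply]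

end Sub

variable (k B H : Type*) [Field k] [Ring B] [HopfAlgebra k B]
  [Ring H] [Algebra k H] [Coalgebra k H] [YDData k B H] [BraidedHopfAlgebra k B H] in
theorem isYD_base : IsYD k B H := BraidedHopfAlgebra.isYDAlgebra.isYD

namespace BraidedHopfSubalgebra

variable {k B H : Type*} [Field k] [Ring B] [HopfAlgebra k B] [Module.Finite k B]
  [Ring H] [Algebra k H] [Coalgebra k H] [YDData k B H] [BraidedHopfAlgebra k B H]
  (U : BraidedHopfSubalgebra k B H)

theorem subtype_hom : IsYDHom k B U.carrier.subtype where
  map_act b f := U.act_spec b f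
  map_coact f := (U.coact_spec f).symm

theorem isYD : IsYD k B U.carrier :=
  IsYD.of_injective (V := U.carrier) (W := Module.Dual k H) (isYD_base k B H).dual U.subtype_hom
    U.carrier.injective_subtype

theorem ev_hom : IsYDHom k B U.ev :=
  (IsYDHom.contractLeft (isYD_base k B H)).comp U.subtype_hom.rTensor

theorem ev_tmul (f : U.carrier) (x : H) : U.ev (f ⊗ₜ x) = (f : Module.Dual k H) x := rfl

theorem separating_ev : Separating U.ev := fun f g h => by
  ext x
  exact h x

end BraidedHopfSubalgebra

section Lift

variable {k : Type*} [CommSemiring k]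
variable {X M N P Q R S T : Type*} [AddCommMonoid X] [Module k X] [AddCommMonoid M] [Module k M]
  [AddCommMonoid N] [Module k N] [AddCommMonoid P] [Module k P] [AddCommMonoid Q] [Module k Q]
  [AddCommMonoid R] [Module k R] [AddCommMonoid S] [Module k S] [AddCommMonoid T] [Module k T]

/-! ### Applying an identity of maps under `X ⊗ -` -/

theorem lift20 {a : N →ₗ[k] M} {b : M →ₗ[k] N} (h : ∀ t, a (b t) = t) (t : X ⊗[k] M) :
    a.lTensor X (b.lTensor X t) = t := by
  rw [← LinearMap.lTensor_comp_apply, LinearMap.ext (f := a ∘ₗ b) (g := LinearMap.id) h]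
  simp

theorem lift21 {a : N →ₗ[k] P} {b : M →ₗ[k] N} {c : M →ₗ[k] P} (h : ∀ t, a (b t) = c t)
    (t : X ⊗[k] M) : a.lTensor X (b.lTensor X t) = c.lTensor X t := by
  rw [← LinearMap.lTensor_comp_apply, LinearMap.ext (f := a ∘ₗ b) (g := c) h]

theorem lift22 {a : N →ₗ[k] P} {b : M →ₗ[k] N} {c : Q →ₗ[k] P} {d : M →ₗ[k] Q}
    (h : ∀ t, a (b t) = c (d t)) (t : X ⊗[k] M) :
    a.lTensor X (b.lTensor X t) = c.lTensor X (d.lTensor X t) := by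
  rw [← LinearMap.lTensor_comp_apply, ← LinearMap.lTensor_comp_apply,
    LinearMap.ext (f := a ∘ₗ b) (g := c ∘ₗ d) h]

theorem lift31 {a : N →ₗ[k] P} {b : M →ₗ[k] N} {b' : Q →ₗ[k] M} {c : Q →ₗ[k] P}
    (h : ∀ t, a (b (b' t)) = c t) (t : X ⊗[k] Q) :
    a.lTensor X (b.lTensor X (b'.lTensor X t)) = c.lTensor X t := by
  rw [← LinearMap.lTensor_comp_apply, ← LinearMap.lTensor_comp_apply,
    LinearMap.ext (f := (a ∘ₗ b) ∘ₗ b') (g := c) h]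

theorem lift32 {a : N →ₗ[k] P} {b : M →ₗ[k] N} {b' : R →ₗ[k] M} {c : Q →ₗ[k] P} {d : R →ₗ[k] Q}
    (h : ∀ t, a (b (b' t)) = c (d t)) (t : X ⊗[k] R) :
    a.lTensor X (b.lTensor X (b'.lTensor X t)) = c.lTensor X (d.lTensor X t) := by
  rw [← LinearMap.lTensor_comp_apply, ← LinearMap.lTensor_comp_apply,
    ← LinearMap.lTensor_comp_apply, LinearMap.ext (f := (a ∘ₗ b) ∘ₗ b') (g := c ∘ₗ d) h]

theorem lift33 {a : N →ₗ[k] P} {b : M →ₗ[k] N} {b' : R →ₗ[k] M} {c : Q →ₗ[k] P} {d : S →ₗ[k] Q}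
    {d' : R →ₗ[k] S} (h : ∀ t, a (b (b' t)) = c (d (d' t))) (t : X ⊗[k] R) :
    a.lTensor X (b.lTensor X (b'.lTensor X t)) =
      c.lTensor X (d.lTensor X (d'.lTensor X t)) := by
  rw [← LinearMap.lTensor_comp_apply, ← LinearMap.lTensor_comp_apply,
    ← LinearMap.lTensor_comp_apply, ← LinearMap.lTensor_comp_apply,
    LinearMap.ext (f := (a ∘ₗ b) ∘ₗ b') (g := (c ∘ₗ d) ∘ₗ d') h]

end Lift

/-! ### The braided Hopf algebra axioms as rewriting rules on heads of tensors. -/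

section BraidedHopf

variable {k B H : Type*} [Field k] [Ring B] [HopfAlgebra k B]
  [Ring H] [Algebra k H] [Coalgebra k H] [YDData k B H] [BraidedHopfAlgebra k B H]
variable {Z Z' : Type*} [AddCommMonoid Z] [Module k Z] [AddCommMonoid Z'] [Module k Z']

local notation "𝖫" => LinearMap.lTensor _
local notation "𝖼" => cr B
local notation "𝗆" => head21 _ (mul' k H)
local notation "𝖽" => head12 _ (comul : H →ₗ[k] H ⊗[k] H)
local notation "𝖾" => head10 _ (counit : H →ₗ[k] k)
local notation "𝗌" => LinearMap.rTensor _ (braidedAntipode k B H)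
local notation "𝗎" => TensorProduct.mk k H _ (1 : H)

variable (k B H) in
theorem mul_hom : IsYDHom k B (mul' k H) := BraidedHopfAlgebra.isYDAlgebra.mul_hom

variable (k B H) in
theorem one_hom : IsYDHom k B (LinearMap.toSpanSingleton k H 1) :=
  BraidedHopfAlgebra.isYDAlgebra.unit_hom

variable (k B H) in
theorem comul_hom : IsYDHom k B (comul : H →ₗ[k] H ⊗[k] H) := BraidedHopfAlgebra.comul_hom

variable (k B H) in
theorem counit_hom : IsYDHom k B (counit : H →ₗ[k] k) := BraidedHopfAlgebra.counit_hom

variable (k B H) in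
theorem antipode_hom : IsYDHom k B (braidedAntipode k B H) := BraidedHopfAlgebra.S_hom

theorem st_mul_assoc (t : H ⊗[k] (H ⊗[k] (H ⊗[k] Z))) : 𝗆 (𝗆 t) = 𝗆 (𝖫 𝗆 t) := by
  refine tensor4_ext (f := 𝗆 ∘ₗ 𝗆) (g := 𝗆 ∘ₗ 𝖫 𝗆) ?_ t
  intro x y w z
  simp [mul_assoc]

theorem st_one_mul (t : H ⊗[k] Z) : 𝗆 (𝗎 t) = t := by
  induction t with
  | zero => simp
  | add s t hs ht => simp only [map_add, hs, ht]
  | tmul x z => simp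

theorem st_mul_one (t : H ⊗[k] Z) : 𝗆 (𝖫 𝗎 t) = t := by
  induction t with
  | zero => simp
  | add s t hs ht => simp only [map_add, hs, ht]
  | tmul x z => simp

theorem st_coassoc (t : H ⊗[k] Z) : 𝖽 (𝖽 t) = 𝖫 𝖽 (𝖽 t) := by
  induction t with
  | zero => simp
  | add s t hs ht => simp only [map_add, hs, ht]
  | tmul x z =>
    let A : H ⊗[k] (H ⊗[k] H) →ₗ[k] H ⊗[k] (H ⊗[k] (H ⊗[k] Z)) :=
      (((TensorProduct.mk k H Z).flip z).lTensor H).lTensor H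
    have h1 : ∀ p : H ⊗[k] H, 𝖽 (TensorProduct.assoc k H H Z (p ⊗ₜ z)) =
        A (TensorProduct.assoc k H H H (comul.rTensor H p)) := by
      intro p
      induction p with
      | zero => simp
      | add s t hs ht => simp only [map_add, add_tmul, hs, ht]
      | tmul a b =>
        simp only [TensorProduct.assoc_tmul, LinearMap.rTensor_tmul, head12_tmul]
        generalize (comul a : H ⊗[k] H) = q
        induction q with
        | zero => simp
        | add s t hs ht => simp only [map_add, add_tmul, hs, ht]
        | tmul c d => simp [A]
    have h2 : ∀ p : H ⊗[k] H, 𝖫 𝖽 (TensorProduct.assoc k H H Z (p ⊗ₜ z)) =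
        A (comul.lTensor H p) := by
      intro p
      induction p with
      | zero => simp
      | add s t hs ht => simp only [map_add, add_tmul, hs, ht]
      | tmul a b =>
        simp only [TensorProduct.assoc_tmul, LinearMap.lTensor_tmul, head12_tmul]
        generalize (comul b : H ⊗[k] H) = q
        induction q with
        | zero => simp
        | add s t hs ht => simp only [map_add, tmul_add, add_tmul, hs, ht]
        | tmul c d => simp [A]
    rw [head12_tmul, h1, h2, Coalgebra.coassoc_apply]

theorem st_counit_comul (t : H ⊗[k] Z) : 𝖾 (𝖽 t) = t := by
  induction t with
  | zero => simp
  | add s t hs ht => simp only [map_add, hs, ht]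
  | tmul x z =>
    have h : ∀ p : H ⊗[k] H, 𝖾 (TensorProduct.assoc k H H Z (p ⊗ₜ z)) =
        TensorProduct.lid k H (counit.rTensor H p) ⊗ₜ z := by
      intro p
      induction p with
      | zero => simp
      | add s t hs ht => simp only [map_add, add_tmul, hs, ht]
      | tmul c d => simp [smul_tmul']
    rw [head12_tmul, h]
    simp

theorem st_comul_counit (t : H ⊗[k] Z) : 𝖫 𝖾 (𝖽 t) = t := by
  induction t with
  | zero => simp
  | add s t hs ht => simp only [map_add, hs, ht]
  | tmul x z =>
    have h : ∀ p : H ⊗[k] H, 𝖫 𝖾 (TensorProduct.assoc k H H Z (p ⊗ₜ z)) =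
        TensorProduct.rid k H (counit.lTensor H p) ⊗ₜ z := by
      intro p
      induction p with
      | zero => simp
      | add s t hs ht => simp only [map_add, add_tmul, hs, ht]
      | tmul c d => simp [smul_tmul']
    rw [head12_tmul, h]
    simp

theorem st_comul_mul (t : H ⊗[k] (H ⊗[k] Z)) :
    𝖽 (𝗆 t) = 𝖫 𝗆 (𝗆 (𝖫 𝖼 (𝖽 (𝖫 𝖽 t)))) := by
  refine tensor3_ext (f := 𝖽 ∘ₗ 𝗆) (g := 𝖫 𝗆 ∘ₗ 𝗆 ∘ₗ 𝖫 𝖼 ∘ₗ 𝖽 ∘ₗ 𝖫 𝖽) ?_ t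
  intro x y z
  have h := LinearMap.congr_fun (BraidedHopfAlgebra.comul_mul (k := k) (B := B) (H := H)) (x ⊗ₜ y)
  simp only [LinearMap.comp_apply, LinearMap.mul'_apply, map_tmul] at h
  simp only [LinearMap.comp_apply, head21_tmul, LinearMap.mul'_apply, LinearMap.lTensor_tmul,
    head12_tmul, h]
  generalize (comul x : H ⊗[k] H) = p
  generalize (comul y : H ⊗[k] H) = q
  induction p with
  | zero => simp
  | add s t hs ht => simp only [map_add, add_tmul, hs, ht]
  | tmul a b =>
    induction q with
    | zero => simp
    | add s t hs ht => simp only [map_add, add_tmul, tmul_add, hs, ht]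
    | tmul c d =>
      simp only [tensorMul, mid, LinearMap.comp_apply, LinearEquiv.coe_coe,
        TensorProduct.assoc_tmul, TensorProduct.assoc_symm_tmul, LinearMap.lTensor_tmul,
        LinearMap.rTensor_tmul, head12_tmul, cr_tmul]
      generalize braid k B H H (b ⊗ₜ c) = r
      induction r with
      | zero => simp
      | add s t hs ht => simp only [map_add, add_tmul, tmul_add, hs, ht]
      | tmul e f => simp [head12_tmul, cr_tmul]

theorem st_comul_one (B : Type*) [Ring B] [HopfAlgebra k B] [YDData k B H]
    [BraidedHopfAlgebra k B H] (t : Z) : 𝖽 (𝗎 t) = 𝗎 (𝗎 t) := by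
  have : (comul : H →ₗ[k] H ⊗[k] H) 1 = 1 ⊗ₜ 1 := BraidedHopfAlgebra.comul_one B
  simp [head12_tmul, this]

theorem st_counit_one (B : Type*) [Ring B] [HopfAlgebra k B] [YDData k B H]
    [BraidedHopfAlgebra k B H] (t : Z) : 𝖾 (𝗎 t) = t := by
  have : (counit : H →ₗ[k] k) 1 = 1 := BraidedHopfAlgebra.counit_one B
  simp [this]

theorem st_counit_mul (B : Type*) [Ring B] [HopfAlgebra k B] [YDData k B H]
    [BraidedHopfAlgebra k B H] (t : H ⊗[k] (H ⊗[k] Z)) : 𝖾 (𝗆 t) = 𝖾 (𝖾 t) := by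
  refine tensor3_ext (f := 𝖾 ∘ₗ 𝗆) (g := 𝖾 ∘ₗ 𝖾) ?_ t
  intro x y z
  have : ∀ x y : H, (counit : H →ₗ[k] k) (x * y) = counit x * counit y :=
    BraidedHopfAlgebra.counit_mul B
  simp [this, smul_smul, mul_comm]

theorem st_antipode_left (t : H ⊗[k] Z) : 𝗆 (𝗌 (𝖽 t)) = 𝗎 (𝖾 t) := by
  induction t with
  | zero => simp
  | add s t hs ht => simp only [map_add, hs, ht]
  | tmul x z =>
    have h : ∀ p : H ⊗[k] H, 𝗆 (𝗌 (TensorProduct.assoc k H H Z (p ⊗ₜ z))) =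
        mul' k H ((braidedAntipode k B H).rTensor H p) ⊗ₜ z := by
      intro p
      induction p with
      | zero => simp
      | add s t hs ht => simp only [map_add, add_tmul, hs, ht]
      | tmul c d => simp
    have h2 := LinearMap.congr_fun (BraidedHopfAlgebra.S_left (k := k) (B := B) (H := H)) x
    simp only [LinearMap.comp_apply] at h2
    rw [head12_tmul, h, braidedAntipode, h2]
    simp [Algebra.algebraMap_eq_smul_one, smul_tmul]

theorem st_antipode_right (t : H ⊗[k] Z) : 𝗆 (𝖫 𝗌 (𝖽 t)) = 𝗎 (𝖾 t) := by
  induction t with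
  | zero => simp
  | add s t hs ht => simp only [map_add, hs, ht]
  | tmul x z =>
    have h : ∀ p : H ⊗[k] H, 𝗆 (𝖫 𝗌 (TensorProduct.assoc k H H Z (p ⊗ₜ z))) =
        mul' k H ((braidedAntipode k B H).lTensor H p) ⊗ₜ z := by
      intro p
      induction p with
      | zero => simp
      | add s t hs ht => simp only [map_add, add_tmul, hs, ht]
      | tmul c d => simp
    have h2 := LinearMap.congr_fun (BraidedHopfAlgebra.S_right (k := k) (B := B) (H := H)) x
    simp only [LinearMap.comp_apply] at h2
    rw [head12_tmul, h, braidedAntipode, h2]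
    simp [Algebra.algebraMap_eq_smul_one, smul_tmul]

end BraidedHopf

section Interchange

variable {k : Type*} [CommSemiring k]
variable {A C V W X Y Z Z' : Type*} [AddCommMonoid A] [Module k A] [AddCommMonoid C] [Module k C]
  [AddCommMonoid V] [Module k V] [AddCommMonoid W] [Module k W]
  [AddCommMonoid X] [Module k X] [AddCommMonoid Y] [Module k Y] [AddCommMonoid Z] [Module k Z]
  [AddCommMonoid Z'] [Module k Z']

local notation "𝖫" => LinearMap.lTensor _

/-! ### Interchange laws one and two levels down -/

theorem lT_head21 (f : V ⊗[k] W →ₗ[k] X) (g : Z →ₗ[k] Z') (t : A ⊗[k] (V ⊗[k] (W ⊗[k] Z))) :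
    𝖫 (head21 Z' f) (𝖫 (𝖫 (𝖫 g)) t) = 𝖫 (𝖫 g) (𝖫 (head21 Z f) t) := lift22 (head21_lTensor f g) t

theorem lT_head12 (f : V →ₗ[k] W ⊗[k] X) (g : Z →ₗ[k] Z') (t : A ⊗[k] (V ⊗[k] Z)) :
    𝖫 (head12 Z' f) (𝖫 (𝖫 g) t) = 𝖫 (𝖫 (𝖫 g)) (𝖫 (head12 Z f) t) := lift22 (head12_lTensor f g) t

theorem lT_head20 (f : V ⊗[k] W →ₗ[k] k) (g : Z →ₗ[k] Z') (t : A ⊗[k] (V ⊗[k] (W ⊗[k] Z))) :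
    𝖫 (head20 Z' f) (𝖫 (𝖫 (𝖫 g)) t) = 𝖫 g (𝖫 (head20 Z f) t) := lift22 (head20_lTensor f g) t

theorem lT_head10 (f : V →ₗ[k] k) (g : Z →ₗ[k] Z') (t : A ⊗[k] (V ⊗[k] Z)) :
    𝖫 (head10 Z' f) (𝖫 (𝖫 g) t) = 𝖫 g (𝖫 (head10 Z f) t) := lift22 (head10_lTensor f g) t

theorem lT_rTensor (f : V →ₗ[k] W) (g : Z →ₗ[k] Z') (t : A ⊗[k] (V ⊗[k] Z)) :
    𝖫 (f.rTensor Z') (𝖫 (𝖫 g) t) = 𝖫 (𝖫 g) (𝖫 (f.rTensor Z) t) :=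
  lift22 (rTensor_lTensor_comm f g) t

theorem mk_lTensor (v : V) (g : Z →ₗ[k] Z') (t : Z) :
    TensorProduct.mk k V Z' v (g t) = 𝖫 g (TensorProduct.mk k V Z v t) := rfl

theorem lT_mk (v : V) (g : Z →ₗ[k] Z') (t : A ⊗[k] Z) :
    𝖫 (TensorProduct.mk k V Z' v) (𝖫 g t) = 𝖫 (𝖫 g) (𝖫 (TensorProduct.mk k V Z v) t) :=
  lift22 (mk_lTensor v g) t

theorem lT2_head12 (f : V →ₗ[k] W ⊗[k] X) (g : Z →ₗ[k] Z') (t : C ⊗[k] (A ⊗[k] (V ⊗[k] Z))) :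
    𝖫 (𝖫 (head12 Z' f)) (𝖫 (𝖫 (𝖫 g)) t) = 𝖫 (𝖫 (𝖫 (𝖫 g))) (𝖫 (𝖫 (head12 Z f)) t) :=
  lift22 (lT_head12 f g) t

end Interchange

section Interchange

variable {k B : Type*} [Field k] [Ring B] [HopfAlgebra k B]
variable {A C V W Z Z' : Type*} [AddCommMonoid A] [Module k A] [AddCommMonoid C] [Module k C]
  [AddCommMonoid V] [Module k V] [AddCommMonoid W] [Module k W]
  [AddCommMonoid Z] [Module k Z] [AddCommMonoid Z'] [Module k Z'] [YDData k B V] [YDData k B W]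

local notation "𝖫" => LinearMap.lTensor _

theorem lT_cr (g : Z →ₗ[k] Z') (t : A ⊗[k] (V ⊗[k] (W ⊗[k] Z))) :
    𝖫 (cr B) (𝖫 (𝖫 (𝖫 g)) t) = 𝖫 (𝖫 (𝖫 g)) (𝖫 (cr B) t) := lift22 (cr_lTensor g) t

theorem lT2_cr (g : Z →ₗ[k] Z') (t : C ⊗[k] (A ⊗[k] (V ⊗[k] (W ⊗[k] Z)))) :
    𝖫 (𝖫 (cr B)) (𝖫 (𝖫 (𝖫 (𝖫 g))) t) = 𝖫 (𝖫 (𝖫 (𝖫 g))) (𝖫 (𝖫 (cr B)) t) :=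
  lift22 (lT_cr g) t

end Interchange

section Lift

variable {k : Type*} [CommSemiring k]
variable {X M N P Q R S T : Type*} [AddCommMonoid X] [Module k X] [AddCommMonoid M] [Module k M]
  [AddCommMonoid N] [Module k N] [AddCommMonoid P] [Module k P] [AddCommMonoid Q] [Module k Q]
  [AddCommMonoid R] [Module k R] [AddCommMonoid S] [Module k S] [AddCommMonoid T] [Module k T]

theorem lift41 {a : N →ₗ[k] P} {b : M →ₗ[k] N} {b' : Q →ₗ[k] M} {b'' : R →ₗ[k] Q} {c : R →ₗ[k] P}
    (h : ∀ t, a (b (b' (b'' t))) = c t) (t : X ⊗[k] R) :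
    a.lTensor X (b.lTensor X (b'.lTensor X (b''.lTensor X t))) = c.lTensor X t := by
  rw [← LinearMap.lTensor_comp_apply X b' b'', lift31 (b' := b' ∘ₗ b'') h]

theorem lift42 {a : N →ₗ[k] P} {b : M →ₗ[k] N} {b' : Q →ₗ[k] M} {b'' : R →ₗ[k] Q} {c : S →ₗ[k] P}
    {d : R →ₗ[k] S} (h : ∀ t, a (b (b' (b'' t))) = c (d t)) (t : X ⊗[k] R) :
    a.lTensor X (b.lTensor X (b'.lTensor X (b''.lTensor X t))) = c.lTensor X (d.lTensor X t) := by
  rw [← LinearMap.lTensor_comp_apply X b' b'', lift32 (b' := b' ∘ₗ b'') h]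

theorem lift43 {a : N →ₗ[k] P} {b : M →ₗ[k] N} {b' : Q →ₗ[k] M} {b'' : R →ₗ[k] Q} {c : S →ₗ[k] P}
    {d : T →ₗ[k] S} {d' : R →ₗ[k] T} (h : ∀ t, a (b (b' (b'' t))) = c (d (d' t))) (t : X ⊗[k] R) :
    a.lTensor X (b.lTensor X (b'.lTensor X (b''.lTensor X t))) =
      c.lTensor X (d.lTensor X (d'.lTensor X t)) := by
  rw [← LinearMap.lTensor_comp_apply X b' b'', lift33 (b' := b' ∘ₗ b'') h]

end Lift

/-! ### The braided antipode reverses products and coproducts. -/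

section Antipode

variable {k B H : Type*} [Field k] [Ring B] [HopfAlgebra k B]
  [Ring H] [Algebra k H] [Coalgebra k H] [YDData k B H] [BraidedHopfAlgebra k B H]
variable {Z Z' : Type*} [AddCommMonoid Z] [Module k Z] [AddCommMonoid Z'] [Module k Z']

local notation "𝖫" => LinearMap.lTensor _
local notation "𝖼" => cr B
local notation "𝗆" => head21 _ (mul' k H)
local notation "𝖽" => head12 _ (comul : H →ₗ[k] H ⊗[k] H)
local notation "𝖾" => head10 _ (counit : H →ₗ[k] k)
local notation "𝗌" => LinearMap.rTensor _ (braidedAntipode k B H)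
local notation "𝗎" => TensorProduct.mk k H _ (1 : H)

theorem lT_mul_assoc {A : Type*} [AddCommMonoid A] [Module k A]
    (t : A ⊗[k] (H ⊗[k] (H ⊗[k] (H ⊗[k] Z)))) : 𝖫 𝗆 (𝖫 𝗆 t) = 𝖫 𝗆 (𝖫 (𝖫 𝗆) t) :=
  lift22 st_mul_assoc t

theorem lT_coassoc {A : Type*} [AddCommMonoid A] [Module k A]
    (t : A ⊗[k] (H ⊗[k] Z)) : 𝖫 𝖽 (𝖫 𝖽 t) = 𝖫 (𝖫 𝖽) (𝖫 𝖽 t) :=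
  lift22 st_coassoc t

/-- `∑ S(x₁ y) x₂ = ε(x) S(y)`, with `x₂` braided past `y`. -/
theorem st_antipode_mul_mul (t : H ⊗[k] (H ⊗[k] Z)) :
    𝗆 (𝗌 (𝗆 (𝖫 𝖼 (𝖽 t)))) = 𝗌 (𝖾 t) := by
  -- The element ∑ S((x y₁)₁)(x y₁)₂ S(y₂) is computed in two ways: here the first two factors
  -- contract; expanding the comultiplication of x y₁ instead makes the y-terms contract with S(y₂).
  have h1 : 𝗆 (𝖫 𝗌 (𝗆 (𝗌 (𝖽 (𝗆 (𝖫 𝖽 t)))))) = 𝗌 (𝖾 t) := by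
    rw [st_antipode_left, ← mk_lTensor, st_one_mul, st_counit_mul B, head10_lTensor,
      st_counit_comul]
  have h2 : ∀ u : H ⊗[k] (H ⊗[k] Z), 𝗆 (𝖫 𝗆 (𝖫 (𝖫 𝗌) (𝖫 𝖽 u))) = 𝖫 𝖾 u := by
    intro u
    rw [lift32 (c := 𝗎) (d := 𝖾) st_antipode_right, st_mul_one]
  calc 𝗆 (𝗌 (𝗆 (𝖫 𝖼 (𝖽 t)))) = 𝗆 (𝗌 (𝗆 (𝖫 𝖼 (𝖽 (𝖫 (𝖫 𝖾) (𝖫 𝖽 t)))))) := by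
        rw [lift20 st_comul_counit]
    _ = 𝖫 𝖾 (𝗆 (𝗌 (𝗆 (𝖫 𝖼 (𝖽 (𝖫 𝖽 t)))))) := by
        simp only [head12_lTensor, lT_cr, head21_lTensor, rTensor_lTensor_comm]
    _ = 𝗆 (𝖫 𝗌 (𝗆 (𝗌 (𝖽 (𝗆 (𝖫 𝖽 t)))))) := by
        rw [← h2, st_comul_mul (B := B)]
        simp only [head12_lTensor, lT_cr, head21_lTensor, rTensor_lTensor_comm, ← st_mul_assoc,
          lT_coassoc]
    _ = 𝗌 (𝖾 t) := h1

/-- `∑ S(x₁)₁ x₂ ⊗ S(x₁)₂ = 1 ⊗ S(x)`, with `x₂` braided past `S(x₁)₂`. -/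
theorem st_comul_antipode_mul (t : H ⊗[k] Z) :
    𝗆 (𝖫 𝖼 (𝖽 (𝗌 (𝖽 t)))) = 𝗎 (𝗌 t) := by
  -- The auxiliary element is Δ(S(x₁) x₂)(1 ⊗ S(x₃)). Here S(x₁) x₂ contracts; expanding Δ of the
  -- product lets the last two factors contract instead.
  have h1 : 𝖫 𝗆 (𝖽 (𝗆 (𝗌 (𝖽 (𝖫 𝗌 (𝖽 t)))))) = 𝗎 (𝗌 t) := by
    rw [st_antipode_left, st_comul_one B, ← mk_lTensor, st_one_mul, head10_lTensor,
      st_counit_comul]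
  have h2 : ∀ u : H ⊗[k] Z, 𝖫 𝗆 (𝖽 (𝖫 𝗌 (𝖽 u))) = 𝖫 𝗎 u := by
    intro u
    rw [head12_lTensor, st_coassoc, lift32 st_antipode_right, st_comul_counit]
  have h3 : ∀ u : H ⊗[k] (H ⊗[k] Z), 𝖫 𝗆 (𝖫 𝗆 (𝗆 (𝖫 𝖼 (𝖽 (𝖫 𝖽 (𝖫 (𝖫 𝗌) (𝖫 𝖽 u))))))) =
      𝗆 (𝖫 𝖼 (𝖽 u)) := by
    intro u
    rw [lT_mul_assoc, ← head21_lTensor, ← lT_cr, ← head12_lTensor, lift41 h2]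
    simp only [head12_lTensor, lT_cr, head21_lTensor]
    rw [lift20 st_mul_one]
  rw [← h1, st_comul_mul (B := B), ← h3]
  simp only [head12_lTensor, lT_cr, head21_lTensor, rTensor_lTensor_comm, ← st_mul_assoc,
          lT_coassoc, st_coassoc]

/-- The antipode of a braided Hopf algebra is an antimorphism of algebras. -/
theorem st_antipode_mul (t : H ⊗[k] (H ⊗[k] Z)) : 𝗌 (𝗆 t) = 𝗆 (𝖼 (𝗌 (𝖫 𝗌 t))) := by
  -- The common value is ∑ S(x₁ y) x₂ S(x₃), up to braiding. Contracting x₂ S(x₃) gives S(x y);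
  -- contracting S(x₁ y) x₂ gives S(y) S(x).
  have h1 : 𝗆 (𝗌 (𝗆 (𝖫 (𝖫 𝗆) (𝖫 (𝖫 (𝖫 𝗌)) (𝖫 (𝖫 𝖽) (𝖫 𝖼 (𝖽 t))))))) = 𝗌 (𝗆 t) := by
    rw [lift32 (lift32 st_antipode_right), lift21 (cr_left10 (counit_hom k B H) (isYD_base k B H)),
      st_comul_counit, head21_lTensor, rTensor_lTensor_comm, st_mul_one]
  have h2 : 𝗆 (𝗌 (𝗆 (𝖫 (𝖫 𝗆) (𝖫 (𝖫 (𝖫 𝗌)) (𝖫 (𝖫 𝖽) (𝖫 𝖼 (𝖽 t))))))) =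
      𝗆 (𝖼 (𝗌 (𝖫 𝗌 t))) := by
    rw [← lift32 (cr_left12 (comul_hom k B H) (isYD_base k B H)), ← st_coassoc, ← head12_lTensor,
      head21_lTensor, rTensor_lTensor_comm, ← st_mul_assoc, ← lT_cr, ← head12_lTensor,
      st_antipode_mul_mul, head10_lTensor, head10_lTensor, st_counit_comul,
      rTensor_lTensor_comm, ← cr_right (antipode_hom k B H), ← cr_left (antipode_hom k B H)]
  exact h1.symm.trans h2

/-- The antipode of a braided Hopf algebra is an antimorphism of coalgebras. -/
theorem st_comul_antipode (t : H ⊗[k] Z) : 𝖽 (𝗌 t) = 𝗌 (𝖫 𝗌 (𝖼 (𝖽 t))) := by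
  -- The common value is ∑ S(x₁)₁ x₂ S(x₃) ⊗ S(x₁)₂, up to braiding, contracted at x₂ S(x₃) or at
  -- S(x₁)₁ x₂.
  have h1 : 𝗆 (𝖫 𝗆 (𝖫 (𝖫 𝗌) (𝖫 𝖽 (𝖫 𝖼 (𝖽 (𝗌 (𝖽 t))))))) = 𝖽 (𝗌 t) := by
    rw [lift32 st_antipode_right, lift21 (cr_right10 (counit_hom k B H) (isYD_base k B H)),
      ← head12_lTensor, ← rTensor_lTensor_comm, st_comul_counit, st_mul_one]
  have h2 : 𝗆 (𝖫 𝗆 (𝖫 (𝖫 𝗌) (𝖫 𝖽 (𝖫 𝖼 (𝖽 (𝗌 (𝖽 t))))))) = 𝗌 (𝖫 𝗌 (𝖼 (𝖽 t))) := by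
    rw [← lift32 (cr_right12 (comul_hom k B H) (isYD_base k B H)), ← head12_lTensor,
      ← rTensor_lTensor_comm, ← st_coassoc, ← st_mul_assoc, head21_lTensor, head21_lTensor,
      st_comul_antipode_mul, ← mk_lTensor, ← mk_lTensor, st_one_mul, cr_left (antipode_hom k B H)]
  exact h1.symm.trans h2

theorem st_antipode_one (B : Type*) [Ring B] [HopfAlgebra k B] [YDData k B H]
    [BraidedHopfAlgebra k B H] (t : Z) : LinearMap.rTensor _ (braidedAntipode k B H) (𝗎 t) = 𝗎 t := by
  have h := st_antipode_left (B := B) (𝗎 t)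
  have h1 : LinearMap.rTensor _ (braidedAntipode k B H) (𝗎 (𝗎 t)) =
      𝖫 𝗎 (LinearMap.rTensor _ (braidedAntipode k B H) (𝗎 t)) := rfl
  rwa [st_comul_one B, st_counit_one B, h1, st_mul_one] at h

end Antipode

/-- A braided Hopf algebra with bijective antipode whose braiding is an involution. -/
class IsSymmetricHopf (k B H : Type*) [Field k] [Ring B] [HopfAlgebra k B]
    [Ring H] [Algebra k H] [Coalgebra k H] [YDData k B H] [BraidedHopfAlgebra k B H] : Prop where
  braid_braid : braid k B H H ∘ₗ braid k B H H = LinearMap.id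
  bijective_antipode : Function.Bijective (braidedAntipode k B H)

/-! ### The opposite comultiplication and the inverse antipode when the braiding of `H` is an
involution. -/

section Symmetric

variable (k B H : Type*) [Field k] [Ring B] [HopfAlgebra k B]
  [Ring H] [Algebra k H] [Coalgebra k H] [YDData k B H] [BraidedHopfAlgebra k B H]

/-- The opposite comultiplication. -/
def comulCop : H →ₗ[k] H ⊗[k] H := braid k B H H ∘ₗ comul

/-- The inverse of the antipode. -/
def antipodeSymm [IsSymmetricHopf k B H] : H →ₗ[k] H :=
  (LinearEquiv.ofBijective (braidedAntipode k B H)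
    IsSymmetricHopf.bijective_antipode).symm.toLinearMap

theorem comulCop_hom : IsYDHom k B (comulCop k B H) :=
  (IsYDHom.braid (isYD_base k B H) (isYD_base k B H)).comp (comul_hom k B H)

variable [IsSymmetricHopf k B H]

theorem antipodeSymm_hom : IsYDHom k B (antipodeSymm k B H) :=
  IsYDHom.symm (e := LinearEquiv.ofBijective (braidedAntipode k B H)
    IsSymmetricHopf.bijective_antipode) (antipode_hom k B H)

variable {k B H}
variable {Z : Type*} [AddCommMonoid Z] [Module k Z]

local notation "𝖫" => LinearMap.lTensor _
local notation "𝖼" => cr B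
local notation "𝗆" => head21 _ (mul' k H)
local notation "𝖽" => head12 _ (comul : H →ₗ[k] H ⊗[k] H)
local notation "𝖣" => head12 _ (comulCop k B H)
local notation "𝖾" => head10 _ (counit : H →ₗ[k] k)
local notation "𝗌" => LinearMap.rTensor _ (braidedAntipode k B H)
local notation "𝗍" => LinearMap.rTensor _ (antipodeSymm k B H)
local notation "𝗎" => TensorProduct.mk k H _ (1 : H)

theorem antipodeSymm_antipode (x : H) : antipodeSymm k B H (braidedAntipode k B H x) = x :=
  LinearEquiv.symm_apply_apply (LinearEquiv.ofBijective (braidedAntipode k B H)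
    IsSymmetricHopf.bijective_antipode) x

theorem antipode_antipodeSymm (x : H) : braidedAntipode k B H (antipodeSymm k B H x) = x :=
  LinearEquiv.apply_symm_apply (LinearEquiv.ofBijective (braidedAntipode k B H)
    IsSymmetricHopf.bijective_antipode) x

theorem st_antipodeSymm_antipode (t : H ⊗[k] Z) : 𝗍 (𝗌 t) = t := by
  rw [← LinearMap.rTensor_comp_apply,
    LinearMap.ext (f := antipodeSymm k B H ∘ₗ braidedAntipode k B H) (g := LinearMap.id)
      antipodeSymm_antipode, LinearMap.rTensor_id, LinearMap.id_apply]

theorem st_antipode_antipodeSymm (t : H ⊗[k] Z) : 𝗌 (𝗍 t) = t := by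
  rw [← LinearMap.rTensor_comp_apply,
    LinearMap.ext (f := braidedAntipode k B H ∘ₗ antipodeSymm k B H) (g := LinearMap.id)
      antipode_antipodeSymm, LinearMap.rTensor_id, LinearMap.id_apply]

theorem st_braid_braid (t : H ⊗[k] (H ⊗[k] Z)) : 𝖼 (𝖼 t) = t := by
  have h : ∀ s : (H ⊗[k] H) ⊗[k] Z,
      (braid k B H H).rTensor Z ((braid k B H H).rTensor Z s) = s := by
    intro s
    rw [← LinearMap.rTensor_comp_apply, IsSymmetricHopf.braid_braid, LinearMap.rTensor_id,
      LinearMap.id_apply]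
  simp [cr, head22, h]

theorem st_comulCop (t : H ⊗[k] Z) : 𝖣 t = 𝖼 (𝖽 t) := by
  simp [cr, head22, head12, comulCop, LinearMap.rTensor_comp]

theorem st_braid_comulCop (t : H ⊗[k] Z) : 𝖼 (𝖣 t) = 𝖽 t := by
  rw [st_comulCop, st_braid_braid]

/-- Naturality of the braiding in the comultiplication reduces this to the Yang–Baxter equation,
which is the local fact `h1`. -/
theorem st_cop_coassoc (t : H ⊗[k] Z) : 𝖣 (𝖣 t) = 𝖫 𝖣 (𝖣 t) := by
  have h1 : ∀ u : H ⊗[k] (H ⊗[k] (H ⊗[k] Z)), 𝖼 (𝖫 𝖼 (𝖼 u)) = 𝖫 𝖼 (𝖼 (𝖫 𝖼 u)) :=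
    fun u => cr_left22 (IsYDHom.braid (isYD_base k B H) (isYD_base k B H)) (isYD_base k B H) u
  rw [← lift21 (fun t => (st_comulCop t).symm)]
  rw [st_comulCop, st_comulCop, ← cr_right12 (comul_hom k B H) (isYD_base k B H),
    ← cr_left12 (comul_hom k B H) (isYD_base k B H), st_coassoc, h1]

/-- Coassociativity with one comultiplication reversed; it is responsible for the commutation of the
two regular actions of U on H. -/
theorem st_cop_mixed (t : H ⊗[k] Z) : 𝖫 𝖣 (𝖽 t) = 𝖼 (𝖫 𝖽 (𝖣 t)) := by
  rw [← lift21 (fun t => (st_comulCop t).symm)]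
  rw [st_comulCop, ← cr_left12 (comul_hom k B H) (isYD_base k B H), st_braid_braid, st_coassoc]

theorem st_counit_cop (t : H ⊗[k] Z) : 𝖾 (𝖣 t) = t := by
  rw [st_comulCop, cr_right10 (counit_hom k B H) (isYD_base k B H), st_comul_counit]

theorem st_cop_counit (t : H ⊗[k] Z) : 𝖫 𝖾 (𝖣 t) = t := by
  rw [st_comulCop, cr_left10 (counit_hom k B H) (isYD_base k B H), st_counit_comul]

theorem st_cop_one (B : Type*) [Ring B] [HopfAlgebra k B] [YDData k B H]
    [BraidedHopfAlgebra k B H] [IsSymmetricHopf k B H] (t : Z) :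
    head12 _ (comulCop k B H) (𝗎 t) = 𝗎 (𝗎 t) := by
  rw [st_comulCop, st_comul_one B, TensorProduct.mk_apply,
    cr_left01 (one_hom k B H) (isYD_base k B H)]
  rfl

/-- The opposite comultiplication is multiplicative for the same braided product on H ⊗ H because
over- and undercrossings of H with H coincide. -/
theorem st_cop_mul (t : H ⊗[k] (H ⊗[k] Z)) : 𝖣 (𝗆 t) = 𝖫 𝗆 (𝗆 (𝖫 𝖼 (𝖣 (𝖫 𝖣 t)))) := by
  rw [← lift21 (fun t => (st_comulCop t).symm)]
  rw [st_comulCop, st_comulCop, st_comul_mul (B := B), cr_right21 (mul_hom k B H) (isYD_base k B H),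
    cr_left21 (mul_hom k B H) (isYD_base k B H), lift20 st_braid_braid,
    ← lift32 (fun t => (cr_left21 (mul_hom k B H) (isYD_base k B H) t).symm), head21_lTensor]
  simp only [head12_lTensor, cr_lTensor]

theorem st_antipodeSymm_one (B : Type*) [Ring B] [HopfAlgebra k B] [YDData k B H]
    [BraidedHopfAlgebra k B H] [IsSymmetricHopf k B H] (t : Z) :
    LinearMap.rTensor _ (antipodeSymm k B H) (𝗎 t) = 𝗎 t := by
  rw [← st_antipode_one B t, st_antipodeSymm_antipode (B := B), st_antipode_one B]

theorem st_antipodeSymm_mul (t : H ⊗[k] (H ⊗[k] Z)) : 𝗍 (𝗆 t) = 𝗆 (𝖼 (𝗍 (𝖫 𝗍 t))) := by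
  rw [← st_antipodeSymm_antipode (B := B) (𝗆 (𝖼 (𝗍 (𝖫 𝗍 t)))), st_antipode_mul (B := B),
    rTensor_lTensor_comm, ← cr_right (antipode_hom k B H), ← cr_left (antipode_hom k B H), st_braid_braid,
    rTensor_lTensor_comm, st_antipode_antipodeSymm, lift20 st_antipode_antipodeSymm]

theorem st_cop_antipodeSymm (t : H ⊗[k] Z) : 𝖣 (𝗍 t) = 𝗍 (𝖫 𝗍 (𝖽 t)) := by
  conv_rhs => rw [← st_antipode_antipodeSymm (B := B) t, st_comul_antipode, ← st_comulCop]
  rw [← rTensor_lTensor_comm, st_antipodeSymm_antipode, lift20 st_antipodeSymm_antipode]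

theorem st_comul_antipodeSymm (t : H ⊗[k] Z) : 𝖽 (𝗍 t) = 𝗍 (𝖫 𝗍 (𝖣 t)) := by
  rw [← st_braid_comulCop (B := B), st_cop_antipodeSymm, cr_left (antipodeSymm_hom k B H),
    cr_right (antipodeSymm_hom k B H), ← rTensor_lTensor_comm, st_comulCop]

/-- S⁻¹ is the antipode for the opposite comultiplication: apply S, which reverses the product, and
use the antipode axiom. -/
theorem st_antipodeSymm_left (t : H ⊗[k] Z) : 𝗆 (𝗍 (𝖣 t)) = 𝗎 (𝖾 t) := by
  rw [← st_antipodeSymm_antipode (B := B) (𝗆 (𝗍 (𝖣 t))), st_antipode_mul (B := B),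
    rTensor_lTensor_comm, st_antipode_antipodeSymm, cr_right (antipode_hom k B H),
    st_braid_comulCop, st_antipode_left, st_antipodeSymm_one B]

theorem st_antipodeSymm_right (t : H ⊗[k] Z) : 𝗆 (𝖫 𝗍 (𝖣 t)) = 𝗎 (𝖾 t) := by
  rw [← st_antipodeSymm_antipode (B := B) (𝗆 (𝖫 𝗍 (𝖣 t))), st_antipode_mul (B := B),
    lift20 st_antipode_antipodeSymm, cr_left (antipode_hom k B H),
    st_braid_comulCop, st_antipode_right, st_antipodeSymm_one B]

end Symmetric

/-! ### Head operations as morphisms, and surjectivity of the braiding. -/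

section Head

variable {k B : Type*} [Field k] [Ring B] [HopfAlgebra k B]
variable {V W X Y Z : Type*} [AddCommMonoid V] [Module k V] [AddCommMonoid W] [Module k W]
  [AddCommMonoid X] [Module k X] [AddCommMonoid Y] [Module k Y] [AddCommMonoid Z] [Module k Z]
  [YDData k B V] [YDData k B W] [YDData k B X] [YDData k B Y] [YDData k B Z]

namespace IsYDHom

theorem head21 {f : V ⊗[k] W →ₗ[k] X} (hf : IsYDHom k B f) : IsYDHom k B (head21 Z f) :=
  hf.rTensor.comp (IsYDHom.symm IsYDHom.assoc)

theorem head12 {f : V →ₗ[k] W ⊗[k] X} (hf : IsYDHom k B f) : IsYDHom k B (head12 Z f) :=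
  IsYDHom.assoc.comp hf.rTensor

theorem head22 {f : V ⊗[k] W →ₗ[k] X ⊗[k] Y} (hf : IsYDHom k B f) : IsYDHom k B (head22 Z f) :=
  IsYDHom.assoc.comp (hf.rTensor.comp (IsYDHom.symm IsYDHom.assoc))

theorem head20 {f : V ⊗[k] W →ₗ[k] k} (hf : IsYDHom k B f) : IsYDHom k B (head20 Z f) :=
  IsYDHom.lid.comp (hf.rTensor.comp (IsYDHom.symm IsYDHom.assoc))

theorem head10 {f : V →ₗ[k] k} (hf : IsYDHom k B f) : IsYDHom k B (head10 Z f) :=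
  IsYDHom.lid.comp hf.rTensor

theorem cr (hV : IsYD k B V) (hW : IsYD k B W) :
    IsYDHom k B (cr B : V ⊗[k] (W ⊗[k] Z) →ₗ[k] W ⊗[k] (V ⊗[k] Z)) :=
  (IsYDHom.braid hV hW).head22

end IsYDHom

variable [Module.Finite k B]

/-- A preimage of w ⊗ v is ∑ v₍₀₎ ⊗ S⁻¹(v₍₋₁₎) · w. -/
theorem braid_surjective (hV : IsYD k B V) (hW : IsYD k B W) :
    Function.Surjective (braid k B V W) := by
  let G : (B ⊗[k] V) ⊗[k] W →ₗ[k] V ⊗[k] W := (TensorProduct.comm k W V).toLinearMap ∘ₗ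
    crossAct k B V W ∘ₗ ((antipodeInv k B).rTensor V).rTensor W
  intro t
  induction t with
  | zero => exact ⟨0, map_zero _⟩
  | add x y hx hy =>
    obtain ⟨x', rfl⟩ := hx
    obtain ⟨y', rfl⟩ := hy
    exact ⟨x' + y', map_add _ _ _⟩
  | tmul w v =>
    refine ⟨G (coactMap k B V v ⊗ₜ w), ?_⟩
    let K : B ⊗[k] (B ⊗[k] V) →ₗ[k] W ⊗[k] V := crossAct k B V W ∘ₗ
      (TensorProduct.mk k _ W).flip w ∘ₗ (mul' k B ∘ₗ (antipodeInv k B).lTensor B ∘ₗ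
        (TensorProduct.comm k B B).toLinearMap).rTensor V ∘ₗ
        (TensorProduct.assoc k B B V).symm.toLinearMap
    have h1 : ∀ p : B ⊗[k] V, braid k B V W (G (p ⊗ₜ w)) =
        K ((coactMap k B V).lTensor B p) := by
      intro p
      induction p with
      | zero => simp
      | add s t hs ht => simp only [map_add, add_tmul, hs, ht]
      | tmul b v =>
        simp only [G, K, LinearMap.comp_apply, LinearMap.rTensor_tmul, crossAct_tmul,
          LinearEquiv.coe_coe, TensorProduct.comm_tmul, braid_tmul, LinearMap.lTensor_tmul]
        generalize coactMap k B V v = q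
        induction q with
        | zero => simp
        | add s t hs ht => simp only [map_add, add_tmul, tmul_add, hs, ht]
        | tmul c v => simp [hW.mul_act]
    have h2 : ∀ p : B ⊗[k] V, K (TensorProduct.assoc k B B V (comul.rTensor V p)) =
        w ⊗ₜ TensorProduct.lid k V (counit.rTensor V p) := by
      intro p
      induction p with
      | zero => simp
      | add s t hs ht => simp only [map_add, tmul_add, hs, ht]
      | tmul b v =>
        simp only [K, LinearMap.comp_apply, LinearMap.rTensor_tmul, LinearEquiv.coe_coe,
          LinearEquiv.symm_apply_apply, mul_antipodeInv_comm']
        simp [Algebra.algebraMap_eq_smul_one, ← smul_tmul', hW.one_act]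
    rw [h1, ← hV.coassoc_apply, h2, hV.counit_apply]

theorem cr_surjective {Z' : Type*} [AddCommMonoid Z'] [Module k Z'] (hV : IsYD k B V)
    (hW : IsYD k B W) :
    Function.Surjective (cr B : V ⊗[k] (W ⊗[k] Z') →ₗ[k] W ⊗[k] (V ⊗[k] Z')) := by
  have := LinearMap.rTensor_surjective Z' (braid_surjective hV hW)
  intro t
  obtain ⟨s, hs⟩ := this ((TensorProduct.assoc k W V Z').symm t)
  exact ⟨TensorProduct.assoc k V W Z' s, by simp [cr, BraidedDuality.head22, hs]⟩

end Head

/-! ### Joint injectivity of families of maps after tensoring. -/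

section Separation

variable {k : Type*} [Field k]

theorem lTensor_jointly_injective {ι V Q Y : Type*} [AddCommMonoid V] [Module k V]
    [AddCommMonoid Q] [Module k Q] [AddCommMonoid Y] [Module k Y] {F : ι → V →ₗ[k] Q}
    (hF : ∀ v v', (∀ i, F i v = F i v') → v = v') {t t' : Y ⊗[k] V}
    (h : ∀ i, (F i).lTensor Y t = (F i).lTensor Y t') : t = t' := by
  classical
  let _ : AddCommGroup Y := Module.addCommMonoidToAddCommGroup k
  let ℬ := Module.Basis.ofVectorSpace k Y
  have h1 : ∀ (p : ι) (t : Y ⊗[k] V) i, equivFinsuppOfBasisLeft ℬ ((F p).lTensor Y t) i =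
      F p (equivFinsuppOfBasisLeft ℬ t i) := by
    intro p t i
    induction t with
    | zero => simp
    | add s t hs ht => simp only [map_add, Finsupp.add_apply, hs, ht]
    | tmul c d => simp
  apply (equivFinsuppOfBasisLeft ℬ).injective
  ext i
  apply hF
  intro p
  rw [← h1, ← h1, h p]

end Separation

/-! ### Separation of `U` by evaluation, and the symmetry of the braidings with `U`. -/

namespace BraidedHopfSubalgebra

variable {k B H : Type*} [Field k] [Ring B] [HopfAlgebra k B] [Module.Finite k B]
  [Ring H] [Algebra k H] [Coalgebra k H] [YDData k B H] [BraidedHopfAlgebra k B H]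
  {U : BraidedHopfSubalgebra k B H}
variable {Y Z : Type*} [AddCommMonoid Y] [Module k Y] [AddCommMonoid Z] [Module k Z]

local notation "𝖫" => LinearMap.lTensor _
local notation "𝖼" => cr B
local notation "𝖊" => head20 _ (BraidedHopfSubalgebra.ev U)

/-- U consists of functionals on H, so its elements, even with a tail Z attached, are determined by
evaluation. This is the standard way of proving identities in U. -/
theorem ext_ev {t t' : U.carrier ⊗[k] Z}
    (h : ∀ x : H, 𝖊 (𝖫 (TensorProduct.mk k H Z x) t) = 𝖊 (𝖫 (TensorProduct.mk k H Z x) t')) :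
    t = t' := by
  apply (TensorProduct.comm k U.carrier Z).injective
  refine lTensor_jointly_injective (F := fun x : H => pairWith U.ev x) (U.separating_ev) ?_
  intro x
  apply (TensorProduct.rid k Z).injective
  have h1 : ∀ s : U.carrier ⊗[k] Z, TensorProduct.rid k Z ((pairWith U.ev x).lTensor Z
      (TensorProduct.comm k U.carrier Z s)) = 𝖊 (𝖫 (TensorProduct.mk k H Z x) s) := by
    intro s
    induction s with
    | zero => simp
    | add s t hs ht => simp only [map_add, hs, ht]
    | tmul c d => simp
  rw [h1, h1, h]

theorem lT_ext_ev {t t' : Y ⊗[k] (U.carrier ⊗[k] Z)}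
    (h : ∀ x : H, 𝖫 𝖊 (𝖫 (𝖫 (TensorProduct.mk k H Z x)) t) =
      𝖫 𝖊 (𝖫 (𝖫 (TensorProduct.mk k H Z x)) t')) : t = t' := by
  refine lTensor_jointly_injective
    (F := fun x : H => 𝖊 ∘ₗ 𝖫 (TensorProduct.mk k H Z x)) (fun v v' => ext_ev) ?_
  intro x
  simpa only [LinearMap.lTensor_comp, LinearMap.comp_apply] using h x

theorem ext_ev_ev {t t' : U.carrier ⊗[k] (U.carrier ⊗[k] Z)}
    (h : ∀ x y : H, 𝖊 (𝖫 𝖊 (𝖫 (𝖫 (𝖫 (TensorProduct.mk k H Z y))) (𝖫 (𝖫 (TensorProduct.mk k H Z x)) t))) =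
      𝖊 (𝖫 𝖊 (𝖫 (𝖫 (𝖫 (TensorProduct.mk k H Z y))) (𝖫 (𝖫 (TensorProduct.mk k H Z x)) t')))) : t = t' := by
  refine lT_ext_ev (Y := U.carrier) fun x => ?_
  refine ext_ev fun y => ?_
  simpa only [lT_head20] using h x y

section Symmetric

variable [IsSymmetricHopf k B H]

/-- Naturality slides the evaluation through a third strand of H; since the crossing of H with H is
an involution, the crossing may be transferred from the U-leg to the H-leg. -/
theorem st_ev_braid (t : U.carrier ⊗[k] (H ⊗[k] (H ⊗[k] Z))) : 𝖫 𝖊 (𝖼 t) = 𝖊 (𝖫 𝖼 t) := by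
  conv_lhs => rw [← lift20 (st_braid_braid (B := B)) t]
  exact cr_left20 U.ev_hom (isYD_base k B H) (𝖫 𝖼 t)

theorem st_ev_braid' (t : H ⊗[k] (U.carrier ⊗[k] (H ⊗[k] Z))) : 𝖊 (𝖫 𝖼 (𝖼 t)) = 𝖫 𝖊 t :=
  cr_right20 U.ev_hom (isYD_base k B H) t

/-- Once the U-strand is evaluated, the first crossing moves to the H-leg and the second undoes it.
-/
theorem st_braid_UH_HU (t : H ⊗[k] (U.carrier ⊗[k] Z)) : 𝖼 (𝖼 t) = t := by
  refine lT_ext_ev fun x => ?_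
  rw [← cr_lTensor, ← cr_lTensor, st_ev_braid, st_ev_braid']

/-- A right inverse of a surjection is a left inverse: the opposite composite is already known and
the braiding is onto. -/
theorem st_braid_HU_UH (t : U.carrier ⊗[k] (H ⊗[k] Z)) : 𝖼 (𝖼 t) = t := by
  obtain ⟨s, rfl⟩ := cr_surjective (isYD_base k B H) U.isYD t
  rw [st_braid_UH_HU]

theorem st_ev_ev_right (t : U.carrier ⊗[k] (U.carrier ⊗[k] (H ⊗[k] (H ⊗[k] Z)))) :
    𝖊 (𝖊 (𝖫 𝖼 t)) = 𝖊 (𝖫 𝖊 (𝖫 (𝖫 𝖼) t)) := by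
  rw [← head20_lTensor, lift22 (fun t => (st_ev_braid t)) t]

theorem st_ev_ev_braid (t : U.carrier ⊗[k] (U.carrier ⊗[k] (H ⊗[k] (H ⊗[k] Z)))) :
    𝖊 (𝖫 𝖊 (𝖼 t)) = 𝖊 (𝖫 𝖊 (𝖫 (𝖫 𝖼) t)) := by
  have h := st_ev_ev_right (𝖫 (𝖫 𝖼) (𝖼 t))
  rw [lift20 (lift20 (st_braid_braid (B := B)))] at h
  rw [← h, ← cr_lTensor, cr_right20 U.ev_hom U.isYD]

/-- Evaluating both strands turns each crossing in U ⊗ U into a crossing in H ⊗ H. -/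
theorem st_braid_UU (t : U.carrier ⊗[k] (U.carrier ⊗[k] Z)) : 𝖼 (𝖼 t) = t := by
  refine ext_ev_ev fun x y => ?_
  rw [← cr_lTensor, ← cr_lTensor, ← cr_lTensor, ← cr_lTensor, st_ev_ev_braid, ← cr_lTensor,
    st_ev_ev_braid, lift20 (lift20 (st_braid_braid (B := B)))]

end Symmetric

end BraidedHopfSubalgebra

namespace BraidedHopfSubalgebra

variable {k B H : Type*} [Field k] [Ring B] [HopfAlgebra k B] [Module.Finite k B]
  [Ring H] [Algebra k H] [Coalgebra k H] [YDData k B H] [BraidedHopfAlgebra k B H]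
  {U : BraidedHopfSubalgebra k B H}
variable {Y Z : Type*} [AddCommMonoid Y] [Module k Y] [AddCommMonoid Z] [Module k Z]

local notation "𝖫" => LinearMap.lTensor _
local notation "𝖼" => cr B
local notation "𝗆" => head21 _ (mul' k H)
local notation "𝖽" => head12 _ (Coalgebra.comul : H →ₗ[k] H ⊗[k] H)
local notation "𝖣" => head12 _ (comulCop k B H)
local notation "𝖾" => head10 _ (Coalgebra.counit : H →ₗ[k] k)
local notation "𝗎" => TensorProduct.mk k H _ (1 : H)
local notation "𝖊" => head20 _ (BraidedHopfSubalgebra.ev U)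
local notation "𝗆U" => head21 _ (BraidedHopfSubalgebra.mul U)
local notation "𝖽U" => head12 _ (BraidedHopfSubalgebra.comul U)

/-! ### The structure maps of `U` under evaluation -/

theorem dualPairing_smul (s : U.carrier ⊗[k] U.carrier) (x y : H) (z : Z) :
    dualPairing k B H (map U.carrier.subtype U.carrier.subtype s) (x ⊗ₜ y) • z =
      𝖊 (𝖊 (𝖫 𝖼 (TensorProduct.assoc k _ _ _ (s ⊗ₜ (x ⊗ₜ (y ⊗ₜ z)))))) := by
  induction s with
  | zero => simp
  | add s t hs ht => simp only [map_add, LinearMap.add_apply, add_smul, add_tmul, hs, ht]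
  | tmul f g =>
    have h := braid_natural U.subtype_hom
      (IsYDHom.id : IsYDHom k B (LinearMap.id : H →ₗ[k] H)) (g ⊗ₜ x)
    simp only [map_tmul, LinearMap.id_apply] at h
    simp only [dualPairing, map_tmul, TensorProduct.curry_apply, LinearMap.comp_apply, mid,
      LinearEquiv.coe_coe, TensorProduct.assoc_tmul, LinearMap.lTensor_tmul,
      TensorProduct.assoc_symm_tmul, LinearMap.rTensor_tmul, cr_tmul, h]
    generalize braid k B U.carrier H (g ⊗ₜ x) = q
    induction q with
    | zero => simp
    | add s t hs ht => simp only [map_add, add_tmul, tmul_add, add_smul, hs, ht]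
    | tmul w e => simp [ev, smul_smul, mul_comm]

theorem st_ev_ev_mul (t : U.carrier ⊗[k] (U.carrier ⊗[k] (H ⊗[k] Z))) :
    𝖊 (𝗆U t) = 𝖊 (𝖊 (𝖫 𝖼 (𝖫 (𝖫 𝖽) t))) := by
  refine tensor4_ext (f := 𝖊 ∘ₗ 𝗆U) (g := 𝖊 ∘ₗ 𝖊 ∘ₗ 𝖫 𝖼 ∘ₗ 𝖫 (𝖫 𝖽)) ?_ t
  intro f g x z
  have h : ∀ p : H ⊗[k] H, dualPairing k B H ((f : Module.Dual k H) ⊗ₜ (g : Module.Dual k H)) p • z =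
      𝖊 (𝖊 (𝖫 𝖼 (f ⊗ₜ (g ⊗ₜ TensorProduct.assoc k _ _ _ (p ⊗ₜ z))))) := by
    intro p
    induction p with
    | zero => simp
    | add s t hs ht => simp only [map_add, add_smul, add_tmul, tmul_add, hs, ht]
    | tmul x y => exact dualPairing_smul (f ⊗ₜ g) x y z
  have h1 : dualMul k B H ((f : Module.Dual k H) ⊗ₜ (g : Module.Dual k H)) x =
    dualPairing k B H ((f : Module.Dual k H) ⊗ₜ (g : Module.Dual k H)) (Coalgebra.comul x) := rfl
  simp only [LinearMap.comp_apply, head21_tmul, head20_tmul, ev_tmul, U.mul_spec, h1, h,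
    LinearMap.lTensor_tmul, head12_tmul]

theorem st_ev_ev_comul (t : U.carrier ⊗[k] (H ⊗[k] (H ⊗[k] Z))) :
    𝖊 (𝖊 (𝖫 𝖼 (𝖽U t))) = 𝖊 (𝖫 𝗆 t) := by
  refine tensor4_ext (f := 𝖊 ∘ₗ 𝖊 ∘ₗ 𝖫 𝖼 ∘ₗ 𝖽U) (g := 𝖊 ∘ₗ 𝖫 𝗆) ?_ t
  intro f x y z
  simp only [LinearMap.comp_apply, head12_tmul, ← dualPairing_smul, U.comul_spec,
    LinearMap.lTensor_tmul, head21_tmul, head20_tmul, ev_tmul, LinearMap.mul'_apply]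

theorem st_ev_one (t : H ⊗[k] Z) : 𝖊 (U.one ⊗ₜ[k] t) = 𝖾 t := by
  induction t with
  | zero => simp
  | add s t hs ht => simp only [map_add, tmul_add, hs, ht]
  | tmul x z => rfl

theorem st_counit (t : U.carrier ⊗[k] Z) : head10 _ U.counit t = 𝖊 (𝖫 𝗎 t) := by
  induction t with
  | zero => simp
  | add s t hs ht => simp only [map_add, tmul_add, hs, ht]
  | tmul x z => rfl

section Symmetric

variable [IsSymmetricHopf k B H]

/-- The pairing of U ⊗ U with H ⊗ H becomes a nested one, inner strands first. This costs one
braiding, which turns the comultiplication of H into the opposite one here and precedes the product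
of H in `st_ev_comul`. -/
theorem st_ev_mul (t : U.carrier ⊗[k] (U.carrier ⊗[k] (H ⊗[k] Z))) :
    𝖊 (𝗆U t) = 𝖊 (𝖫 𝖊 (𝖫 (𝖫 𝖣) t)) := by
  rw [st_ev_ev_mul, st_ev_ev_right, lift21 (lift21 fun t => (st_comulCop (B := B) t).symm)]

theorem st_ev_comul (t : U.carrier ⊗[k] (H ⊗[k] (H ⊗[k] Z))) :
    𝖊 (𝖫 𝖊 (𝖽U t)) = 𝖊 (𝖫 𝗆 (𝖫 𝖼 t)) := by
  rw [← st_ev_ev_comul, head12_lTensor, st_ev_ev_right, lift20 (lift20 (st_braid_braid (B := B)))]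

end Symmetric

/-! ### The structure maps of `U` are morphisms -/

/-- The factor `k` is a dummy tail, present so that the head calculus can describe the composite
with evaluation. -/
theorem _root_.BraidedDuality.IsYDHom.of_ev {X : Type*} [AddCommMonoid X] [Module k X] [YDData k B X]
    {F : X →ₗ[k] U.carrier}
    (hF : IsYDHom k B (head20 k U.ev ∘ₗ F.rTensor (H ⊗[k] k))) : IsYDHom k B F := by
  refine IsYDHom.of_separating U.ev_hom U.separating_ev (isYD_base k B H) ?_
  have h : U.ev ∘ₗ F.rTensor H = (head20 k U.ev ∘ₗ F.rTensor (H ⊗[k] k)) ∘ₗ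
      (TensorProduct.rid k H).symm.toLinearMap.lTensor X := by
    apply TensorProduct.ext'
    intro x y
    simp
  rw [h]
  exact hF.comp (IsYDHom.symm IsYDHom.rid).lTensor

/-- The structure of U says nothing directly about equivariance of its product; it is read off from
the evaluated product, a composite of morphisms. -/
theorem mul_hom : IsYDHom k B U.mul := by
  refine IsYDHom.of_ev ?_
  have h : head20 k U.ev ∘ₗ U.mul.rTensor (H ⊗[k] k) = (𝖊 ∘ₗ 𝖊 ∘ₗ 𝖫 𝖼 ∘ₗ 𝖫 (𝖫 𝖽)) ∘ₗ
      (TensorProduct.assoc k U.carrier U.carrier (H ⊗[k] k)).toLinearMap := by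
    apply LinearMap.ext
    intro t
    simp only [LinearMap.comp_apply, ← st_ev_ev_mul]
    simp [head21]
  rw [h]
  exact .comp (.comp (.head20 U.ev_hom) (.comp (.head20 U.ev_hom)
    (.comp (.lTensor (.cr U.isYD (isYD_base k B H)))
      (.lTensor (.lTensor (.head12 (BraidedDuality.comul_hom k B H))))))) .assoc

theorem one_hom : IsYDHom k B (LinearMap.toSpanSingleton k U.carrier U.one) := by
  refine IsYDHom.of_ev ?_
  have h : head20 k U.ev ∘ₗ (LinearMap.toSpanSingleton k U.carrier U.one).rTensor (H ⊗[k] k) =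
      𝖾 ∘ₗ (TensorProduct.lid k _).toLinearMap := by
    apply LinearMap.ext
    intro t
    induction t with
    | zero => simp
    | add s t hs ht => simp only [map_add, hs, ht]
    | tmul c t =>
      simp only [LinearMap.comp_apply, LinearMap.rTensor_tmul, LinearMap.toSpanSingleton_apply,
        LinearEquiv.coe_coe, TensorProduct.lid_tmul, ← smul_tmul', map_smul, st_ev_one]
  rw [h]
  exact (BraidedDuality.counit_hom k B H).head10.comp IsYDHom.lid

section Symmetric

variable [IsSymmetricHopf k B H]

/-- The same test with the double evaluation U ⊗ U ⊗ H ⊗ H → k, under which the comultiplication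
becomes the product of H. -/
theorem comul_hom : IsYDHom k B U.comul := by
  have he : IsYDHom k B ((𝖊 ∘ₗ 𝖫 𝖊 ∘ₗ
      (TensorProduct.assoc k U.carrier U.carrier (H ⊗[k] (H ⊗[k] k))).toLinearMap)) :=
    U.ev_hom.head20.comp (U.ev_hom.head20.lTensor.comp IsYDHom.assoc)
  refine IsYDHom.of_separating he ?_
    ((isYD_base k B H).tensor ((isYD_base k B H).tensor IsYD.unit)) ?_
  · intro v v' h
    apply (TensorProduct.congr (LinearEquiv.refl k U.carrier) (TensorProduct.rid k U.carrier)).symm.injective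
    refine ext_ev_ev fun x y => ?_
    have h1 : ∀ v : U.carrier ⊗[k] U.carrier,
        (𝖫 (𝖫 (𝖫 (TensorProduct.mk k H k y)))) (𝖫 (𝖫 (TensorProduct.mk k H k x))
         ((TensorProduct.congr (LinearEquiv.refl k U.carrier) (TensorProduct.rid k U.carrier)).symm v))
         = TensorProduct.assoc k U.carrier U.carrier (H ⊗[k] (H ⊗[k] k)) (v ⊗ₜ (x ⊗ₜ (y ⊗ₜ 1))) := by
      intro v
      induction v with
      | zero => simp
      | add s t hs ht => simp only [map_add, add_tmul, hs, ht]
      | tmul f g => simp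
    have h2 := h (x ⊗ₜ (y ⊗ₜ 1))
    simp only [LinearMap.comp_apply, LinearEquiv.coe_coe, ← h1] at h2
    exact h2
  · have h : (𝖊 ∘ₗ 𝖫 𝖊 ∘ₗ
      (TensorProduct.assoc k U.carrier U.carrier (H ⊗[k] (H ⊗[k] k))).toLinearMap) ∘ₗ
        U.comul.rTensor (H ⊗[k] (H ⊗[k] k)) = 𝖊 ∘ₗ 𝖫 𝗆 ∘ₗ 𝖫 𝖼 := by
      apply LinearMap.ext
      intro t
      simp only [LinearMap.comp_apply, ← st_ev_comul]
      rfl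
    rw [h]
    exact U.ev_hom.head20.comp ((BraidedDuality.mul_hom k B H).head21.lTensor.comp
      (IsYDHom.cr (isYD_base k B H) (isYD_base k B H)).lTensor)

end Symmetric

end BraidedHopfSubalgebra

section Lift

variable {k : Type*} [CommSemiring k]
variable {X M N P Q R S T : Type*} [AddCommMonoid X] [Module k X] [AddCommMonoid M] [Module k M]
  [AddCommMonoid N] [Module k N] [AddCommMonoid P] [Module k P] [AddCommMonoid Q] [Module k Q]
  [AddCommMonoid R] [Module k R] [AddCommMonoid S] [Module k S] [AddCommMonoid T] [Module k T]

theorem lift12 {a : N →ₗ[k] P} {b : M →ₗ[k] N} {c : M →ₗ[k] P} (h : ∀ t, c t = a (b t))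
    (t : X ⊗[k] M) : c.lTensor X t = a.lTensor X (b.lTensor X t) :=
  (lift21 (fun t => (h t).symm) t).symm

theorem lift13 {a : N →ₗ[k] P} {b : M →ₗ[k] N} {b' : Q →ₗ[k] M} {c : Q →ₗ[k] P}
    (h : ∀ t, c t = a (b (b' t))) (t : X ⊗[k] Q) :
    c.lTensor X t = a.lTensor X (b.lTensor X (b'.lTensor X t)) :=
  (lift31 (fun t => (h t).symm) t).symm

theorem lift23 {a : N →ₗ[k] P} {b : M →ₗ[k] N} {b' : R →ₗ[k] M} {c : Q →ₗ[k] P} {d : R →ₗ[k] Q}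
    (h : ∀ t, c (d t) = a (b (b' t))) (t : X ⊗[k] R) :
    c.lTensor X (d.lTensor X t) = a.lTensor X (b.lTensor X (b'.lTensor X t)) :=
  (lift32 (fun t => (h t).symm) t).symm

theorem lift24 {a : N →ₗ[k] P} {b : M →ₗ[k] N} {b' : Q →ₗ[k] M} {b'' : R →ₗ[k] Q} {c : S →ₗ[k] P}
    {d : R →ₗ[k] S} (h : ∀ t, c (d t) = a (b (b' (b'' t)))) (t : X ⊗[k] R) :
    c.lTensor X (d.lTensor X t) =
      a.lTensor X (b.lTensor X (b'.lTensor X (b''.lTensor X t))) :=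
  (lift42 (fun t => (h t).symm) t).symm

theorem lift34 {a : N →ₗ[k] P} {b : M →ₗ[k] N} {b' : Q →ₗ[k] M} {b'' : R →ₗ[k] Q} {c : S →ₗ[k] P}
    {d : T →ₗ[k] S} {d' : R →ₗ[k] T} (h : ∀ t, c (d (d' t)) = a (b (b' (b'' t)))) (t : X ⊗[k] R) :
    c.lTensor X (d.lTensor X (d'.lTensor X t)) =
      a.lTensor X (b.lTensor X (b'.lTensor X (b''.lTensor X t))) :=
  (lift43 (fun t => (h t).symm) t).symm

theorem lift25 {a : N →ₗ[k] P} {b : M →ₗ[k] N} {b' : Q →ₗ[k] M} {b'' : R →ₗ[k] Q}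
    {e : T →ₗ[k] R} {c : S →ₗ[k] P} {d : T →ₗ[k] S}
    (h : ∀ t, c (d t) = a (b (b' (b'' (e t))))) (t : X ⊗[k] T) :
    c.lTensor X (d.lTensor X t) =
      a.lTensor X (b.lTensor X (b'.lTensor X (b''.lTensor X (e.lTensor X t)))) := by
  rw [← LinearMap.lTensor_comp_apply X b'' e, lift24 (b'' := b'' ∘ₗ e) h]

end Lift

namespace BraidedHopfSubalgebra

variable {k B H : Type*} [Field k] [Ring B] [HopfAlgebra k B] [Module.Finite k B]
  [Ring H] [Algebra k H] [Coalgebra k H] [YDData k B H] [BraidedHopfAlgebra k B H]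
  {U : BraidedHopfSubalgebra k B H}
variable {Y Z : Type*} [AddCommMonoid Y] [Module k Y] [AddCommMonoid Z] [Module k Z]

local notation "𝖫" => LinearMap.lTensor _
local notation "𝖼" => cr B
local notation "𝗆" => head21 _ (mul' k H)
local notation "𝖽" => head12 _ (Coalgebra.comul : H →ₗ[k] H ⊗[k] H)
local notation "𝖣" => head12 _ (comulCop k B H)
local notation "𝗎" => TensorProduct.mk k H _ (1 : H)
local notation "𝖊" => head20 _ (BraidedHopfSubalgebra.ev U)
local notation "𝗆U" => head21 _ (BraidedHopfSubalgebra.mul U)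
local notation "𝖽U" => head12 _ (BraidedHopfSubalgebra.comul U)
local notation "𝗁" => head21 _ (BraidedHopfSubalgebra.hit U)

/-! ### The left and right regular actions of `U` on `H` -/

/-- The definition braids f past x₁; by `st_ev_braid` one may braid x₁ past x₂ instead, which gives
the opposite comultiplication. -/
theorem st_hit [IsSymmetricHopf k B H] (t : U.carrier ⊗[k] (H ⊗[k] Z)) : 𝗁 t = 𝖊 (𝖫 𝖣 t) := by
  have h : 𝗁 t = 𝖫 𝖊 (𝖼 (𝖫 𝖽 t)) := by
    refine tensor3_ext (f := 𝗁) (g := 𝖫 𝖊 ∘ₗ 𝖼 ∘ₗ 𝖫 𝖽) ?_ t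
    intro f x z
    simp only [head21_tmul, hit, pass, LinearMap.comp_apply, LinearEquiv.coe_coe,
      LinearMap.lTensor_tmul, head12_tmul]
    generalize (Coalgebra.comul x : H ⊗[k] H) = p
    induction p with
    | zero => simp
    | add s t hs ht => simp only [map_add, add_tmul, tmul_add, hs, ht]
    | tmul x y =>
      simp only [TensorProduct.assoc_symm_tmul, LinearMap.rTensor_tmul, TensorProduct.assoc_tmul,
        cr_tmul]
      generalize braid k B U.carrier H (f ⊗ₜ x) = q
      induction q with
      | zero => simp
      | add s t hs ht => simp only [map_add, add_tmul, tmul_add, hs, ht]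
      | tmul x f => simp [smul_tmul']
  rw [h, st_ev_braid, lift21 fun t => (st_comulCop (B := B) t).symm]

variable (U) in
/-- The action `f ⊗ x ↦ ⟨f, x₁⟩ x₂` of `U` on `H`. -/
def regRight : U.carrier ⊗[k] H →ₗ[k] H :=
  (TensorProduct.lid k H).toLinearMap ∘ₗ U.ev.rTensor H ∘ₗ
    (TensorProduct.assoc k U.carrier H H).symm.toLinearMap ∘ₗ
    (Coalgebra.comul : H →ₗ[k] H ⊗[k] H).lTensor U.carrier

local notation "𝗋" => head21 _ (BraidedHopfSubalgebra.regRight U)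

theorem st_regRight (t : U.carrier ⊗[k] (H ⊗[k] Z)) : 𝗋 t = 𝖊 (𝖫 𝖽 t) := by
  refine tensor3_ext (f := 𝗋) (g := 𝖊 ∘ₗ 𝖫 𝖽) ?_ t
  intro f x z
  simp only [head21_tmul, regRight, LinearMap.comp_apply, LinearEquiv.coe_coe,
    LinearMap.lTensor_tmul, head12_tmul]
  generalize (Coalgebra.comul x : H ⊗[k] H) = p
  induction p with
  | zero => simp
  | add s t hs ht => simp only [map_add, add_tmul, tmul_add, hs, ht]
  | tmul x y => simp [smul_tmul']

/-- Both braidings in `rho` are with the unit of H or cancel down to it, since the unit is a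
morphism from the trivial object. -/
theorem rho_apply (f : U.carrier) (x : H) : U.rho (f ⊗ₜ 1) x = U.regRight (f ⊗ₜ x) := by
  simp only [rho, regRight, TensorProduct.curry_apply, LinearMap.comp_apply,
    LinearMap.lTensor_tmul, LinearEquiv.coe_coe]
  generalize (Coalgebra.comul x : H ⊗[k] H) = p
  induction p with
  | zero => simp
  | add s t hs ht => simp only [map_add, add_tmul, tmul_add, hs, ht]
  | tmul x y =>
    have h : ∀ x : H, braid k B H H (1 ⊗ₜ x) = x ⊗ₜ 1 := by
      intro x
      have := braid_natural (BraidedDuality.one_hom k B H)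
        (IsYDHom.id : IsYDHom k B (LinearMap.id : H →ₗ[k] H)) ((1 : k) ⊗ₜ x)
      simpa [braid_tmul, coactMap_unit, (isYD_base k B H).one_act] using this
    simp [mid, h]

theorem regRight_hom : IsYDHom k B U.regRight :=
  .comp .lid (.comp (.rTensor U.ev_hom) (.comp (.symm .assoc)
    (.lTensor (BraidedDuality.comul_hom k B H))))

theorem st_hit_one [IsSymmetricHopf k B H] (t : H ⊗[k] Z) : 𝗁 (U.one ⊗ₜ[k] t) = t := by
  rw [st_hit, LinearMap.lTensor_tmul, st_ev_one, st_counit_cop]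

theorem st_regRight_one (t : H ⊗[k] Z) : 𝗋 (U.one ⊗ₜ[k] t) = t := by
  rw [st_regRight, LinearMap.lTensor_tmul, st_ev_one, st_counit_comul]

theorem st_hit_unit [IsSymmetricHopf k B H] (t : U.carrier ⊗[k] Z) :
    𝗁 (𝖫 𝗎 t) = 𝗎 (𝖊 (𝖫 𝗎 t)) := by
  rw [st_hit, lift22 (fun t => st_cop_one B t), lT_mk,
    head20_lTensor]

section Symmetric

variable [IsSymmetricHopf k B H]

theorem hit_hom : IsYDHom k B U.hit := by
  refine .comp .rid (.comp ?_ (.lTensor (BraidedDuality.comul_hom k B H)))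
  exact .comp (.lTensor U.ev_hom) (.comp .assoc
    (.comp (.rTensor (.braid U.isYD (isYD_base k B H))) (.symm .assoc)))

theorem st_hit_mul (t : U.carrier ⊗[k] (U.carrier ⊗[k] (H ⊗[k] Z))) : 𝗁 (𝗆U t) = 𝗁 (𝖫 𝗁 t) := by
  have h : ∀ t : U.carrier ⊗[k] (U.carrier ⊗[k] (H ⊗[k] Z)),
      𝖫 𝗁 t = 𝖫 𝖊 (𝖫 (𝖫 𝖣) t) := lift12 st_hit
  rw [st_hit, st_hit, h, ← head21_lTensor, st_ev_mul, ← lT_head20, lift22 (lift22 st_cop_coassoc)]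

/-- The right regular action reverses products: evaluating a product in U introduces the opposite
comultiplication, whereas the action uses the original one. -/
theorem st_regRight_mul (t : U.carrier ⊗[k] (U.carrier ⊗[k] (H ⊗[k] Z))) :
    𝗋 (𝗆U t) = 𝗋 (𝖫 𝗋 (𝖼 t)) := by
  have h : ∀ t : U.carrier ⊗[k] (U.carrier ⊗[k] (H ⊗[k] Z)),
      𝖫 𝗋 t = 𝖫 𝖊 (𝖫 (𝖫 𝖽) t) := lift12 st_regRight
  rw [st_regRight, st_regRight, h, ← head21_lTensor, st_ev_mul, ← lT_head20, ← cr_lTensor,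
    ← cr_lTensor, st_ev_ev_braid,
    lift23 (lift23 fun t => (st_comulCop (B := B) (𝖽 t)).trans (congrArg 𝖼 (st_coassoc t)))]

/-- One action uses the right leg of Δ and the other the left leg, so they commute up to the
braiding by coassociativity. -/
theorem st_hit_regRight (t : U.carrier ⊗[k] (U.carrier ⊗[k] (H ⊗[k] Z))) :
    𝗁 (𝖫 𝗋 t) = 𝗋 (𝖫 𝗁 (𝖼 t)) := by
  have h : ∀ t : U.carrier ⊗[k] (U.carrier ⊗[k] (H ⊗[k] Z)),
      𝖫 𝗋 t = 𝖫 𝖊 (𝖫 (𝖫 𝖽) t) := lift12 st_regRight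
  have h' : ∀ t : U.carrier ⊗[k] (U.carrier ⊗[k] (H ⊗[k] Z)),
      𝖫 𝗁 t = 𝖫 𝖊 (𝖫 (𝖫 𝖣) t) := lift12 st_hit
  rw [st_regRight, st_hit, h, h', ← lT_head20, ← lT_head20, ← cr_lTensor, ← cr_lTensor,
    st_ev_ev_braid, lift23 (lift23 st_cop_mixed)]

/-- Evaluating f on a product is evaluating its coproduct on the factors; here this is applied to
one leg of the comultiplication of a product in H. -/
theorem st_hit_mul_right (t : U.carrier ⊗[k] (H ⊗[k] (H ⊗[k] Z))) :
    𝗁 (𝖫 𝗆 t) = 𝗆 (𝖫 𝗁 (𝗁 (𝖫 𝖼 (𝖽U t)))) := by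
  have h1 : 𝗁 (𝖫 𝗆 t) = 𝗆 (𝖊 (𝖊 (𝖫 𝖼 (𝖽U (𝖫 (𝖫 𝖼) (𝖫 𝖣 (𝖫 (𝖫 𝖣) t))))))) := by
    rw [st_hit, lift25 st_cop_mul, head20_lTensor, st_ev_ev_comul]
  have h2 : 𝗆 (𝖫 𝗁 (𝗁 (𝖫 𝖼 (𝖽U t)))) =
      𝗆 (𝖊 (𝖊 (𝖫 (𝖫 (𝖫 𝖼)) (𝖫 (𝖫 𝖼) (𝖫 (𝖫 (𝖫 (𝖫 𝖣))) (𝖫 𝖣 (𝖫 𝖼 (𝖽U t)))))))) := by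
    rw [st_hit (𝖫 𝖼 (𝖽U t)), lift12 st_hit, ← st_ev_braid']
    simp only [head20_lTensor]
  have h3 : ∀ s : U.carrier ⊗[k] (H ⊗[k] (H ⊗[k] Z)), 𝖫 𝖼 (𝖣 (𝖼 s)) = 𝖼 (𝖫 𝖣 s) := by
    intro s
    rw [← cr_right12 (comulCop_hom k B H) U.isYD, lift20 st_braid_HU_UH]
  rw [h1, h2]
  simp only [head12_lTensor, lT_cr, lT2_cr, lT2_head12]
  rw [lift32 h3]

/-- As for ⇀, with the other leg of the comultiplication. The first H-strand starts to the left of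
the functional because that is where it meets the functional in H # U. -/
theorem st_regRight_mul_right (t : H ⊗[k] (U.carrier ⊗[k] (H ⊗[k] Z))) :
    𝗋 (𝖫 𝗆 (𝖼 t)) = 𝗆 (𝖫 𝗋 (𝗋 (𝖼 (𝖫 𝖽U t)))) := by
  have h1 : 𝗋 (𝖫 𝗆 (𝖼 t)) = 𝗆 (𝖊 (𝖊 (𝖫 𝖼 (𝖽U (𝖫 (𝖫 𝖼) (𝖫 𝖽 (𝖫 (𝖫 𝖽) (𝖼 t)))))))) := by
    rw [st_regRight, lift25 (st_comul_mul (B := B)), head20_lTensor, st_ev_ev_comul]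
  have h2 : 𝗆 (𝖫 𝗋 (𝗋 (𝖼 (𝖫 𝖽U t)))) =
      𝗆 (𝖊 (𝖊 (𝖫 (𝖫 (𝖫 𝖼)) (𝖫 (𝖫 𝖼) (𝖫 (𝖫 (𝖫 (𝖫 𝖽))) (𝖫 𝖽 (𝖼 (𝖫 𝖽U t)))))))) := by
    rw [st_regRight (𝖼 (𝖫 𝖽U t)), lift12 st_regRight, ← st_ev_braid']
    simp only [head20_lTensor]
  have h3 : ∀ s : H ⊗[k] (U.carrier ⊗[k] (H ⊗[k] Z)), 𝖼 (𝖫 𝖽 (𝖼 s)) = 𝖫 𝖼 (𝖽 s) := by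
    intro s
    rw [← lift20 st_braid_HU_UH (𝖼 (𝖫 𝖽 (𝖼 s))),
      cr_right12 (BraidedDuality.comul_hom k B H) U.isYD, st_braid_UH_HU]
  rw [h1, h2]
  simp only [head12_lTensor, lT_cr, lT2_cr, lT2_head12]
  rw [← cr_right12 U.comul_hom (isYD_base k B H), lift32 h3]

end Symmetric
end BraidedHopfSubalgebra

namespace BraidedHopfSubalgebra

variable {k B H : Type*} [Field k] [Ring B] [HopfAlgebra k B] [Module.Finite k B]
  [Ring H] [Algebra k H] [Coalgebra k H] [YDData k B H] [BraidedHopfAlgebra k B H]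
  {U : BraidedHopfSubalgebra k B H}
variable {Y Z : Type*} [AddCommMonoid Y] [Module k Y] [AddCommMonoid Z] [Module k Z]

local notation "𝖫" => LinearMap.lTensor _
local notation "𝖼" => cr B
local notation "𝗆" => head21 _ (mul' k H)
local notation "𝖽" => head12 _ (Coalgebra.comul : H →ₗ[k] H ⊗[k] H)
local notation "𝖣" => head12 _ (comulCop k B H)
local notation "𝖾" => head10 _ (Coalgebra.counit : H →ₗ[k] k)
local notation "𝗌" => LinearMap.rTensor _ (braidedAntipode k B H)
local notation "𝗍" => LinearMap.rTensor _ (antipodeSymm k B H)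
local notation "𝗎" => TensorProduct.mk k H _ (1 : H)
local notation "𝖊" => head20 _ (BraidedHopfSubalgebra.ev U)
local notation "𝗆U" => head21 _ (BraidedHopfSubalgebra.mul U)
local notation "𝖽U" => head12 _ (BraidedHopfSubalgebra.comul U)
local notation "𝗁" => head21 _ (BraidedHopfSubalgebra.hit U)
local notation "𝗋" => head21 _ (BraidedHopfSubalgebra.regRight U)

/-! ### The faithful action of `H # U` on `H` -/

theorem lam_tmul (t : H ⊗[k] U.carrier) (x : H) (z : Z) :
    U.lam t x ⊗ₜ[k] z = 𝗆 (𝖫 𝗁 (TensorProduct.assoc k _ _ _ (t ⊗ₜ (x ⊗ₜ z)))) := by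
  induction t with
  | zero => simp
  | add s t hs ht => simp only [map_add, LinearMap.add_apply, add_tmul, hs, ht]
  | tmul h f =>
    simp only [lam, TensorProduct.curry_apply, LinearMap.comp_apply, LinearMap.lTensor_tmul,
      TensorProduct.assoc_tmul, head21_tmul, hit, pass]
    generalize (Coalgebra.comul x : H ⊗[k] H) = p
    induction p with
    | zero => simp
    | add s t hs ht => simp only [map_add, add_tmul, tmul_add, hs, ht]
    | tmul x y =>
      simp only [mid, LinearMap.comp_apply, LinearEquiv.coe_coe, TensorProduct.assoc_tmul,
        LinearMap.lTensor_tmul, TensorProduct.assoc_symm_tmul, LinearMap.rTensor_tmul]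
      generalize braid k B U.carrier H (f ⊗ₜ x) = q
      induction q with
      | zero => simp
      | add s t hs ht => simp only [map_add, add_tmul, tmul_add, hs, ht]
      | tmul x f => simp [smul_tmul']

section Symmetric

variable [IsSymmetricHopf k B H]

/-- Without braidings: h⟨f, x⟩ = ∑ λ(h # f)(x₂) S⁻¹(x₁), because f ⇀ x₂ = ∑ x₂⟨f, x₃⟩ and x₂ S⁻¹(x₁)
contracts. So an element of H # U can be reconstructed from its operator on H. -/
theorem st_ev_eq_lam (t : H ⊗[k] (U.carrier ⊗[k] (H ⊗[k] Z))) :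
    𝖫 𝖊 t = 𝗆 (𝗆 (𝖫 𝗁 (𝖫 (𝖫 (𝖫 𝗍)) (𝖫 (𝖫 𝖣) t)))) := by
  have h1 : ∀ v : H ⊗[k] Z, 𝖫 𝗆 (𝖣 (𝖫 𝗍 (𝖣 v))) = 𝖫 𝗎 v := by
    intro v
    rw [head12_lTensor, st_cop_coassoc, lift32 st_antipodeSymm_right, st_cop_counit]
  have h2 : ∀ u : U.carrier ⊗[k] (H ⊗[k] Z), 𝗆 (𝗁 (𝖫 (𝖫 𝗍) (𝖫 𝖣 u))) = 𝗎 (𝖊 u) := by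
    intro u
    rw [st_hit, ← head20_lTensor, lift41 h1, head20_lTensor]
  rw [st_mul_assoc, lift42 h2, st_mul_one]

/-- Faithfulness of λ, with a tail: `st_ev_eq_lam` expresses every evaluation through values of the
operator. -/
theorem ext_lam {t t' : H ⊗[k] (U.carrier ⊗[k] Z)}
    (h : ∀ x : H, 𝗆 (𝖫 𝗁 (𝖫 (𝖫 (TensorProduct.mk k H Z x)) t)) =
      𝗆 (𝖫 𝗁 (𝖫 (𝖫 (TensorProduct.mk k H Z x)) t'))) : t = t' := by
  refine lT_ext_ev fun x => ?_
  rw [st_ev_eq_lam, st_ev_eq_lam]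
  -- The hypothesis concerns single vectors; it is extended linearly to tensors p so that p may be
  -- the opposite coproduct of x.
  have h1 : ∀ (p : H ⊗[k] H), 𝗆 (𝖫 𝗁 (𝖫 (𝖫 (𝖫 𝗍)) (𝖫 (𝖫 ((TensorProduct.assoc k H H Z).toLinearMap ∘ₗ
      TensorProduct.mk k _ Z p)) t))) = 𝗆 (𝖫 𝗁 (𝖫 (𝖫 (𝖫 𝗍)) (𝖫 (𝖫
      ((TensorProduct.assoc k H H Z).toLinearMap ∘ₗ TensorProduct.mk k _ Z p)) t'))) := by
    intro p
    induction p with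
    | zero =>
      have : TensorProduct.mk k (H ⊗[k] H) Z 0 = 0 := map_zero _
      simp [this]
    | add p q hp hq =>
      have : TensorProduct.mk k (H ⊗[k] H) Z (p + q) =
        TensorProduct.mk k (H ⊗[k] H) Z p + TensorProduct.mk k (H ⊗[k] H) Z q := map_add _ _ _
      simp only [this, LinearMap.comp_add, LinearMap.lTensor_add, LinearMap.add_apply, map_add,
        hp, hq]
    | tmul a b =>
      have h2 : ∀ t : H ⊗[k] (U.carrier ⊗[k] Z), 𝗆 (𝖫 𝗁 (𝖫 (𝖫 (𝖫 𝗍)) (𝖫 (𝖫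
          ((TensorProduct.assoc k H H Z).toLinearMap ∘ₗ TensorProduct.mk k _ Z (a ⊗ₜ b))) t))) =
          𝖫 (TensorProduct.mk k H Z (antipodeSymm k B H b))
            (𝗆 (𝖫 𝗁 (𝖫 (𝖫 (TensorProduct.mk k H Z a)) t))) := by
        intro t
        rw [← head21_lTensor, ← lT_head21]
        congr 2
        exact lift22 (lift22 fun z => by simp) t
      rw [h2, h2, h]
  congr 1
  have h3 := h1 (comulCop k B H x)
  have h4 : ∀ t : H ⊗[k] (U.carrier ⊗[k] Z), 𝖫 (𝖫 𝖣) (𝖫 (𝖫 (TensorProduct.mk k H Z x)) t) =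
      𝖫 (𝖫 ((TensorProduct.assoc k H H Z).toLinearMap ∘ₗ
        TensorProduct.mk k _ Z (comulCop k B H x))) t := lift21 (lift21 fun z => rfl)
  rw [h4, h4, h3]

variable (U) in
/-- The multiplication of `H # U` acting on the head of `H ⊗ (U ⊗ (H ⊗ (U ⊗ Z)))`. -/
def headMulHU (Z : Type*) [AddCommMonoid Z] [Module k Z] :
    H ⊗[k] (U.carrier ⊗[k] (H ⊗[k] (U.carrier ⊗[k] Z))) →ₗ[k] H ⊗[k] (U.carrier ⊗[k] Z) :=
  𝖫 𝗆U ∘ₗ 𝗆 ∘ₗ 𝖫 𝗁 ∘ₗ 𝖫 (𝖫 𝖼) ∘ₗ 𝖫 𝖽U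

local notation "𝗘" => BraidedHopfSubalgebra.headMulHU U _

theorem headMulHU_apply (t : H ⊗[k] (U.carrier ⊗[k] (H ⊗[k] (U.carrier ⊗[k] Z)))) :
    𝗘 t = 𝖫 𝗆U (𝗆 (𝖫 𝗁 (𝖫 (𝖫 𝖼) (𝖫 𝖽U t)))) := rfl

theorem headMulHU_lTensor {Z' : Type*} [AddCommMonoid Z'] [Module k Z'] (g : Z →ₗ[k] Z')
    (t : H ⊗[k] (U.carrier ⊗[k] (H ⊗[k] (U.carrier ⊗[k] Z)))) :
    𝗘 (𝖫 (𝖫 (𝖫 (𝖫 g))) t) = 𝖫 (𝖫 g) (𝗘 t) := by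
  simp only [headMulHU, LinearMap.comp_apply, lT_head12, lT2_cr, lT_head21, head21_lTensor]

theorem st_mulHU (a b : H ⊗[k] U.carrier) (z : Z) :
    TensorProduct.assoc k _ _ _ (U.mulHU (a ⊗ₜ b) ⊗ₜ z) =
      𝗘 (TensorProduct.assoc k _ _ _ (a ⊗ₜ TensorProduct.assoc k _ _ _ (b ⊗ₜ z))) := by
  induction a with
  | zero => simp
  | add s t hs ht => simp only [map_add, add_tmul, hs, ht]
  | tmul h f =>
    induction b with
    | zero => simp
    | add s t hs ht => simp only [map_add, tmul_add, add_tmul, hs, ht]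
    | tmul x g =>
      simp only [mulHU, smashMul, mid, LinearMap.comp_apply, LinearEquiv.coe_coe,
        TensorProduct.assoc_tmul, LinearMap.lTensor_tmul, TensorProduct.assoc_symm_tmul,
        LinearMap.rTensor_tmul, headMulHU, head12_tmul]
      generalize U.comul f = p
      induction p with
      | zero => simp
      | add s t hs ht => simp only [map_add, add_tmul, tmul_add, hs, ht]
      | tmul f f' =>
        simp only [TensorProduct.assoc_tmul, LinearMap.lTensor_tmul, cr_tmul]
        generalize braid k B U.carrier H (f' ⊗ₜ x) = q
        induction q with
        | zero => simp
        | add s t hs ht => simp only [map_add, add_tmul, tmul_add, hs, ht]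
        | tmul x f => simp

/-- λ is multiplicative because H is a module algebra under ⇀. -/
theorem st_lam_mulHU (t : H ⊗[k] (U.carrier ⊗[k] (H ⊗[k] (U.carrier ⊗[k] (H ⊗[k] Z))))) :
    𝗆 (𝖫 𝗁 (𝗘 t)) = 𝗆 (𝖫 𝗁 (𝖫 (𝖫 𝗆) (𝖫 (𝖫 (𝖫 𝗁)) t))) := by
  rw [lift25 st_hit_mul_right, ← st_mul_assoc]
  rw [headMulHU_apply, lift22 st_hit_mul]
  simp only [lT_head12, lT2_cr, lT_head21, head21_lTensor]

/-- H # U acts faithfully and multiplicatively by operators, and composition of operators is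
associative. -/
theorem st_mulHU_assoc (t : H ⊗[k] (U.carrier ⊗[k] (H ⊗[k] (U.carrier ⊗[k]
    (H ⊗[k] (U.carrier ⊗[k] Z)))))) : 𝗘 (𝗘 t) = 𝗘 (𝖫 (𝖫 𝗘) t) := by
  refine ext_lam fun x => ?_
  simp only [← headMulHU_lTensor, st_lam_mulHU]
  rw [lift22 (lift22 fun t => (headMulHU_lTensor (TensorProduct.mk k H Z x) t).symm),
    lift34 (lift34 st_lam_mulHU)]

theorem st_one_mulHU (t : H ⊗[k] (U.carrier ⊗[k] Z)) : 𝗘 (1 ⊗ₜ (U.one ⊗ₜ t)) = t := by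
  refine ext_lam fun x => ?_
  rw [← headMulHU_lTensor, st_lam_mulHU]
  simp only [LinearMap.lTensor_tmul, st_hit_one]
  exact st_one_mul _

theorem st_mulHU_one (t : H ⊗[k] (U.carrier ⊗[k] Z)) :
    𝗘 (𝖫 (𝖫 (𝗎 ∘ₗ TensorProduct.mk k _ _ U.one)) t) = t := by
  refine ext_lam fun x => ?_
  have h : ∀ v : Z, 𝗆 (𝖫 𝗁 (𝖫 (𝖫 (TensorProduct.mk k H Z x))
      ((𝗎 ∘ₗ TensorProduct.mk k _ Z U.one) v))) = TensorProduct.mk k H Z x v := by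
    intro v
    simp only [LinearMap.comp_apply, TensorProduct.mk_apply, LinearMap.lTensor_tmul, st_hit_one]
    exact st_one_mul _
  rw [← headMulHU_lTensor, st_lam_mulHU, lift41 (lift41 h)]

end Symmetric

section Symmetric

variable [IsSymmetricHopf k B H]

/-! ### Left translations of functionals -/

variable (U) in
/-- The left translation `f ⊗ a ↦ f (a -)`. -/
def leftTrans : U.carrier ⊗[k] H →ₗ[k] U.carrier :=
  (TensorProduct.rid k U.carrier).toLinearMap ∘ₗ 𝖊 ∘ₗ 𝖫 𝖼 ∘ₗ 𝖽U ∘ₗ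
    (TensorProduct.rid k H).symm.toLinearMap.lTensor U.carrier

theorem leftTrans_hom : IsYDHom k B U.leftTrans :=
  .comp .rid (.comp (.head20 U.ev_hom) (.comp (.lTensor (.cr U.isYD (isYD_base k B H)))
    (.comp (.head12 U.comul_hom) (.lTensor (.symm .rid)))))

local notation "𝖪" => head21 _ (BraidedHopfSubalgebra.leftTrans U)

theorem st_leftTrans (t : U.carrier ⊗[k] (H ⊗[k] Z)) : 𝖪 t = 𝖊 (𝖫 𝖼 (𝖽U t)) := by
  refine tensor3_ext (f := 𝖪) (g := 𝖊 ∘ₗ 𝖫 𝖼 ∘ₗ 𝖽U) ?_ t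
  intro f a z
  have h1 : ∀ s : U.carrier ⊗[k] k, TensorProduct.rid k U.carrier s ⊗ₜ[k] z =
      𝖫 (LinearMap.toSpanSingleton k Z z) s := by
    intro s
    induction s with
    | zero => simp
    | add s t hs ht => simp only [map_add, add_tmul, hs, ht]
    | tmul f c => simp [smul_tmul']
  simp only [head21_tmul, leftTrans, LinearMap.comp_apply, LinearEquiv.coe_coe, h1]
  simp only [← head20_lTensor, ← lT_cr, ← head12_lTensor]
  simp

theorem st_ev_leftTrans (t : U.carrier ⊗[k] (H ⊗[k] (H ⊗[k] Z))) : 𝖊 (𝖪 t) = 𝖊 (𝖫 𝗆 t) := by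
  rw [st_leftTrans, st_ev_ev_comul]

theorem st_leftTrans_leftTrans (t : U.carrier ⊗[k] (H ⊗[k] (H ⊗[k] Z))) :
    𝖪 (𝖪 t) = 𝖪 (𝖫 𝗆 t) := by
  refine ext_ev fun x => ?_
  simp only [← head21_lTensor, st_ev_leftTrans]
  rw [lift22 (fun t => (head21_lTensor _ (TensorProduct.mk k H Z x) t).symm),
    lift22 (st_mul_assoc)]

theorem st_leftTrans_one (t : U.carrier ⊗[k] Z) : 𝖪 (𝖫 𝗎 t) = t := by
  refine ext_ev fun x => ?_
  rw [← head21_lTensor, st_ev_leftTrans, lift31 (c := TensorProduct.mk k H Z x)]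
  intro v
  exact st_one_mul _

/-- The strand that is evaluated may be carried past the other leg of Δf, since the braiding of U
with itself is an involution. -/
theorem st_leftTrans_eq (t : U.carrier ⊗[k] (H ⊗[k] Z)) : 𝖪 t = 𝖫 𝖊 (𝖼 (𝖽U t)) := by
  rw [st_leftTrans, ← st_braid_UU (𝖽U t), cr_right20 U.ev_hom U.isYD, st_braid_UU]

theorem st_braid_hit (t : U.carrier ⊗[k] (H ⊗[k] Z)) : 𝖼 (𝗁 (𝖫 𝖼 (𝖽U t))) = 𝖪 (𝖫 𝖣 t) := by
  have h3 : ∀ s : U.carrier ⊗[k] (H ⊗[k] Z), 𝖫 𝖼 (𝖣 (𝖼 s)) = 𝖼 (𝖫 𝖣 s) := by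
    intro s
    rw [← cr_right12 (comulCop_hom k B H) U.isYD, lift20 st_braid_HU_UH]
  rw [st_hit, ← head20_lTensor, lift32 h3, st_leftTrans, head12_lTensor]

theorem st_regRight_comul (t : U.carrier ⊗[k] (H ⊗[k] Z)) :
    𝗋 (𝖫 𝖼 (𝖽U t)) = 𝖼 (𝖪 (𝖫 𝖽 t)) := by
  have h3 : ∀ s : U.carrier ⊗[k] (H ⊗[k] Z), 𝖽 (𝖼 s) = 𝖫 𝖼 (𝖼 (𝖫 𝖽 s)) := by
    intro s
    rw [← cr_right12 (BraidedDuality.comul_hom k B H) U.isYD]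
  rw [st_regRight, st_leftTrans, ← head20_lTensor, lift23 h3, head12_lTensor]

/-! ### The map expressing right translations by left ones -/

theorem lam_injective : Function.Injective U.lam := by
  intro t t' h
  apply (TensorProduct.congr (LinearEquiv.refl k H) (TensorProduct.rid k U.carrier)).symm.injective
  refine ext_lam fun x => ?_
  have h1 : ∀ t : H ⊗[k] U.carrier, 𝗆 (𝖫 𝗁 (𝖫 (𝖫 (TensorProduct.mk k H k x))
      ((TensorProduct.congr (LinearEquiv.refl k H) (TensorProduct.rid k U.carrier)).symm t))) =
      U.lam t x ⊗ₜ[k] (1 : k) := by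
    intro t
    rw [lam_tmul]
    congr 2
    induction t with
    | zero => simp
    | add s t hs ht => simp only [map_add, add_tmul, hs, ht]
    | tmul h f => simp
  rw [h1, h1, h]

variable [hRL : Fact U.RLCondition]

variable (U) in
/-- The map `U → H # U` with `λ (rightToLeft f) = ρ (f # 1)`. -/
def rightToLeft : U.carrier →ₗ[k] H ⊗[k] U.carrier :=
  (LinearEquiv.ofInjective U.lam lam_injective).symm.toLinearMap ∘ₗ
    LinearMap.codRestrict (LinearMap.range U.lam)
      (U.rho ∘ₗ (TensorProduct.mk k U.carrier H).flip 1) hRL.out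

theorem lam_rightToLeft (f : U.carrier) : U.lam (U.rightToLeft f) = U.rho (f ⊗ₜ 1) := by
  have := LinearEquiv.apply_symm_apply (LinearEquiv.ofInjective U.lam lam_injective)
    (LinearMap.codRestrict (LinearMap.range U.lam)
      (U.rho ∘ₗ (TensorProduct.mk k U.carrier H).flip 1) hRL.out f)
  exact congrArg Subtype.val this

local notation "𝗐" => head12 _ (BraidedHopfSubalgebra.rightToLeft U)

theorem st_lam_rightToLeft (t : U.carrier ⊗[k] (H ⊗[k] Z)) : 𝗆 (𝖫 𝗁 (𝗐 t)) = 𝗋 t := by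
  refine tensor3_ext (f := 𝗆 ∘ₗ 𝖫 𝗁 ∘ₗ 𝗐) (g := 𝗋) ?_ t
  intro f x z
  simp only [LinearMap.comp_apply, head12_tmul, ← lam_tmul, lam_rightToLeft, rho_apply,
    head21_tmul]

/-- An explicit form of w: pairing its U-leg with x gives ∑ ⟨f, x₂⟩ x₃ S⁻¹(x₁), up to braiding. The
defining property of w involves an inverse of λ; this one does not. -/
theorem st_ev_rightToLeft (t : U.carrier ⊗[k] (H ⊗[k] Z)) :
    𝖫 𝖊 (𝗐 t) = 𝗆 (𝗋 (𝖫 (𝖫 𝗍) (𝖫 𝖣 t))) := by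
  rw [st_ev_eq_lam, ← head12_lTensor, ← head12_lTensor, st_lam_rightToLeft]

theorem _root_.BraidedDuality.IsYDHom.of_lTensor_ev {X : Type*} [AddCommMonoid X] [Module k X]
    [YDData k B X] {F : X →ₗ[k] H ⊗[k] U.carrier}
    (hF : IsYDHom k B ((head20 k U.ev).lTensor H ∘ₗ head12 (H ⊗[k] k) F)) : IsYDHom k B F := by
  have he : IsYDHom k B ((head20 k U.ev).lTensor H ∘ₗ
      (TensorProduct.assoc k H U.carrier (H ⊗[k] k)).toLinearMap) :=
    .comp (.lTensor (.head20 U.ev_hom)) .assoc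
  refine IsYDHom.of_separating he ?_ ((isYD_base k B H).tensor IsYD.unit) hF
  intro v v' h
  apply (TensorProduct.congr (LinearEquiv.refl k H) (TensorProduct.rid k U.carrier)).symm.injective
  refine lT_ext_ev fun x => ?_
  have h1 : ∀ v : H ⊗[k] U.carrier, 𝖫 (𝖫 (TensorProduct.mk k H k x))
      ((TensorProduct.congr (LinearEquiv.refl k H) (TensorProduct.rid k U.carrier)).symm v) =
      TensorProduct.assoc k H U.carrier (H ⊗[k] k) (v ⊗ₜ (x ⊗ₜ 1)) := by
    intro v
    induction v with
    | zero => simp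
    | add s t hs ht => simp only [map_add, add_tmul, hs, ht]
    | tmul f g => simp
  have h2 := h (x ⊗ₜ 1)
  simp only [LinearMap.comp_apply, LinearEquiv.coe_coe, ← h1] at h2
  exact h2

/-- The inverse of λ on its range hides equivariance; the explicit evaluation formula is a composite
of morphisms and shows it. -/
theorem rightToLeft_hom : IsYDHom k B U.rightToLeft := by
  refine IsYDHom.of_lTensor_ev ?_
  have h : (head20 k U.ev).lTensor H ∘ₗ head12 (H ⊗[k] k) U.rightToLeft =
      𝗆 ∘ₗ 𝗋 ∘ₗ 𝖫 (𝖫 𝗍) ∘ₗ 𝖫 𝖣 := LinearMap.ext st_ev_rightToLeft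
  rw [h]
  exact .comp (.head21 (BraidedDuality.mul_hom k B H)) (.comp (.head21 regRight_hom)
    (.comp (.lTensor (.lTensor (.rTensor (antipodeSymm_hom k B H))))
      (.lTensor (.head12 (comulCop_hom k B H)))))

omit hRL in
theorem st_comul_cop (t : H ⊗[k] Z) : 𝖫 𝖼 (𝖽 (𝖣 t)) = 𝖣 (𝖽 t) := by
  rw [st_comulCop, st_comulCop, ← cr_right12 (BraidedDuality.comul_hom k B H) (isYD_base k B H),
    lift20 (st_braid_braid (B := B)), st_coassoc]

/-- By `st_ev_rightToLeft`, w is the transpose of the adjoint-type coaction x ↦ ∑ x₂ ⊗ x₃ S⁻¹(x₁) of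
H on itself. Its coassociativity is `h3`, from comultiplicativity of the product and
anticomultiplicativity of S⁻¹. -/
theorem st_rightToLeft_coassoc (t : U.carrier ⊗[k] Z) : 𝖽 (𝗐 t) = 𝖫 𝗐 (𝗐 t) := by
  have h1 : ∀ t : U.carrier ⊗[k] (H ⊗[k] (H ⊗[k] Z)), 𝖫 𝗋 (𝗐 t) = 𝗆 (𝗋 (𝖫 (𝖫 𝗍) (𝖫 𝖣 (𝖫 𝖽 t)))) := by
    intro t
    rw [lift12 st_regRight, ← head12_lTensor, st_ev_rightToLeft]
  have h2 : ∀ u : H ⊗[k] Z, 𝖫 𝖼 (𝖽 (𝖫 𝖽 (𝖫 𝗍 (𝖣 u)))) = 𝖫 𝗍 (𝖣 (𝖽 (𝖫 𝗍 (𝖣 u)))) := by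
    intro u
    rw [lift23 (st_comul_antipodeSymm (B := B)), ← st_cop_coassoc]
    simp only [head12_lTensor]
    rw [← st_comul_cop, lift22 (fun t => cr_right (antipodeSymm_hom k B H) t), lT_cr]
  have h3 : ∀ u : H ⊗[k] Z, 𝖫 𝖽 (𝖫 𝗆 (𝖽 (𝖫 𝗍 (𝖣 u)))) =
      𝖫 (𝖫 𝗆) (𝖫 𝗆 (𝖽 (𝖫 𝗍 (𝖣 (𝖽 (𝖫 𝗍 (𝖣 u))))))) := by
    intro u
    rw [← h2, lift25 (st_comul_mul (B := B))]
    simp only [← head12_lTensor]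
    rw [← st_coassoc, ← head12_lTensor]
  have h4 : ∀ t : U.carrier ⊗[k] (H ⊗[k] Z), 𝖽 (𝖫 𝖊 (𝗐 t)) = 𝖫 (𝖫 𝖊) (𝖫 𝗐 (𝗐 t)) := by
    intro t
    rw [lift24 st_ev_rightToLeft, ← head12_lTensor, ← head12_lTensor, h1, st_ev_rightToLeft]
    have h5 : 𝖫 𝖽 ∘ₗ 𝖫 𝗆 ∘ₗ 𝖽 ∘ₗ 𝖫 𝗍 ∘ₗ head12 Z (comulCop k B H) =
        𝖫 (𝖫 𝗆) ∘ₗ 𝖫 𝗆 ∘ₗ 𝖽 ∘ₗ 𝖫 𝗍 ∘ₗ 𝖣 ∘ₗ 𝖽 ∘ₗ 𝖫 𝗍 ∘ₗ 𝖣 := LinearMap.ext h3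
    have h6 := LinearMap.congr_fun (congrArg (LinearMap.lTensor U.carrier) h5) t
    simp only [LinearMap.lTensor_comp, LinearMap.comp_apply] at h6
    simp only [st_regRight, ← head20_lTensor]
    rw [h6]
  refine lTensor_jointly_injective (Y := H) (F := fun x : H => 𝖫 𝖊 ∘ₗ 𝖫 (𝖫 (TensorProduct.mk k H Z x)))
    (fun v v' => lT_ext_ev) fun x => ?_
  simp only [LinearMap.lTensor_comp_apply, ← head12_lTensor, ← h4]
  rw [← lT_head12, ← head12_lTensor, h4]

/-- Apply ε to λ(w f)(x) = ρ(f)(x): both ε(f ⇀ x) and ε(ρ(f)(x)) are ⟨f, x⟩. -/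
theorem st_counit_rightToLeft (t : U.carrier ⊗[k] Z) : 𝖾 (𝗐 t) = t := by
  refine ext_ev fun x => ?_
  have h1 : ∀ t : U.carrier ⊗[k] (H ⊗[k] Z), 𝖾 (𝗁 t) = 𝖊 t := by
    intro t
    rw [st_hit, ← head20_lTensor, lift20 st_cop_counit]
  have h2 : ∀ t : U.carrier ⊗[k] (H ⊗[k] Z), 𝖾 (𝗋 t) = 𝖊 t := by
    intro t
    rw [st_regRight, ← head20_lTensor, lift20 st_comul_counit]
  have h3 : ∀ t : U.carrier ⊗[k] (H ⊗[k] Z), 𝖊 (𝖾 (𝗐 t)) = 𝖊 t := by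
    intro t
    rw [← h1, ← head10_lTensor, ← st_counit_mul B, st_lam_rightToLeft, h2]
  rw [← head10_lTensor, ← head12_lTensor, h3]

end Symmetric

/-! ### Stability of `U` under the inverse antipode. -/

section Symmetric

local notation "𝖪" => head21 _ (BraidedHopfSubalgebra.leftTrans U)
local notation "𝗐" => head12 _ (BraidedHopfSubalgebra.rightToLeft U)

variable [IsSymmetricHopf k B H]

/-- Without braidings this reads ρ(f)(a x) = ∑ a₂ ρ(f · a₁)(x), where (f · a)(y) = f(a y). -/
theorem st_regRight_mul_braid (t : U.carrier ⊗[k] (H ⊗[k] (H ⊗[k] Z))) :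
    𝗋 (𝖫 𝗆 t) = 𝗆 (𝖫 𝗋 (𝖼 (𝖪 (𝖫 𝖽 t)))) := by
  have h := st_regRight_mul_right (𝖼 t)
  rw [st_braid_HU_UH, ← cr_left12 BraidedHopfSubalgebra.comul_hom (isYD_base k B H),
    st_braid_HU_UH, st_regRight_comul] at h
  exact h

variable [hRL : Fact U.RLCondition]

/-- The Yetter–Drinfeld compatibility over H between the coaction w and the action by left
translation. Under λ, both sides are the operator x ↦ ρ(f)(a x). -/
theorem st_rightToLeft_leftTrans (t : U.carrier ⊗[k] (H ⊗[k] Z)) :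
    𝗆 (𝖼 (𝖫 𝖼 (𝗐 (𝖪 (𝖫 𝖽 t))))) = 𝗆 (𝖫 𝗁 (𝖫 (𝖫 𝖼) (𝖫 𝖽U (𝗐 t)))) := by
  have h1 : ∀ s : U.carrier ⊗[k] (H ⊗[k] (H ⊗[k] Z)),
      𝗆 (𝖫 𝗁 (𝗆 (𝖫 𝗁 (𝖫 (𝖫 𝖼) (𝖫 𝖽U (𝗐 s)))))) = 𝗋 (𝖫 𝗆 s) := by
    intro s
    rw [← head21_lTensor, st_mul_assoc, ← lift25 (c := 𝗁) st_hit_mul_right, ← head12_lTensor, st_lam_rightToLeft]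
  have h2 : ∀ s : U.carrier ⊗[k] (H ⊗[k] (H ⊗[k] Z)),
      𝗆 (𝖫 𝗁 (𝗆 (𝖼 (𝖫 𝖼 (𝗐 (𝖪 (𝖫 𝖽 s))))))) = 𝗋 (𝖫 𝗆 s) := by
    intro s
    rw [cr_left12 rightToLeft_hom (isYD_base k B H), ← head21_lTensor, st_mul_assoc,
      lift31 st_lam_rightToLeft, st_regRight_mul_braid]
  refine ext_lam fun x => ?_
  have h3 := (h2 (𝖫 (𝖫 (TensorProduct.mk k H Z x)) t)).trans (h1 _).symm
  simpa only [head12_lTensor, head21_lTensor, cr_lTensor, lT_cr, lT_head21, lT2_cr, lT_head12] using h3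

variable (U) in
/-- The map `U → U` given by `𝖪 (𝗍 h ⊗ f)` for `h ⊗ f = rightToLeft`. -/
def drinfeldTwist : U.carrier →ₗ[k] U.carrier :=
  U.leftTrans ∘ₗ (antipodeSymm k B H).lTensor U.carrier ∘ₗ braid k B H U.carrier ∘ₗ U.rightToLeft

local notation "𝖥" => LinearMap.rTensor _ (BraidedHopfSubalgebra.drinfeldTwist U)

theorem drinfeldTwist_hom : IsYDHom k B U.drinfeldTwist :=
  .comp leftTrans_hom (.comp (.lTensor (antipodeSymm_hom k B H))
    (.comp (.braid (isYD_base k B H) U.isYD) rightToLeft_hom))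

theorem st_drinfeldTwist (t : U.carrier ⊗[k] Z) : 𝖥 t = 𝖪 (𝖫 𝗍 (𝖼 (𝗐 t))) := by
  induction t with
  | zero => simp
  | add s t hs ht => simp only [map_add, hs, ht]
  | tmul f z =>
    have h1 : ∀ s : H ⊗[k] U.carrier, 𝖪 (𝖫 𝗍 (𝖼 (TensorProduct.assoc k _ _ _ (s ⊗ₜ[k] z)))) =
        U.leftTrans ((antipodeSymm k B H).lTensor U.carrier (braid k B H U.carrier s)) ⊗ₜ z := by
      intro s
      have h2 : ∀ s : U.carrier ⊗[k] H, 𝖪 (𝖫 𝗍 (TensorProduct.assoc k _ _ _ (s ⊗ₜ[k] z))) =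
          U.leftTrans ((antipodeSymm k B H).lTensor U.carrier s) ⊗ₜ z := by
        intro s
        induction s with
        | zero => simp
        | add s t hs ht => simp only [map_add, add_tmul, hs, ht]
        | tmul f x => simp
      rw [← h2]
      induction s with
      | zero => simp
      | add s t hs ht => simp only [map_add, add_tmul, hs, ht]
      | tmul f x => simp [cr_tmul]
    rw [head12_tmul, h1]
    rfl

omit hRL in
theorem st_mul_antipodeSymm_tensor (u : H ⊗[k] (H ⊗[k] Z)) : 𝗆 (𝖫 𝗍 (𝗍 u)) = 𝗍 (𝗆 (𝖼 u)) := by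
  rw [st_antipodeSymm_mul (B := B), cr_left (antipodeSymm_hom k B H),
    cr_right (antipodeSymm_hom k B H), st_braid_braid (B := B)]

/-- Without braidings: ∑ D(f · a₁) · S⁻¹(a₂) = ε(a) D(f). The two inverse antipodes combine into
S⁻¹(a₂ (f · a₁)₍₋₁₎); the compatibility rewrites this as S⁻¹(f₍₋₁₎ a₁) acting on f₍₀₎ · a₂, where a₂
S⁻¹(a₁) contracts. -/
theorem st_leftTrans_drinfeldTwist (t : U.carrier ⊗[k] (H ⊗[k] Z)) :
    𝖪 (𝖫 𝗍 (𝖥 (𝖪 (𝖫 𝖽 t)))) = 𝖥 (𝖫 𝖾 t) := by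
  have h1 : ∀ y : H ⊗[k] (U.carrier ⊗[k] (H ⊗[k] Z)), 𝖫 𝗆 (𝖫 𝖼 (𝖼 y)) = 𝖼 (𝗆 (𝖼 (𝖫 𝖼 y))) := by
    intro y
    have h : ∀ u : H ⊗[k] (H ⊗[k] (U.carrier ⊗[k] Z)), 𝖼 (𝖫 𝖼 (𝖼 u)) = 𝖫 𝖼 (𝖼 (𝖫 𝖼 u)) :=
      fun u => cr_left22 (IsYDHom.braid (isYD_base k B H) (isYD_base k B H)) U.isYD u
    rw [cr_left21 (BraidedDuality.mul_hom k B H) U.isYD, h, lift20 st_braid_HU_UH]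
  have h2 : ∀ v : U.carrier ⊗[k] (H ⊗[k] Z), 𝖪 (𝖫 𝗍 (𝖪 (𝖫 𝖣 v))) = 𝖫 𝖾 v := by
    intro v
    rw [← head21_lTensor, st_leftTrans_leftTrans, lift32 (st_antipodeSymm_right (B := B)),
      st_leftTrans_one]
  have h3 : ∀ q : H ⊗[k] (U.carrier ⊗[k] (H ⊗[k] Z)),
      𝖪 (𝖫 𝗍 (𝖫 𝗆 (𝖼 q))) = 𝖪 (𝖫 𝗍 (𝖼 (𝖫 𝖪 (𝖫 (𝖫 𝗍) q)))) := by
    intro q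
    rw [lift24 (st_antipodeSymm_mul (B := B)), ← st_leftTrans_leftTrans,
      cr_right21 leftTrans_hom (isYD_base k B H), ← head21_lTensor,
      lift22 (fun t => (cr_left (antipodeSymm_hom k B H) t).symm), cr_lTensor]
  rw [st_drinfeldTwist, ← head21_lTensor, st_leftTrans_leftTrans,
    lift33 (st_mul_antipodeSymm_tensor (B := B)), h1, st_rightToLeft_leftTrans,
    cr_left21 (BraidedDuality.mul_hom k B H) U.isYD, lift42 st_braid_hit, h3,
    lift41 h2, ← head12_lTensor, ← st_drinfeldTwist]

/-- The analogue of u a = S²(a) u for a Drinfeld element u: here D(f · a) = D(f) · S⁻²(a), obtained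
by solving `st_leftTrans_drinfeldTwist` for its first factor. -/
theorem st_drinfeldTwist_leftTrans (t : U.carrier ⊗[k] (H ⊗[k] Z)) :
    𝖥 (𝖪 t) = 𝖪 (𝖫 𝗍 (𝖫 𝗍 (𝖥 t))) := by
  have h1 : ∀ v : U.carrier ⊗[k] (H ⊗[k] Z), 𝖪 (𝖫 𝗍 (𝖫 𝗍 (𝖪 (𝖫 𝗍 (𝖫 𝖽 v))))) = 𝖫 𝖾 v := by
    intro v
    rw [← head21_lTensor, ← head21_lTensor, st_leftTrans_leftTrans,
      ← lift22 (fun t => rTensor_lTensor_comm (antipodeSymm k B H) _ t),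
      lift33 (st_mul_antipodeSymm_tensor (B := B)),
      lift22 (fun t => cr_right (antipodeSymm_hom k B H) t),
      lift21 (fun t => (st_comulCop (B := B) t).symm), lift32 (st_antipodeSymm_left (B := B)),
      lift21 (st_antipodeSymm_one B), st_leftTrans_one]
  have h := st_leftTrans_drinfeldTwist (𝖫 𝖽 t)
  rw [lift20 st_counit_comul, lift22 (st_coassoc), head21_lTensor, rTensor_lTensor_comm] at h
  rw [← h, h1, ← rTensor_lTensor_comm, ← head21_lTensor, lift20 st_comul_counit]

/-- Without braidings: ∑ D(f₍₀₎) · f₍₋₁₎ = f, by coassociativity of w and ∑ S⁻¹(a₂) a₁ = ε(a). It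
supplies the preimages under D. -/
theorem st_leftTrans_braid_drinfeldTwist (t : U.carrier ⊗[k] Z) : 𝖪 (𝖼 (𝖫 𝖥 (𝗐 t))) = t := by
  have h : ∀ u : H ⊗[k] (H ⊗[k] (U.carrier ⊗[k] Z)), 𝖫 𝖼 (𝖼 (𝖫 𝖼 u)) = 𝖼 (𝖫 𝖼 (𝖼 u)) :=
    fun u => (cr_left22 (IsYDHom.braid (isYD_base k B H) (isYD_base k B H)) U.isYD u).symm
  rw [← lift41 (fun t => (st_drinfeldTwist t).symm), ← st_rightToLeft_coassoc,
    cr_right21 leftTrans_hom (isYD_base k B H), st_leftTrans_leftTrans,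
    lift22 (fun t => (cr_left (antipodeSymm_hom k B H) t).symm), h,
    ← cr_left21 (BraidedDuality.mul_hom k B H) U.isYD, cr_right (antipodeSymm_hom k B H),
    ← st_comulCop, st_antipodeSymm_left, st_counit_rightToLeft,
    TensorProduct.mk_apply, cr_left01 (BraidedDuality.one_hom k B H) U.isYD, st_leftTrans_one]

/-- D shifts the translating element by S⁻², so the preimage of f is taken with S² inserted: ∑ f₍₀₎
· S²(f₍₋₁₎). -/
theorem st_drinfeldTwist_surjective (t : U.carrier ⊗[k] Z) :
    𝖥 (𝖪 (𝖫 𝗌 (𝖫 𝗌 (𝖼 (𝗐 t))))) = t := by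
  rw [st_drinfeldTwist_leftTrans, rTensor_lTensor_comm, rTensor_lTensor_comm,
    lift20 st_antipodeSymm_antipode, lift20 st_antipodeSymm_antipode,
    ← cr_right drinfeldTwist_hom, st_leftTrans_braid_drinfeldTwist]

/-- If f = D(g), then f(S⁻²(x)) = D(g · x)(1). Since g · x = ∑ ⟨g₁, x⟩ g₂, the dependence on x is
through elements of U only. -/
theorem st_ev_antipodeSymm_sq (t : U.carrier ⊗[k] (H ⊗[k] Z)) :
    𝖊 (head10 _ (U.counit ∘ₗ U.drinfeldTwist) (𝖼 (𝖽U (𝖪 (𝖫 𝗌 (𝖫 𝗌 (𝖼 (𝗐 t)))))))) =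
      𝖊 (𝖫 𝗍 (𝖫 𝗍 t)) := by
  have h1 : ∀ s : U.carrier ⊗[k] Z, head10 _ (U.counit ∘ₗ U.drinfeldTwist) s =
      head10 _ U.counit (𝖥 s) := by
    intro s
    induction s with
    | zero => simp
    | add s t hs ht => simp only [map_add, hs, ht]
    | tmul f z => simp
  rw [← head10_lTensor, ← st_leftTrans_eq, h1, st_drinfeldTwist_leftTrans,
    st_drinfeldTwist_surjective, st_counit, ← head21_lTensor, st_ev_leftTrans, lift20 st_mul_one]

theorem antipodeSymm_sq_mem (f : U.carrier) :
    (f : Module.Dual k H) ∘ₗ antipodeSymm k B H ∘ₗ antipodeSymm k B H ∈ U.carrier := by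
  -- The functional ∑ ε(D(g₂)) g₁ for the chosen preimage of f under D; the dummy tail `k` is
  -- removed at the end.
  let g : U.carrier := TensorProduct.rid k U.carrier (head10 _ (U.counit ∘ₗ U.drinfeldTwist)
    (𝖼 (𝖽U (𝖪 (𝖫 𝗌 (𝖫 𝗌 (𝖼 (𝗐 (f ⊗ₜ (1 : k))))))))))
  convert g.2
  ext x
  have h := st_ev_antipodeSymm_sq (𝖫 (TensorProduct.mk k H k x) (f ⊗ₜ (1 : k)))
  simp only [cr_lTensor, lT_rTensor, head21_lTensor, head12_lTensor, head10_lTensor] at h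
  have h1 : ∀ s : U.carrier ⊗[k] k, s = TensorProduct.rid k U.carrier s ⊗ₜ (1 : k) := fun s =>
    ((TensorProduct.rid k U.carrier).symm_apply_apply s).symm
  rw [h1 (head10 _ (U.counit ∘ₗ U.drinfeldTwist) _)] at h
  simp only [LinearMap.lTensor_tmul, LinearMap.rTensor_tmul, TensorProduct.mk_apply,
    head20_tmul, smul_eq_mul, mul_one] at h
  exact h.symm

/-- Stability under S⁻² followed by the assumed stability under S. -/
theorem antipodeSymm_mem (f : U.carrier) :
    (f : Module.Dual k H) ∘ₗ antipodeSymm k B H ∈ U.carrier := by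
  have h := U.antipode_mem _ (antipodeSymm_sq_mem f)
  convert h using 1
  ext x
  simp [antipodeSymm_antipode]

variable (U) in
/-- The inverse antipode `f ↦ f ∘ S⁻¹` of `U`. -/
def coantipode : U.carrier →ₗ[k] U.carrier :=
  LinearMap.codRestrict U.carrier (LinearMap.lcomp k k (antipodeSymm k B H) ∘ₗ U.carrier.subtype)
    antipodeSymm_mem

theorem st_ev_coantipode (t : U.carrier ⊗[k] (H ⊗[k] Z)) :
    𝖊 (U.coantipode.rTensor _ t) = 𝖊 (𝖫 𝗍 t) := by
  refine tensor3_ext (f := 𝖊 ∘ₗ U.coantipode.rTensor _) (g := 𝖊 ∘ₗ 𝖫 𝗍) ?_ t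
  intro f x z
  simp
  rfl

theorem coantipode_hom : IsYDHom k B U.coantipode := by
  refine IsYDHom.of_ev ?_
  have h : head20 k U.ev ∘ₗ U.coantipode.rTensor (H ⊗[k] k) = 𝖊 ∘ₗ 𝖫 𝗍 :=
    LinearMap.ext st_ev_coantipode
  rw [h]
  exact .comp (.head20 U.ev_hom) (.lTensor (.rTensor (antipodeSymm_hom k B H)))

end Symmetric

/-! ### The inverse antipode of `U`, obtained by transposition. -/

section Symmetric

local notation "𝖪" => head21 _ (BraidedHopfSubalgebra.leftTrans U)
local notation "𝗍U" => LinearMap.rTensor _ (BraidedHopfSubalgebra.coantipode U)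

variable [IsSymmetricHopf k B H]

/-- The counterpart of `st_antipode_mul_mul` for the opposite comultiplication and S⁻¹. -/
theorem st_antipodeSymm_mul_mul (t : H ⊗[k] (H ⊗[k] Z)) :
    𝗆 (𝗍 (𝗆 (𝖫 𝖼 (𝖣 t)))) = 𝗍 (𝖾 t) := by
  rw [st_antipodeSymm_mul (B := B), st_mul_assoc,
    lift22 (fun t => (cr_right (antipodeSymm_hom k B H) t).symm), rTensor_lTensor_comm,
    ← cr_left21 (BraidedDuality.mul_hom k B H) (isYD_base k B H), ← head12_lTensor,
    st_antipodeSymm_left, TensorProduct.mk_apply,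
    cr_left01 (BraidedDuality.one_hom k B H) (isYD_base k B H), st_mul_one, head10_lTensor]

theorem st_comul_regRight (t : U.carrier ⊗[k] (H ⊗[k] Z)) : 𝖽 (𝗋 t) = 𝗋 (𝖫 𝖽 t) := by
  rw [st_regRight, st_regRight, ← head20_lTensor, lift22 st_coassoc]

theorem st_counit_antipodeSymm (t : H ⊗[k] Z) : 𝖾 (𝗍 t) = 𝖾 t := by
  have h := congrArg 𝖾 (st_antipodeSymm_left (B := B) t)
  rw [st_counit_mul B, st_counit_one B, ← head10_lTensor, ← rTensor_lTensor_comm, st_cop_counit] at h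
  exact h

variable [hRL : Fact U.RLCondition]

theorem st_coantipode_one (t : Z) : 𝗍U (U.one ⊗ₜ[k] t) = U.one ⊗ₜ[k] t := by
  refine ext_ev fun x => ?_
  rw [← rTensor_lTensor_comm, st_ev_coantipode]
  simp only [LinearMap.lTensor_tmul, st_ev_one, st_counit_antipodeSymm]

/-- The transpose of the fact that S⁻¹ exchanges the comultiplication of H with its opposite. -/
theorem st_coantipode_mul (t : U.carrier ⊗[k] (U.carrier ⊗[k] Z)) :
    𝗍U (𝗆U t) = 𝗆U (𝖼 (𝖫 𝗍U (𝗍U t))) := by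
  have h1 : ∀ s : U.carrier ⊗[k] (U.carrier ⊗[k] (H ⊗[k] Z)), 𝖊 (𝗍U (𝗆U s)) = 𝖊 (𝗆U (𝖼 (𝖫 𝗍U (𝗍U s)))) := by
    intro s
    rw [st_ev_coantipode, ← head21_lTensor, st_ev_mul, st_ev_mul, lift23 (lift23 (st_cop_antipodeSymm (B := B))),
      ← cr_lTensor, st_ev_ev_braid, lift21 (lift21 (st_braid_comulCop (B := B))), ← lT_rTensor,
      lift22 st_ev_coantipode, ← rTensor_lTensor_comm, ← rTensor_lTensor_comm,
      ← rTensor_lTensor_comm, st_ev_coantipode, lift22 (fun t => (head20_lTensor _ _ t).symm),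
      lift22 (lift22 (fun t => rTensor_lTensor_comm (antipodeSymm k B H) _ t))]
  refine ext_ev fun x => ?_
  have h2 := h1 (𝖫 (𝖫 (TensorProduct.mk k H Z x)) t)
  simpa only [head21_lTensor, cr_lTensor, lT_rTensor, rTensor_lTensor_comm] using h2

omit [IsSymmetricHopf k B H] hRL in
theorem st_ev_one_counit (t : U.carrier ⊗[k] (H ⊗[k] Z)) :
    𝖊 (U.one ⊗ₜ[k] head10 _ U.counit t) = 𝖊 (𝖫 𝗎 (𝖫 𝖾 t)) := by
  rw [st_ev_one, st_counit, ← head20_lTensor, lift22 (fun t => (mk_lTensor (1 : H) 𝖾 t).symm)]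

/-- The crossing reverses the product, as befits an inverse antipode: the identity is ∑ f₂ S⁻¹(f₁) =
ε(f) up to braiding, transposed from H. -/
theorem st_coantipode_left (t : U.carrier ⊗[k] Z) :
    𝗆U (𝖼 (𝗍U (𝖽U t))) = U.one ⊗ₜ[k] head10 _ U.counit t := by
  have h1 : ∀ s : U.carrier ⊗[k] (H ⊗[k] Z), 𝖊 (𝗆U (𝖼 (𝗍U (𝖽U s)))) = 𝖊 (U.one ⊗ₜ[k] head10 _ U.counit s) := by
    intro s
    rw [st_ev_mul, ← cr_lTensor, ← rTensor_lTensor_comm, ← head12_lTensor, st_ev_ev_braid,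
      ← rTensor_lTensor_comm, ← rTensor_lTensor_comm, st_ev_coantipode,
      lift22 (fun t => (head20_lTensor _ _ t).symm), ← head12_lTensor, ← head12_lTensor,
      st_ev_comul, lift22 (fun t => cr_right (antipodeSymm_hom k B H) t),
      lift20 (st_braid_braid (B := B)), lift32 (st_antipodeSymm_left (B := B)), st_ev_one_counit]
  refine ext_ev fun x => ?_
  have h2 := h1 (𝖫 (TensorProduct.mk k H Z x) t)
  simpa only [head21_lTensor, cr_lTensor, lT_rTensor, rTensor_lTensor_comm, head12_lTensor,
    head10_lTensor, LinearMap.lTensor_tmul] using h2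

theorem st_coantipode_right (t : U.carrier ⊗[k] Z) :
    𝗆U (𝖼 (𝖫 𝗍U (𝖽U t))) = U.one ⊗ₜ[k] head10 _ U.counit t := by
  have h1 : ∀ s : U.carrier ⊗[k] (H ⊗[k] Z), 𝖊 (𝗆U (𝖼 (𝖫 𝗍U (𝖽U s)))) =
      𝖊 (U.one ⊗ₜ[k] head10 _ U.counit s) := by
    intro s
    rw [st_ev_mul, ← cr_lTensor, st_ev_ev_braid, lift21 (lift21 (st_braid_comulCop (B := B))),
      ← lT_rTensor, lift22 st_ev_coantipode, ← head12_lTensor, ← head12_lTensor, st_ev_comul,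
      lift22 (fun t => cr_left (antipodeSymm_hom k B H) t),
      lift21 (fun t => (st_comulCop (B := B) t).symm),
      lift32 (st_antipodeSymm_right (B := B)), st_ev_one_counit]
  refine ext_ev fun x => ?_
  have h2 := h1 (𝖫 (TensorProduct.mk k H Z x) t)
  simpa only [head21_lTensor, cr_lTensor, lT_rTensor, rTensor_lTensor_comm, head12_lTensor,
    head10_lTensor, LinearMap.lTensor_tmul] using h2

/-- The transpose of `st_antipodeSymm_mul_mul`; it is the cancellation needed for commuting γ past
H. -/
theorem st_leftTrans_coantipode (t : U.carrier ⊗[k] (H ⊗[k] Z)) :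
    𝖪 (𝗍U (𝖫 𝗋 (𝖽U t))) = 𝖫 𝖾 (𝗍U t) := by
  have h1 : ∀ s : U.carrier ⊗[k] (H ⊗[k] (H ⊗[k] Z)), 𝖊 (𝖪 (𝗍U (𝖫 𝗋 (𝖽U s)))) = 𝖊 (𝖫 𝖾 (𝗍U s)) := by
    intro s
    rw [st_ev_leftTrans, ← rTensor_lTensor_comm, st_ev_coantipode, lift12 st_regRight,
      lift22 (fun t => (head20_lTensor _ _ t).symm), lift22 (fun t => (head20_lTensor _ _ t).symm),
      ← head12_lTensor, ← head12_lTensor, ← head12_lTensor, st_ev_comul,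
      lift22 (fun t => cr_right (antipodeSymm_hom k B H) t),
      lift23 (fun t => cr_right21 (BraidedDuality.mul_hom k B H) (isYD_base k B H) t),
      lift21 (fun t => (st_comulCop (B := B) t).symm),
      ← lift25 (fun t => (st_antipodeSymm_mul_mul t).symm), ← rTensor_lTensor_comm,
      st_ev_coantipode]
  refine ext_ev fun x => ?_
  have h2 := h1 (𝖫 (𝖫 (TensorProduct.mk k H Z x)) t)
  simpa only [head21_lTensor, lT_head21, rTensor_lTensor_comm, head12_lTensor, lT_head10] using h2

end Symmetric

/-! ### The map γ : U → H # U and its commutation with H # U. -/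

section Symmetric

local notation "𝗐" => head12 _ (BraidedHopfSubalgebra.rightToLeft U)
local notation "𝗍U" => LinearMap.rTensor _ (BraidedHopfSubalgebra.coantipode U)
local notation "𝗘" => BraidedHopfSubalgebra.headMulHU U _

variable [IsSymmetricHopf k B H] [hRL : Fact U.RLCondition]

variable (U) in
/-- The map `γ : U → H # U` with `λ (γ f) = ρ (f ∘ S⁻¹ # 1)`; it is the convolution inverse of
`rightToLeft`. -/
def rightToLeftInv : U.carrier →ₗ[k] H ⊗[k] U.carrier := U.rightToLeft ∘ₗ U.coantipode

local notation "𝗀" => head12 _ (BraidedHopfSubalgebra.rightToLeftInv U)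

theorem rightToLeftInv_hom : IsYDHom k B U.rightToLeftInv := .comp rightToLeft_hom coantipode_hom

theorem st_lam_rightToLeftInv (t : U.carrier ⊗[k] (H ⊗[k] Z)) : 𝗆 (𝖫 𝗁 (𝗀 t)) = 𝗋 (𝗍U t) := by
  have h : 𝗀 t = 𝗐 (𝗍U t) := by
    simp only [rightToLeftInv, head12, LinearMap.rTensor_comp, LinearMap.comp_apply]
  rw [h, st_lam_rightToLeft]

theorem st_rightToLeftInv_one (t : Z) : 𝗀 (U.one ⊗ₜ[k] t) = 1 ⊗ₜ (U.one ⊗ₜ t) := by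
  refine ext_lam fun x => ?_
  rw [← head12_lTensor, st_lam_rightToLeftInv]
  simp only [LinearMap.lTensor_tmul, st_coantipode_one, st_regRight_one, st_hit_one]
  exact (st_one_mul _).symm

/-- Both ρ and the inverse antipode of U reverse products, so their composite preserves them;
faithfulness of λ transfers this to γ. -/
theorem st_rightToLeftInv_mul (t : U.carrier ⊗[k] (U.carrier ⊗[k] Z)) :
    𝗀 (𝗆U t) = 𝗘 (𝖫 (𝖫 𝗀) (𝗀 t)) := by
  have h1 : ∀ s : U.carrier ⊗[k] (U.carrier ⊗[k] (H ⊗[k] Z)), 𝗆 (𝖫 𝗁 (𝗀 (𝗆U s))) =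
      𝗆 (𝖫 𝗁 (𝗘 (𝖫 (𝖫 𝗀) (𝗀 s)))) := by
    intro s
    rw [st_lam_rightToLeftInv, st_coantipode_mul, st_regRight_mul, st_braid_UU, st_lam_mulHU,
      lift32 (lift32 st_lam_rightToLeftInv), ← head12_lTensor, ← head12_lTensor,
      st_lam_rightToLeftInv, rTensor_lTensor_comm, rTensor_lTensor_comm]
  refine ext_lam fun x => ?_
  have h2 := h1 (𝖫 (𝖫 (TensorProduct.mk k H Z x)) t)
  rw [head21_lTensor, head12_lTensor, head12_lTensor, lT2_head12, headMulHU_lTensor] at h2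
  exact h2

/-- Under λ the left side is ρ(S⁻¹ f₁) ρ(f₂) = ρ(f₂ S⁻¹(f₁)), where the inverse antipode of U
contracts. -/
theorem st_rightToLeftInv_left (t : U.carrier ⊗[k] Z) :
    𝗘 (𝖫 (𝖫 𝗐) (𝗀 (𝖽U t))) = 1 ⊗ₜ (U.one ⊗ₜ head10 _ U.counit t) := by
  have h1 : ∀ s : U.carrier ⊗[k] (H ⊗[k] Z), 𝗆 (𝖫 𝗁 (𝗘 (𝖫 (𝖫 𝗐) (𝗀 (𝖽U s))))) =
      head10 _ U.counit s := by
    intro s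
    rw [st_lam_mulHU, lift31 (lift31 st_lam_rightToLeft), ← head12_lTensor,
      st_lam_rightToLeftInv, rTensor_lTensor_comm, ← st_braid_UU (𝗍U (𝖽U s)), ← st_regRight_mul,
      st_coantipode_left, st_regRight_one]
  refine ext_lam fun x => ?_
  have h2 := h1 (𝖫 (TensorProduct.mk k H Z x) t)
  rw [head12_lTensor, head12_lTensor, lT2_head12, headMulHU_lTensor, head10_lTensor] at h2
  rw [h2]
  simp only [LinearMap.lTensor_tmul, st_hit_one]
  exact (st_one_mul _).symm

theorem st_rightToLeftInv_right (t : U.carrier ⊗[k] Z) :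
    𝗘 (𝖫 (𝖫 𝗀) (𝗐 (𝖽U t))) = 1 ⊗ₜ (U.one ⊗ₜ head10 _ U.counit t) := by
  have h1 : ∀ s : U.carrier ⊗[k] (H ⊗[k] Z), 𝗆 (𝖫 𝗁 (𝗘 (𝖫 (𝖫 𝗀) (𝗐 (𝖽U s))))) =
      head10 _ U.counit s := by
    intro s
    rw [st_lam_mulHU, lift32 (lift32 st_lam_rightToLeftInv), ← head12_lTensor, ← head12_lTensor,
      st_lam_rightToLeft, ← st_braid_UU (𝖫 𝗍U (𝖽U s)), ← st_regRight_mul,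
      st_coantipode_right, st_regRight_one]
  refine ext_lam fun x => ?_
  have h2 := h1 (𝖫 (TensorProduct.mk k H Z x) t)
  rw [head12_lTensor, head12_lTensor, lT2_head12, headMulHU_lTensor, head10_lTensor] at h2
  rw [h2]
  simp only [LinearMap.lTensor_tmul, st_hit_one]
  exact (st_one_mul _).symm

/-- Without braidings: ∑ ρ(S⁻¹ f₁)(ρ(f₂)(h) x) = h ρ(S⁻¹ f)(x). Expand with `st_regRight_mul_braid`
and cancel with `st_leftTrans_coantipode`. -/
theorem st_regRight_coantipode (t : U.carrier ⊗[k] (H ⊗[k] (H ⊗[k] Z))) :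
    𝗋 (𝗍U (𝖫 𝗆 (𝖫 𝗋 (𝖽U t)))) = 𝗆 (𝖫 𝗋 (𝖼 (𝗍U t))) := by
  rw [rTensor_lTensor_comm, st_regRight_mul_braid, ← rTensor_lTensor_comm, lift22 st_comul_regRight,
    ← head12_lTensor, st_leftTrans_coantipode, rTensor_lTensor_comm, lift20 st_counit_comul]

/-- The commutation of γ tested on H: the H-part is `st_regRight_coantipode`, and the U-part holds
because ⇀ commutes with ρ. -/
theorem st_lam_mulHU_rightToLeftInv
    (v : U.carrier ⊗[k] (H ⊗[k] (U.carrier ⊗[k] (H ⊗[k] Z)))) :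
    𝗆 (𝖫 𝗁 (𝗘 (𝗀 (𝖫 𝗋 (𝖽U v))))) = 𝗆 (𝖫 𝗁 (𝗘 (𝖫 (𝖫 𝗀) (𝖫 𝖼 (𝖼 v))))) := by
  have h : ∀ y : U.carrier ⊗[k] (U.carrier ⊗[k] (H ⊗[k] Z)), 𝗁 (𝖫 𝗋 (𝖼 y)) = 𝗋 (𝖫 𝗁 y) := by
    intro y
    rw [st_hit_regRight, st_braid_UU]
  rw [st_lam_mulHU, ← head12_lTensor, ← head12_lTensor, st_lam_rightToLeftInv,
    lift22 (fun t => (head21_lTensor _ _ t).symm), ← head12_lTensor, st_regRight_coantipode,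
    st_lam_mulHU, lift32 (lift32 st_lam_rightToLeftInv),
    lift22 (fun t => (cr_left coantipode_hom t).symm), ← cr_left coantipode_hom,
    lift32 h, ← cr_lTensor, rTensor_lTensor_comm]

/-- The commutation of `H # U` with `γ`. -/
theorem st_mulHU_rightToLeftInv (t : U.carrier ⊗[k] (H ⊗[k] (U.carrier ⊗[k] Z))) :
    𝗘 (𝗀 (𝖫 𝗋 (𝖽U t))) = 𝗘 (𝖫 (𝖫 𝗀) (𝖫 𝖼 (𝖼 t))) := by
  refine ext_lam fun x => ?_
  have h2 := st_lam_mulHU_rightToLeftInv (𝖫 (𝖫 (𝖫 (TensorProduct.mk k H Z x))) t)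
  rw [head12_lTensor U.comul, lT_head21, head12_lTensor, headMulHU_lTensor, cr_lTensor, lT_cr,
    lT2_head12, headMulHU_lTensor] at h2
  exact h2

end Symmetric

end BraidedHopfSubalgebra

/-! ### Products of algebras acting on heads of tensors -/

section HeadProducts

variable {k B : Type*} [Field k] [Ring B] [HopfAlgebra k B]
variable {A D P Q V W X Y Z Z' : Type*} [AddCommMonoid A] [Module k A] [AddCommMonoid D]
  [Module k D] [AddCommMonoid P] [Module k P] [AddCommMonoid Q] [Module k Q]
  [AddCommMonoid V] [Module k V] [AddCommMonoid W] [Module k W]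
  [AddCommMonoid X] [Module k X] [AddCommMonoid Y] [Module k Y] [AddCommMonoid Z] [Module k Z]
  [AddCommMonoid Z'] [Module k Z']

local notation "𝖫" => LinearMap.lTensor _
local notation "𝖺" => TensorProduct.assoc k _ _ _
local notation "𝖠" => LinearEquiv.toLinearMap (TensorProduct.assoc k _ _ _)

/-- The passage from products on paired factors to right-nested form. Smash products and braided
tensor products are both of this shape, with different twists χ. -/
theorem assoc_head21_map_mid (f : A ⊗[k] W →ₗ[k] P) (g : V ⊗[k] D →ₗ[k] Q)
    (χ : V ⊗[k] W →ₗ[k] W ⊗[k] V) (t : (A ⊗[k] V) ⊗[k] ((W ⊗[k] D) ⊗[k] Z)) :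
    𝖺 (head21 Z (map f g ∘ₗ mid A D χ) t) =
      𝖫 (head21 Z g) (head21 _ f (𝖫 (head22 _ χ) (𝖺 (𝖫 𝖠 t)))) := by
  refine tensor3_ext (f := 𝖠 ∘ₗ head21 Z (map f g ∘ₗ mid A D χ))
    (g := 𝖫 (head21 Z g) ∘ₗ head21 _ f ∘ₗ 𝖫 (head22 _ χ) ∘ₗ 𝖠 ∘ₗ 𝖫 𝖠) ?_ t
  intro x y z
  induction x with
  | zero => simp
  | add s t hs ht => simp only [map_add, add_tmul, hs, ht]
  | tmul a v =>
    induction y with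
    | zero => simp
    | add s t hs ht => simp only [map_add, add_tmul, tmul_add, hs, ht]
    | tmul w d =>
      simp only [mid, LinearMap.comp_apply, LinearEquiv.coe_coe, head21_tmul, head22_tmul,
        TensorProduct.assoc_tmul, LinearMap.lTensor_tmul, TensorProduct.assoc_symm_tmul,
        LinearMap.rTensor_tmul]
      generalize χ (v ⊗ₜ w) = p
      induction p with
      | zero => simp
      | add s t hs ht => simp only [map_add, add_tmul, tmul_add, hs, ht]
      | tmul w v => simp

theorem assoc_head21_tensorMul [YDData k B A] [YDData k B D] (mA : A ⊗[k] A →ₗ[k] A)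
    (mD : D ⊗[k] D →ₗ[k] D) (t : (A ⊗[k] D) ⊗[k] ((A ⊗[k] D) ⊗[k] Z)) :
    𝖺 (head21 Z (tensorMul B mA mD) t) =
      𝖫 (head21 Z mD) (head21 _ mA (𝖫 (cr B) (𝖺 (𝖫 𝖠 t)))) :=
  assoc_head21_map_mid mA mD _ t

theorem head22_smash [YDData k B A] [YDData k B X] (act : X ⊗[k] A →ₗ[k] A)
    (Δ : X →ₗ[k] X ⊗[k] X) (t : X ⊗[k] (A ⊗[k] Z)) :
    head22 Z (act.rTensor X ∘ₗ (TensorProduct.assoc k X A X).symm.toLinearMap ∘ₗ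
      (braid k B X A).lTensor X ∘ₗ (TensorProduct.assoc k X X A).toLinearMap ∘ₗ Δ.rTensor A) t =
    head21 _ act (𝖫 (cr B) (head12 _ Δ t)) := by
  refine tensor3_ext (f := head22 Z (act.rTensor X ∘ₗ
      (TensorProduct.assoc k X A X).symm.toLinearMap ∘ₗ (braid k B X A).lTensor X ∘ₗ
        (TensorProduct.assoc k X X A).toLinearMap ∘ₗ Δ.rTensor A))
    (g := head21 _ act ∘ₗ 𝖫 (cr B) ∘ₗ head12 _ Δ) ?_ t
  intro x a z
  simp only [LinearMap.comp_apply, LinearEquiv.coe_coe, head22_tmul, LinearMap.rTensor_tmul,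
    head12_tmul]
  generalize Δ x = p
  induction p with
  | zero => simp
  | add s t hs ht => simp only [map_add, add_tmul, tmul_add, hs, ht]
  | tmul x y =>
    simp only [TensorProduct.assoc_tmul, LinearMap.lTensor_tmul, cr_tmul]
    generalize braid k B X A (y ⊗ₜ a) = q
    induction q with
    | zero => simp
    | add s t hs ht => simp only [map_add, add_tmul, tmul_add, hs, ht]
    | tmul a y => simp

theorem assoc_head21_pass [YDData k B A] [YDData k B X] (g : X ⊗[k] Y →ₗ[k] Z')
    (t : X ⊗[k] ((A ⊗[k] Y) ⊗[k] Z)) :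
    𝖺 (head21 Z (pass B A g) t) = 𝖫 (head21 Z g) (cr B (𝖫 𝖠 t)) := by
  refine tensor3_ext (f := 𝖠 ∘ₗ head21 Z (pass B A g))
    (g := 𝖫 (head21 Z g) ∘ₗ cr B ∘ₗ 𝖫 𝖠) ?_ t
  intro x y z
  induction y with
  | zero => simp
  | add s t hs ht => simp only [map_add, add_tmul, tmul_add, hs, ht]
  | tmul a y =>
    simp only [pass, LinearMap.comp_apply, LinearEquiv.coe_coe, head21_tmul, LinearMap.lTensor_tmul,
      TensorProduct.assoc_tmul, TensorProduct.assoc_symm_tmul, LinearMap.rTensor_tmul, cr_tmul]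
    generalize braid k B X A (x ⊗ₜ a) = q
    induction q with
    | zero => simp
    | add s t hs ht => simp only [map_add, add_tmul, tmul_add, hs, ht]
    | tmul a y => simp

theorem tmul_one_injective {a a' : A} (h : a ⊗ₜ[k] (1 : k) = a' ⊗ₜ[k] (1 : k)) : a = a' := by
  simpa using congrArg (TensorProduct.rid k A) h

theorem IsModuleAlgebra.act_mul_of_head [YDData k B A] [YDData k B X] {Δ : X →ₗ[k] X ⊗[k] X}
    {mA : A ⊗[k] A →ₗ[k] A} {act : X ⊗[k] A →ₗ[k] A}
    (h : ∀ t : X ⊗[k] (A ⊗[k] (A ⊗[k] k)), head21 k act (𝖫 (head21 k mA) t) =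
      head21 k mA (𝖫 (head21 k act) (head21 _ act (𝖫 (cr B) (head12 _ Δ t))))) :
    act ∘ₗ mA.lTensor X = mA ∘ₗ map act act ∘ₗ mid X A (braid k B X A) ∘ₗ
      Δ.rTensor (A ⊗[k] A) := by
  apply TensorProduct.ext_threefold'
  intro x a b
  apply tmul_one_injective (k := k)
  have h1 := h (x ⊗ₜ (a ⊗ₜ (b ⊗ₜ 1)))
  simp only [LinearMap.lTensor_tmul, head21_tmul, head12_tmul] at h1
  simp only [LinearMap.comp_apply, LinearMap.lTensor_tmul, LinearMap.rTensor_tmul]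
  rw [h1]
  generalize Δ x = p
  induction p with
  | zero => simp
  | add s t hs ht => simp only [map_add, add_tmul, hs, ht]
  | tmul x y =>
    have h2 := assoc_head21_map_mid (Z := k) act act (braid k B X A)
      ((x ⊗ₜ y) ⊗ₜ ((a ⊗ₜ b) ⊗ₜ 1))
    have h3 : ∀ s : A ⊗[k] A, mA s ⊗ₜ[k] (1 : k) = head21 k mA (𝖺 (s ⊗ₜ 1)) := by
      intro s
      induction s with
      | zero => simp
      | add s t hs ht => simp only [map_add, add_tmul, hs, ht]
      | tmul a b => simp
    rw [h3, ← LinearMap.comp_apply (map act act)]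
    simp only [head21_tmul, LinearMap.lTensor_tmul, LinearEquiv.coe_coe,
      TensorProduct.assoc_tmul] at h2
    rw [h2]
    rfl

theorem mid_hom [YDData k B A] [YDData k B D] [YDData k B V] [YDData k B W]
    {χ : V ⊗[k] W →ₗ[k] W ⊗[k] V} (h : IsYDHom k B χ) : IsYDHom k B (mid A D χ) :=
  .comp (.symm .assoc) (.comp (.lTensor (.comp .assoc (.comp (.rTensor h) (.symm .assoc)))) .assoc)

theorem pass_hom [YDData k B A] [YDData k B X] [YDData k B Y] [YDData k B Z]
    (hX : IsYD k B X) (hA : IsYD k B A) {g : X ⊗[k] Y →ₗ[k] Z} (hg : IsYDHom k B g) :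
    IsYDHom k B (pass B A g) :=
  .comp (.lTensor hg) (.comp .assoc (.comp (.rTensor (.braid hX hA)) (.symm .assoc)))

theorem smashMul_hom [YDData k B A] [YDData k B X] (hX : IsYD k B X) (hA : IsYD k B A)
    {mA : A ⊗[k] A →ₗ[k] A} {mX : X ⊗[k] X →ₗ[k] X} {Δ : X →ₗ[k] X ⊗[k] X}
    {act : X ⊗[k] A →ₗ[k] A} (hmA : IsYDHom k B mA) (hmX : IsYDHom k B mX) (hΔ : IsYDHom k B Δ)
    (hact : IsYDHom k B act) : IsYDHom k B (smashMul B mA mX Δ act) :=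
  .comp (.tensorMap hmA hmX) (mid_hom (.comp (.rTensor hact) (.comp (.symm .assoc)
    (.comp (.lTensor (.braid hX hA)) (.comp .assoc (.rTensor hΔ))))))

theorem unit_tmul_hom [YDData k B A] [YDData k B X] {e : A} {e' : X}
    (he : IsYDHom k B (LinearMap.toSpanSingleton k A e))
    (he' : IsYDHom k B (LinearMap.toSpanSingleton k X e')) :
    IsYDHom k B (LinearMap.toSpanSingleton k (A ⊗[k] X) (e ⊗ₜ e')) := by
  have h : LinearMap.toSpanSingleton k (A ⊗[k] X) (e ⊗ₜ e') =
      map (LinearMap.toSpanSingleton k A e) (LinearMap.toSpanSingleton k X e') ∘ₗ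
        (TensorProduct.lid k k).symm.toLinearMap := by
    ext
    simp
  rw [h]
  exact .comp (.tensorMap he he') (.symm .lid)

theorem IsYDAlgebra.head_assoc [YDData k B A] {mA : A ⊗[k] A →ₗ[k] A} {eA : A}
    (hA : IsYDAlgebra B mA eA) (t : A ⊗[k] (A ⊗[k] (A ⊗[k] Z))) :
    head21 Z mA (head21 _ mA t) = head21 Z mA (𝖫 (head21 Z mA) t) := by
  refine tensor4_ext (f := head21 Z mA ∘ₗ head21 _ mA) (g := head21 Z mA ∘ₗ 𝖫 (head21 Z mA)) ?_ t
  intro a b c z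
  simp [hA.assoc]

theorem IsYDAlgebra.head_one_mul [YDData k B A] {mA : A ⊗[k] A →ₗ[k] A} {eA : A}
    (hA : IsYDAlgebra B mA eA) (t : A ⊗[k] Z) : head21 Z mA (eA ⊗ₜ t) = t := by
  induction t with
  | zero => simp
  | add s t hs ht => simp only [map_add, tmul_add, hs, ht]
  | tmul a z => simp [hA.one_mul]

theorem IsYDAlgebra.head_mul_one [YDData k B A] {mA : A ⊗[k] A →ₗ[k] A} {eA : A}
    (hA : IsYDAlgebra B mA eA) (t : A ⊗[k] Z) :
    head21 Z mA (𝖫 (TensorProduct.mk k A Z eA) t) = t := by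
  induction t with
  | zero => simp
  | add s t hs ht => simp only [map_add, hs, ht]
  | tmul a z => simp [hA.mul_one]

theorem assoc_tensorMul_tmul [YDData k B A] [YDData k B D] (mA : A ⊗[k] A →ₗ[k] A)
    (mD : D ⊗[k] D →ₗ[k] D) (a b : A ⊗[k] D) (z : Z) :
    𝖺 (tensorMul B mA mD (a ⊗ₜ b) ⊗ₜ z) =
      𝖫 (head21 Z mD) (head21 _ mA (𝖫 (cr B) (𝖺 (a ⊗ₜ 𝖺 (b ⊗ₜ z))))) :=
  assoc_head21_tensorMul mA mD (a ⊗ₜ (b ⊗ₜ z))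

/-- Naturality lets the product of D cross a strand of A and the product of A cross a strand of D;
what is left is associativity in each factor. -/
theorem IsYDAlgebra.head_tensorMul_assoc [YDData k B A] [YDData k B D] {mA : A ⊗[k] A →ₗ[k] A}
    {eA : A} {mD : D ⊗[k] D →ₗ[k] D} {eD : D} (hA : IsYDAlgebra B mA eA)
    (hD : IsYDAlgebra B mD eD) (t : A ⊗[k] (D ⊗[k] (A ⊗[k] (D ⊗[k] (A ⊗[k] (D ⊗[k] Z)))))) :
    𝖫 (head21 Z mD) (head21 _ mA (𝖫 (cr B) (𝖫 (head21 _ mD) (head21 _ mA (𝖫 (cr B) t))))) =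
    𝖫 (head21 Z mD) (head21 _ mA (𝖫 (cr B)
      (𝖫 (𝖫 (𝖫 (head21 Z mD) ∘ₗ head21 _ mA ∘ₗ 𝖫 (cr B))) t))) := by
  simp only [LinearMap.lTensor_comp, LinearMap.comp_apply]
  rw [lift23 (fun t => cr_left21 hD.mul_hom hA.isYD t), lT_cr,
    lift23 (fun t => cr_right21 hA.mul_hom hD.isYD t)]
  simp only [← head21_lTensor]
  simp only [← lT_head21]
  rw [hA.head_assoc, lift22 (lift22 (lift22 hD.head_assoc)), lT_cr]

theorem IsYDAlgebra.tensorMul [YDData k B A] [YDData k B D] {mA : A ⊗[k] A →ₗ[k] A} {eA : A}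
    {mD : D ⊗[k] D →ₗ[k] D} {eD : D} (hA : IsYDAlgebra B mA eA) (hD : IsYDAlgebra B mD eD) :
    IsYDAlgebra B (tensorMul B mA mD) (eA ⊗ₜ[k] eD) where
  isYD := hA.isYD.tensor hD.isYD
  assoc a b c := by
    have h2 : ∀ {Y Y' : Type _} [AddCommMonoid Y] [Module k Y] [AddCommMonoid Y'] [Module k Y']
        (F : Y →ₗ[k] Y') (y : Y), 𝖺 (a ⊗ₜ[k] F y) = 𝖫 (𝖫 F) (𝖺 (a ⊗ₜ[k] y)) :=
      fun F y => assoc_lTensor F (a ⊗ₜ[k] y)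
    apply tmul_one_injective (k := k)
    apply (TensorProduct.assoc k A D k).injective
    have h1 := hA.head_tensorMul_assoc hD (𝖺 (a ⊗ₜ 𝖺 (b ⊗ₜ 𝖺 (c ⊗ₜ (1 : k)))))
    rw [← h2] at h1
    rw [assoc_tensorMul_tmul, assoc_tensorMul_tmul, assoc_tensorMul_tmul, assoc_tensorMul_tmul]
    exact h1
  one_mul a := by
    apply tmul_one_injective (k := k)
    apply (TensorProduct.assoc k A D k).injective
    rw [assoc_tensorMul_tmul, TensorProduct.assoc_tmul, LinearMap.lTensor_tmul,
      cr_left01 hD.unit_hom hA.isYD, hA.head_one_mul, lift20 hD.head_one_mul]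
  mul_one a := by
    apply tmul_one_injective (k := k)
    apply (TensorProduct.assoc k A D k).injective
    have h : a ⊗ₜ[k] (eA ⊗ₜ[k] (eD ⊗ₜ[k] (1 : k))) =
        𝖫 (TensorProduct.mk k A _ eA ∘ₗ TensorProduct.mk k D k eD) (a ⊗ₜ (1 : k)) := rfl
    rw [assoc_tensorMul_tmul, TensorProduct.assoc_tmul, h, assoc_lTensor]
    simp only [LinearMap.lTensor_comp, LinearMap.comp_apply]
    rw [lift21 (c := TensorProduct.mk k A _ eA) (fun t => cr_right01 hA.unit_hom hD.isYD t),
      hA.head_mul_one, lift20 hD.head_mul_one]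
  mul_hom := .comp (.tensorMap hA.mul_hom hD.mul_hom) (mid_hom (.braid hD.isYD hA.isYD))
  unit_hom := unit_tmul_hom hA.unit_hom hD.unit_hom

/-- Used to obtain the axioms for (R # H) # U from those for R ⊗ (H # U). -/
theorem IsYDAlgebra.of_equiv [YDData k B A] [YDData k B D] {mA : A ⊗[k] A →ₗ[k] A} {eA : A}
    {mD : D ⊗[k] D →ₗ[k] D} {eD : D} (hD : IsYDAlgebra B mD eD) (hA : IsYD k B A)
    (e : A ≃ₗ[k] D) (he : IsYDHom k B e.toLinearMap) (h1 : e eA = eD)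
    (hm : ∀ x y, e (mA (x ⊗ₜ y)) = mD (e x ⊗ₜ e y)) : IsYDAlgebra B mA eA where
  isYD := hA
  assoc a b c := e.injective (by simp only [hm, hD.assoc])
  one_mul a := e.injective (by rw [hm, h1, hD.one_mul])
  mul_one a := e.injective (by rw [hm, h1, hD.mul_one])
  mul_hom := by
    have h : mA = e.symm.toLinearMap ∘ₗ mD ∘ₗ map e.toLinearMap e.toLinearMap := by
      apply TensorProduct.ext'
      intro x y
      apply e.injective
      simp [hm]
    rw [h]
    exact .comp (.symm he) (.comp hD.mul_hom (.tensorMap he he))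
  unit_hom := by
    have h : LinearMap.toSpanSingleton k A eA =
        e.symm.toLinearMap ∘ₗ LinearMap.toSpanSingleton k D eD := by
      ext
      simp [← h1]
    rw [h]
    exact .comp (.symm he) hD.unit_hom

end HeadProducts

/-! ### Comodule algebras over `U` and the twist of `R # H`. -/

namespace BraidedHopfSubalgebra

variable {k B H : Type*} [Field k] [Ring B] [HopfAlgebra k B] [Module.Finite k B]
  [Ring H] [Algebra k H] [Coalgebra k H] [YDData k B H] [BraidedHopfAlgebra k B H]
  {U : BraidedHopfSubalgebra k B H}
variable {Y Z : Type*} [AddCommMonoid Y] [Module k Y] [AddCommMonoid Z] [Module k Z]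

local notation "𝖫" => LinearMap.lTensor _
local notation "𝖼" => cr B
local notation "𝗆" => head21 _ (mul' k H)
local notation "𝖽" => head12 _ (Coalgebra.comul : H →ₗ[k] H ⊗[k] H)
local notation "𝖣" => head12 _ (comulCop k B H)
local notation "𝖾" => head10 _ (Coalgebra.counit : H →ₗ[k] k)
local notation "𝗎" => TensorProduct.mk k H _ (1 : H)
local notation "𝖊" => head20 _ (BraidedHopfSubalgebra.ev U)
local notation "𝗆U" => head21 _ (BraidedHopfSubalgebra.mul U)
local notation "𝖽U" => head12 _ (BraidedHopfSubalgebra.comul U)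
local notation "𝗁" => head21 _ (BraidedHopfSubalgebra.hit U)
local notation "𝗋" => head21 _ (BraidedHopfSubalgebra.regRight U)

local notation "𝗘" => BraidedHopfSubalgebra.headMulHU U _

variable {R : Type*} [Ring R] [Algebra k R] [YDData k B R] {ψ : R →ₗ[k] R ⊗[k] U.carrier}

local notation "𝖬" => head21 _ (mul' k R)
local notation "𝖯" => head12 _ ψ
local notation "𝖺" => TensorProduct.assoc k _ _ _
local notation "𝖠" => LinearEquiv.toLinearMap (TensorProduct.assoc k _ _ _)
local notation "𝗉" => head21 _ (BraidedHopfSubalgebra.alpha U ψ)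

namespace IsComoduleAlgebra

theorem st_coassoc (hψ : U.IsComoduleAlgebra ψ) (t : R ⊗[k] Z) : 𝖯 (𝖯 t) = 𝖫 𝖽U (𝖯 t) := by
  induction t with
  | zero => simp
  | add s t hs ht => simp only [map_add, hs, ht]
  | tmul x z =>
    let A : R ⊗[k] (U.carrier ⊗[k] U.carrier) →ₗ[k] R ⊗[k] (U.carrier ⊗[k] (U.carrier ⊗[k] Z)) :=
      (((TensorProduct.mk k U.carrier Z).flip z).lTensor U.carrier).lTensor R
    have h1 : ∀ p : R ⊗[k] U.carrier, 𝖯 (TensorProduct.assoc k R U.carrier Z (p ⊗ₜ z)) =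
        A (TensorProduct.assoc k R U.carrier U.carrier (ψ.rTensor U.carrier p)) := by
      intro p
      induction p with
      | zero => simp
      | add s t hs ht => simp only [map_add, add_tmul, hs, ht]
      | tmul a b =>
        simp only [TensorProduct.assoc_tmul, LinearMap.rTensor_tmul, head12_tmul]
        generalize ψ a = q
        induction q with
        | zero => simp
        | add s t hs ht => simp only [map_add, add_tmul, hs, ht]
        | tmul c d => simp [A]
    have h2 : ∀ p : R ⊗[k] U.carrier, 𝖫 𝖽U (TensorProduct.assoc k R U.carrier Z (p ⊗ₜ z)) =
        A (U.comul.lTensor R p) := by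
      intro p
      induction p with
      | zero => simp
      | add s t hs ht => simp only [map_add, add_tmul, hs, ht]
      | tmul a b =>
        simp only [TensorProduct.assoc_tmul, LinearMap.lTensor_tmul, head12_tmul]
        generalize U.comul b = q
        induction q with
        | zero => simp
        | add s t hs ht => simp only [map_add, tmul_add, add_tmul, hs, ht]
        | tmul c d => simp [A]
    have h3 := LinearMap.congr_fun hψ.coassoc x
    simp only [LinearMap.comp_apply, LinearEquiv.coe_coe] at h3
    rw [head12_tmul, h1, h2, h3]

theorem st_counit (hψ : U.IsComoduleAlgebra ψ) (t : R ⊗[k] Z) :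
    𝖫 (head10 _ U.counit) (𝖯 t) = t := by
  induction t with
  | zero => simp
  | add s t hs ht => simp only [map_add, hs, ht]
  | tmul x z =>
    have h : ∀ p : R ⊗[k] U.carrier, 𝖫 (head10 _ U.counit) (𝖺 (p ⊗ₜ[k] z)) =
        TensorProduct.rid k R (U.counit.lTensor R p) ⊗ₜ z := by
      intro p
      induction p with
      | zero => simp
      | add s t hs ht => simp only [map_add, add_tmul, hs, ht]
      | tmul c d => simp [smul_tmul']
    have h3 := LinearMap.congr_fun hψ.counit x
    simp only [LinearMap.comp_apply, LinearEquiv.coe_coe, LinearMap.id_apply] at h3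
    rw [head12_tmul, h, h3]

theorem st_one (hψ : U.IsComoduleAlgebra ψ) (t : Z) :
    𝖯 ((1 : R) ⊗ₜ[k] t) = 1 ⊗ₜ (U.one ⊗ₜ t) := by
  simp [head12_tmul, hψ.map_one]

theorem st_mul (hψ : U.IsComoduleAlgebra ψ) (t : R ⊗[k] (R ⊗[k] Z)) :
    𝖯 (𝖬 t) = 𝖫 𝗆U (𝖬 (𝖫 𝖼 (𝖯 (𝖫 𝖯 t)))) := by
  refine tensor3_ext (f := 𝖯 ∘ₗ 𝖬) (g := 𝖫 𝗆U ∘ₗ 𝖬 ∘ₗ 𝖫 𝖼 ∘ₗ 𝖯 ∘ₗ 𝖫 𝖯) ?_ t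
  intro x y z
  have h := LinearMap.congr_fun hψ.map_mul (x ⊗ₜ y)
  simp only [LinearMap.comp_apply, map_tmul] at h
  simp only [LinearMap.comp_apply, head21_tmul, LinearMap.lTensor_tmul, head12_tmul, h,
    assoc_tensorMul_tmul]

theorem isYD (hψ : U.IsComoduleAlgebra ψ) : IsYD k B R := hψ.isYDAlgebra.isYD

end IsComoduleAlgebra

theorem st_alpha_eq (t : H ⊗[k] (R ⊗[k] Z)) : 𝗉 t = 𝖫 𝖊 (𝖫 𝖼 (𝖼 (𝖫 𝖯 t))) := by
  have h0 : ∀ s : H ⊗[k] (U.carrier ⊗[k] Z), 𝖊 (𝖼 s) = head20 Z (U.ev ∘ₗ braid k B H U.carrier) s := by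
    intro s
    refine tensor3_ext (f := 𝖊 ∘ₗ 𝖼) (g := head20 Z (U.ev ∘ₗ braid k B H U.carrier)) ?_ s
    intro x f z
    simp only [LinearMap.comp_apply, head20_tmul, cr_tmul]
    generalize braid k B H U.carrier (x ⊗ₜ f) = q
    induction q with
    | zero => simp
    | add s t hs ht => simp only [map_add, add_tmul, add_smul, hs, ht]
    | tmul f x => simp
  rw [lift21 h0]
  refine tensor3_ext (f := 𝗉) (g := 𝖫 (head20 Z (U.ev ∘ₗ braid k B H U.carrier)) ∘ₗ 𝖼 ∘ₗ 𝖫 𝖯) ?_ t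
  intro x r z
  simp only [LinearMap.comp_apply, alpha, head21_tmul, LinearMap.lTensor_tmul, head12_tmul, LinearEquiv.coe_coe]
  generalize ψ r = p
  induction p with
  | zero => simp
  | add s t hs ht => simp only [map_add, tmul_add, add_tmul, hs, ht]
  | tmul r f =>
    simp only [pass, LinearMap.comp_apply, LinearEquiv.coe_coe, TensorProduct.assoc_tmul,
      TensorProduct.assoc_symm_tmul, LinearMap.rTensor_tmul, cr_tmul]
    generalize braid k B H R (x ⊗ₜ r) = q
    induction q with
    | zero => simp
    | add s t hs ht => simp only [map_add, tmul_add, add_tmul, hs, ht]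
    | tmul r x => simp [smul_tmul']

/-- Since ψ is a morphism, h can first be carried past the whole of r and then evaluated against r₁.
-/
theorem st_alpha (hψ : U.IsComoduleAlgebra ψ) (t : H ⊗[k] (R ⊗[k] Z)) : 𝗉 t = 𝖫 𝖊 (𝖯 (𝖼 t)) := by
  rw [st_alpha_eq, cr_right12 hψ.hom (isYD_base k B H)]

theorem alpha_hom (hψ : U.IsComoduleAlgebra ψ) : IsYDHom k B (U.alpha ψ) :=
  .comp .rid (.comp (pass_hom (isYD_base k B H) hψ.isYD
    (.comp U.ev_hom (.braid (isYD_base k B H) U.isYD))) (.lTensor hψ.hom))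

theorem st_alpha_one_left (hψ : U.IsComoduleAlgebra ψ) (t : R ⊗[k] Z) :
    𝗉 ((1 : H) ⊗ₜ[k] t) = t := by
  rw [st_alpha hψ, cr_left01 (BraidedDuality.one_hom k B H) hψ.isYD,
    head12_lTensor, lift21 (fun t => (BraidedHopfSubalgebra.st_counit t).symm), hψ.st_counit]

theorem st_alpha_one_right (hψ : U.IsComoduleAlgebra ψ) (t : H ⊗[k] Z) :
    𝗉 (𝖫 (TensorProduct.mk k R Z 1) t) = 1 ⊗ₜ 𝖾 t := by
  rw [st_alpha hψ, cr_right01 hψ.isYDAlgebra.unit_hom (isYD_base k B H), hψ.st_one,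
    LinearMap.lTensor_tmul, st_ev_one]

section Symmetric

variable [IsSymmetricHopf k B H]

theorem IsComoduleAlgebra.st_braid_HR (hψ : U.IsComoduleAlgebra ψ) (t : H ⊗[k] (R ⊗[k] Z)) :
    𝖼 (𝖫 𝖯 t) = 𝖫 𝖼 (𝖯 (𝖼 t)) := by
  rw [← cr_right12 hψ.hom (isYD_base k B H), lift20 st_braid_UH_HU]

theorem IsComoduleAlgebra.st_braid_UR (hψ : U.IsComoduleAlgebra ψ) (t : U.carrier ⊗[k] (R ⊗[k] Z)) :
    𝖼 (𝖫 𝖯 t) = 𝖫 𝖼 (𝖯 (𝖼 t)) := by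
  rw [← cr_right12 hψ.hom U.isYD, lift20 st_braid_UU]

/-- Evaluating r₁ on a product of H is evaluating its coproduct on the factors; coassociativity of ψ
turns this into two successive actions. -/
theorem st_alpha_mul (hψ : U.IsComoduleAlgebra ψ) (t : H ⊗[k] (H ⊗[k] (R ⊗[k] Z))) :
    𝗉 (𝗆 t) = 𝗉 (𝖫 𝗉 t) := by
  have h : ∀ s : U.carrier ⊗[k] (H ⊗[k] (H ⊗[k] Z)), 𝖊 (𝖫 𝗆 s) = 𝖊 (𝖫 𝖊 (𝖽U (𝖫 𝖼 s))) := by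
    intro s
    rw [st_ev_comul, lift20 (st_braid_braid (B := B))]
  rw [st_alpha hψ, st_alpha hψ, lift13 (st_alpha hψ), cr_left21 (BraidedDuality.mul_hom k B H) hψ.isYD,
    head12_lTensor, lift24 h, ← head12_lTensor, ← hψ.st_coassoc, cr_lTensor, hψ.st_braid_HR,
    head12_lTensor, head12_lTensor, head12_lTensor, head12_lTensor, lift22 (lift22 st_ev_braid)]

/-- The twist `H ⊗ R → R ⊗ H` of the smash product `R # H`. -/
def smashTwist (ψ : R →ₗ[k] R ⊗[k] U.carrier) : H ⊗[k] R →ₗ[k] R ⊗[k] H :=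
  (U.alpha ψ).rTensor H ∘ₗ (TensorProduct.assoc k H R H).symm.toLinearMap ∘ₗ
    (braid k B H R).lTensor H ∘ₗ (TensorProduct.assoc k H H R).toLinearMap ∘ₗ
      (Coalgebra.comul : H →ₗ[k] H ⊗[k] H).rTensor R

local notation "𝖳" => head22 _ (BraidedHopfSubalgebra.smashTwist ψ)

theorem st_smashTwist_eq (t : H ⊗[k] (R ⊗[k] Z)) : 𝖳 t = 𝗉 (𝖫 𝖼 (𝖽 t)) := head22_smash _ _ t

theorem smashTwist_hom (hψ : U.IsComoduleAlgebra ψ) : IsYDHom k B (smashTwist ψ) :=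
  .comp (.rTensor (alpha_hom hψ)) (.comp (.symm .assoc) (.comp
    (.lTensor (.braid (isYD_base k B H) hψ.isYD)) (.comp .assoc
      (.rTensor (BraidedDuality.comul_hom k B H)))))

/-- The key description of R # H: moving h past r acts on h by ρ(r₁). The leg h₁ of h is consumed by
the action on r and the leg h₂ survives, which is the right regular action. -/
theorem st_smashTwist (hψ : U.IsComoduleAlgebra ψ) (t : H ⊗[k] (R ⊗[k] Z)) :
    𝖳 t = 𝖫 𝗋 (𝖯 (𝖼 t)) := by
  rw [st_smashTwist_eq, st_alpha hψ, cr_left12 (BraidedDuality.comul_hom k B H) hψ.isYD,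
    head12_lTensor, lift21 (fun t => (st_regRight t).symm)]

/-- Multiplicativity of ψ produces a product in U, whose evaluation splits h by its opposite
comultiplication; the crossing restores the original one and assembles the smash twist. -/
theorem st_alpha_mul_right (hψ : U.IsComoduleAlgebra ψ) (t : H ⊗[k] (R ⊗[k] (R ⊗[k] Z))) :
    𝗉 (𝖫 𝖬 t) = 𝖬 (𝖫 𝗉 (𝗉 (𝖫 𝖼 (𝖽 t)))) := by
  have h : ∀ y : U.carrier ⊗[k] (U.carrier ⊗[k] (H ⊗[k] Z)),
      𝖊 (𝖫 𝖊 (𝖫 (𝖫 𝖣) (𝖼 y))) = 𝖊 (𝖫 𝗋 y) := by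
    intro y
    rw [← cr_lTensor, st_ev_ev_braid, lift21 (lift21 (st_braid_comulCop (B := B))),
      lift12 st_regRight]
  rw [← st_smashTwist_eq, st_smashTwist hψ, st_alpha hψ, lift13 (st_alpha hψ),
    cr_right21 hψ.isYDAlgebra.mul_hom (isYD_base k B H), hψ.st_mul, lift23 st_ev_mul,
    ← head21_lTensor, ← head21_lTensor, ← head21_lTensor, head12_lTensor, head12_lTensor,
    lift23 hψ.st_braid_UR, lift42 (lift42 h), lift23 (fun t => cr_left21 regRight_hom hψ.isYD t),
    lift22 (fun t => head12_lTensor ψ _ t)]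

/-- The twist acts on H through ρ, and ρ commutes with ⇀. This makes the action of U compatible with
the product of R # H. -/
theorem st_hit_smashTwist (hψ : U.IsComoduleAlgebra ψ)
    (t : U.carrier ⊗[k] (H ⊗[k] (R ⊗[k] Z))) : 𝖫 𝗁 (𝖼 (𝖫 𝖳 t)) = 𝖳 (𝗁 t) := by
  rw [st_smashTwist hψ, lift13 (st_smashTwist hψ), cr_lTensor,
    lift23 st_hit_regRight, cr_right12 hψ.hom U.isYD, cr_left21 hit_hom hψ.isYD, head12_lTensor]

end Symmetric

/-! ### The module algebras `R` over `H` and `R # H` over `U`. -/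

section Symmetric

local notation "𝖳" => head22 _ (BraidedHopfSubalgebra.smashTwist ψ)

variable [IsSymmetricHopf k B H]

theorem isModuleAlgebra_alpha (hψ : U.IsComoduleAlgebra ψ) :
    IsModuleAlgebra B (mul' k H) 1 Coalgebra.comul Coalgebra.counit (mul' k R) 1 (U.alpha ψ) where
  act_hom := alpha_hom hψ
  one_act a := tmul_one_injective (st_alpha_one_left hψ (a ⊗ₜ[k] (1 : k)))
  mul_act x y a := tmul_one_injective (st_alpha_mul hψ (x ⊗ₜ (y ⊗ₜ[k] (a ⊗ₜ (1 : k)))))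
  act_one x := tmul_one_injective (k := k) (by
    rw [smul_tmul]
    exact st_alpha_one_right hψ (x ⊗ₜ[k] (1 : k)))
  act_mul := IsModuleAlgebra.act_mul_of_head (st_alpha_mul_right hψ)

theorem st_hit_comul_smashTwist (hψ : U.IsComoduleAlgebra ψ)
    (t : U.carrier ⊗[k] (H ⊗[k] (R ⊗[k] Z))) :
    𝖫 𝗁 (𝖫 (𝖫 𝖼) (𝖫 𝖽U (𝖼 (𝖫 𝖳 t)))) = 𝖳 (𝖫 𝖼 (𝗁 (𝖫 𝖼 (𝖽U t)))) := by
  rw [← cr_left12 BraidedHopfSubalgebra.comul_hom hψ.isYD, head12_lTensor, ← cr_lTensor,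
    lift33 (fun t => cr_right22 (smashTwist_hom hψ) U.isYD t), st_hit_smashTwist hψ,
    head21_lTensor]

theorem lift55 {M M' M'' M₃ M₄ N N' N'' N₃ N₄ X : Type*} [AddCommMonoid M] [Module k M]
    [AddCommMonoid M'] [Module k M'] [AddCommMonoid M''] [Module k M''] [AddCommMonoid M₃]
    [Module k M₃] [AddCommMonoid M₄] [Module k M₄] [AddCommMonoid N] [Module k N]
    [AddCommMonoid N'] [Module k N'] [AddCommMonoid N''] [Module k N''] [AddCommMonoid N₃]
    [Module k N₃] [AddCommMonoid N₄] [Module k N₄] [AddCommMonoid X] [Module k X]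
    {a : M' →ₗ[k] M} {b : M'' →ₗ[k] M'} {c : M₃ →ₗ[k] M''} {d : M₄ →ₗ[k] M₃} {e : N →ₗ[k] M₄}
    {a' : N' →ₗ[k] M} {b' : N'' →ₗ[k] N'} {c' : N₃ →ₗ[k] N''} {d' : N₄ →ₗ[k] N₃}
    {e' : N →ₗ[k] N₄} (h : ∀ t, a (b (c (d (e t)))) = a' (b' (c' (d' (e' t))))) (t : X ⊗[k] N) :
    𝖫 a (𝖫 b (𝖫 c (𝖫 d (𝖫 e t)))) = 𝖫 a' (𝖫 b' (𝖫 c' (𝖫 d' (𝖫 e' t)))) := by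
  have h' : a ∘ₗ b ∘ₗ c ∘ₗ d ∘ₗ e = a' ∘ₗ b' ∘ₗ c' ∘ₗ d' ∘ₗ e' := LinearMap.ext h
  simpa only [LinearMap.lTensor_comp, LinearMap.comp_apply] using
    LinearMap.congr_fun (congrArg (LinearMap.lTensor X) h') t

theorem st_hit_map_mul (hψ : U.IsComoduleAlgebra ψ)
    (s : U.carrier ⊗[k] (R ⊗[k] (R ⊗[k] (H ⊗[k] (H ⊗[k] Z))))) :
    𝖫 𝗁 (𝖼 (𝖫 (𝖫 𝗆) (𝖫 𝖬 s))) = 𝖫 𝗆 (𝖬 (𝖫 (𝖫 (𝖫 𝗁)) (𝖫 (𝖫 𝗁)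
      (𝖫 (𝖫 (𝖫 𝖼)) (𝖫 (𝖫 𝖽U) (𝖫 𝖼 (𝖼 s))))))) := by
  rw [cr_lTensor, lift25 st_hit_mul_right, cr_right21 hψ.isYDAlgebra.mul_hom U.isYD,
    head21_lTensor, head21_lTensor, head21_lTensor, head21_lTensor]

theorem lT_hit_comul_smashTwist (hψ : U.IsComoduleAlgebra ψ)
    (s : R ⊗[k] (U.carrier ⊗[k] (H ⊗[k] (R ⊗[k] (H ⊗[k] Z))))) :
    𝖫 (𝖫 (𝖫 𝗁)) (𝖫 (𝖫 𝗁) (𝖫 (𝖫 (𝖫 𝖼)) (𝖫 (𝖫 𝖽U) (𝖫 𝖼 (𝖫 (𝖫 𝖳) s))))) =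
      𝖫 𝖳 (𝖫 (𝖫 (𝖫 𝗁)) (𝖫 (𝖫 𝖼) (𝖫 𝗁 (𝖫 (𝖫 𝖼) (𝖫 𝖽U s))))) := by
  have h : ∀ u : R ⊗[k] (H ⊗[k] (R ⊗[k] (U.carrier ⊗[k] (H ⊗[k] Z)))),
      𝖫 𝖳 (𝖫 (𝖫 (𝖫 𝗁)) u) = 𝖫 (𝖫 (𝖫 𝗁)) (𝖫 𝖳 u) :=
    lift22 (fun t => head22_lTensor (smashTwist ψ) _ t)
  rw [lift55 (st_hit_comul_smashTwist (Z := H ⊗[k] Z) hψ), h]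

theorem braid_braid_comul (hψ : U.IsComoduleAlgebra ψ)
    (t : U.carrier ⊗[k] (R ⊗[k] (H ⊗[k] Y))) :
    𝖼 (𝖫 (𝖫 𝖼) (𝖫 𝖼 (𝖽U t))) = 𝖫 (𝖫 𝖼) (𝖫 𝖽U (𝖼 t)) := by
  rw [cr_lTensor, cr_left12 BraidedHopfSubalgebra.comul_hom hψ.isYD]

/-- The functional crosses the product in R, its coproduct distributes over the product in H, and
its two legs then commute with the twist. -/
theorem st_hit_mulRH (hψ : U.IsComoduleAlgebra ψ)
    (t : U.carrier ⊗[k] (R ⊗[k] (H ⊗[k] (R ⊗[k] (H ⊗[k] Z))))) :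
    𝖫 𝗁 (𝖼 (𝖫 (𝖫 𝗆) (𝖫 𝖬 (𝖫 (𝖫 𝖳) t)))) = 𝖫 𝗆 (𝖬 (𝖫 𝖳 (𝖫 (𝖫 (𝖫 𝗁)) (𝖫 (𝖫 𝖼)
      (𝖫 𝗁 (𝖼 (𝖫 (𝖫 𝖼) (𝖫 𝖼 (𝖽U t))))))))) := by
  rw [st_hit_map_mul hψ, cr_lTensor, lT_hit_comul_smashTwist hψ, braid_braid_comul hψ]

theorem assoc_hitRH_tmul (f : U.carrier) (a : R ⊗[k] H) (z : Z) :
    𝖺 (U.hitRH R (f ⊗ₜ[k] a) ⊗ₜ[k] z) = 𝖫 𝗁 (𝖼 (f ⊗ₜ[k] 𝖺 (a ⊗ₜ[k] z))) :=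
  assoc_head21_pass U.hit (f ⊗ₜ[k] (a ⊗ₜ[k] z))

theorem assoc_head21_hitRH (t : U.carrier ⊗[k] ((R ⊗[k] H) ⊗[k] Z)) :
    𝖠 (head21 Z (U.hitRH R) t) = 𝖫 𝗁 (𝖼 (𝖫 𝖠 t)) :=
  assoc_head21_pass U.hit t

theorem assoc_head21_mulRH (t : (R ⊗[k] H) ⊗[k] ((R ⊗[k] H) ⊗[k] Z)) :
    𝖠 (head21 Z (U.mulRH ψ) t) = 𝖫 𝗆 (𝖬 (𝖫 𝖳 (𝖠 (𝖫 𝖠 t)))) :=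
  assoc_head21_map_mid _ _ (smashTwist ψ) t

theorem assoc_cr_tensor {V W X : Type*} [AddCommMonoid V] [Module k V] [AddCommMonoid W]
    [Module k W] [AddCommMonoid X] [Module k X] [YDData k B V] [YDData k B W] [YDData k B X]
    (hV : IsYD k B V) (t : V ⊗[k] ((W ⊗[k] X) ⊗[k] Z)) :
    (TensorProduct.assoc k W X _).toLinearMap (cr B t) = 𝖫 𝖼 (𝖼 (𝖫 𝖠 t)) := by
  rw [LinearEquiv.coe_coe, ← cr_tensor_right hV, ← LinearMap.lTensor_comp_apply]
  simp

theorem assoc_assoc_hitRH (t : U.carrier ⊗[k] (U.carrier ⊗[k] ((R ⊗[k] H) ⊗[k] Y))) :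
    𝖠 (head21 _ (U.hitRH R) (𝖫 𝖼 t)) = 𝖫 𝗁 (𝖼 (𝖫 (𝖫 𝖼) (𝖫 𝖼 (𝖫 (𝖫 𝖠) t)))) := by
  rw [assoc_head21_hitRH, lift23 (assoc_cr_tensor U.isYD)]

theorem assoc_lTensor_hitRH (y : (R ⊗[k] H) ⊗[k] (U.carrier ⊗[k] ((R ⊗[k] H) ⊗[k] Z))) :
    𝖠 (𝖫 𝖠 (𝖫 (head21 Z (U.hitRH R)) y)) = 𝖫 (𝖫 (𝖫 𝗁)) (𝖫 (𝖫 𝖼) (𝖫 (𝖫 (𝖫 𝖠)) (𝖠 y))) := by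
  have h : 𝖫 𝖠 (𝖫 (head21 Z (U.hitRH R)) y) = 𝖫 (𝖫 𝗁 ∘ₗ 𝖼 ∘ₗ 𝖫 𝖠) y :=
    lift21 (assoc_head21_hitRH (U := U)) y
  rw [h, LinearEquiv.coe_coe, assoc_lTensor]
  simp only [LinearMap.lTensor_comp, LinearMap.comp_apply, LinearEquiv.coe_coe]

theorem assoc_hitRH_mulRH (hψ : U.IsComoduleAlgebra ψ)
    (t : U.carrier ⊗[k] ((R ⊗[k] H) ⊗[k] ((R ⊗[k] H) ⊗[k] Z))) :
    𝖠 (head21 Z (U.hitRH R) (𝖫 (head21 Z (U.mulRH ψ)) t)) =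
      𝖠 (head21 Z (U.mulRH ψ) (𝖫 (head21 Z (U.hitRH R)) (head21 _ (U.hitRH R) (𝖫 𝖼 (𝖽U t))))) := by
  have h0 : 𝖫 𝖠 (𝖫 (𝖫 𝖠) t) = 𝖫 (𝖫 (𝖫 𝖠)) (𝖫 𝖠 t) := lift22 (assoc_lTensor _) t
  have h1 : 𝖫 𝖠 (𝖫 (head21 Z (U.mulRH ψ)) t) =
      𝖫 (𝖫 𝗆) (𝖫 𝖬 (𝖫 (𝖫 𝖳) (𝖫 𝖠 (𝖫 (𝖫 𝖠) t)))) := lift25 (assoc_head21_mulRH (ψ := ψ)) t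
  rw [assoc_head21_hitRH, h1, st_hit_mulRH hψ, assoc_head21_mulRH, assoc_lTensor_hitRH,
    assoc_assoc_hitRH, h0]
  simp only [← head12_lTensor]
  simp only [← lT_head21, ← lT_cr, ← lT2_cr, ← cr_lTensor, ← head12_lTensor]

theorem isModuleAlgebra_hitRH (hψ : U.IsComoduleAlgebra ψ) :
    IsModuleAlgebra B U.mul U.one U.comul U.counit (U.mulRH ψ) (1 ⊗ₜ 1) (U.hitRH R) where
  act_hom := pass_hom U.isYD hψ.isYD hit_hom
  one_act a := by
    apply tmul_one_injective (k := k)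
    apply (TensorProduct.assoc k R H k).injective
    rw [assoc_hitRH_tmul, cr_left01 BraidedHopfSubalgebra.one_hom hψ.isYD, lift20 st_hit_one]
  mul_act f g a := by
    apply tmul_one_injective (k := k)
    apply (TensorProduct.assoc k R H k).injective
    have h : ∀ s : U.carrier ⊗[k] (U.carrier ⊗[k] (R ⊗[k] (H ⊗[k] k))),
        𝖫 𝗁 (𝖼 (𝗆U s)) = 𝖫 𝗁 (𝖼 (𝖫 (𝖫 𝗁) (𝖫 𝖼 s))) := by
      intro s
      rw [cr_left21 BraidedHopfSubalgebra.mul_hom hψ.isYD, lift22 st_hit_mul, cr_lTensor]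
    rw [assoc_hitRH_tmul, assoc_hitRH_tmul, assoc_hitRH_tmul]
    exact h (f ⊗ₜ (g ⊗ₜ 𝖺 (a ⊗ₜ 1)))
  act_one f := by
    apply tmul_one_injective (k := k)
    apply (TensorProduct.assoc k R H k).injective
    have h := cr_right01 hψ.isYDAlgebra.unit_hom U.isYD (f ⊗ₜ[k] ((1 : H) ⊗ₜ[k] (1 : k)))
    rw [LinearMap.lTensor_tmul, TensorProduct.mk_apply] at h
    have h1 := st_hit_unit (f ⊗ₜ[k] (1 : k))
    rw [LinearMap.lTensor_tmul, TensorProduct.mk_apply] at h1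
    have h2 : 𝖊 (f ⊗ₜ[k] ((1 : H) ⊗ₜ[k] (1 : k))) = U.counit f := by
      simp [head20, BraidedHopfSubalgebra.ev, BraidedHopfSubalgebra.counit]
    rw [assoc_hitRH_tmul, TensorProduct.assoc_tmul, h, LinearMap.lTensor_tmul, h1, h2]
    simp [smul_tmul]
  act_mul := by
    refine IsModuleAlgebra.act_mul_of_head fun t => ?_
    apply (TensorProduct.assoc k R H k).injective
    exact assoc_hitRH_mulRH hψ t

end Symmetric

/-! ### The algebra H # U, and (R # H) # U as a twisted product of R with H # U. -/

section Symmetric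

local notation "𝖳" => head22 _ (BraidedHopfSubalgebra.smashTwist ψ)

variable [IsSymmetricHopf k B H]

theorem assocMap_lTensor {V W X X' : Type*} [AddCommMonoid V] [Module k V] [AddCommMonoid W]
    [Module k W] [AddCommMonoid X] [Module k X] [AddCommMonoid X'] [Module k X'] (g : X →ₗ[k] X')
    (t : (V ⊗[k] W) ⊗[k] X) : 𝖠 (𝖫 g t) = 𝖫 (𝖫 g) (𝖠 t) := assoc_lTensor g t

variable (U) in
/-- The twist `f ⊗ h ↦ ∑ (f₁ ⇀ f₂₍₋₁₎ · h) ⊗ f₂₍₀₎` of `H # U` acting on the head of a tensor. -/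
def headCross (Z : Type*) [AddCommMonoid Z] [Module k Z] :
    U.carrier ⊗[k] (H ⊗[k] Z) →ₗ[k] H ⊗[k] (U.carrier ⊗[k] Z) := 𝗁 ∘ₗ 𝖫 𝖼 ∘ₗ 𝖽U

local notation "𝗫" => headCross U _

theorem assoc_hitRH_braid (hψ : U.IsComoduleAlgebra ψ)
    (s : U.carrier ⊗[k] ((R ⊗[k] H) ⊗[k] Y)) :
    𝖠 (head21 _ (U.hitRH R) (𝖫 𝖼 (𝖽U s))) = 𝖫 𝗫 (𝖼 (𝖫 𝖠 s)) := by
  rw [assoc_assoc_hitRH, ← head12_lTensor, cr_lTensor,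
    cr_left12 BraidedHopfSubalgebra.comul_hom hψ.isYD]
  simp only [headCross, LinearMap.lTensor_comp, LinearMap.comp_apply]

theorem assoc_lTensor_hitRH_braid (hψ : U.IsComoduleAlgebra ψ)
    (w : (R ⊗[k] H) ⊗[k] (U.carrier ⊗[k] ((R ⊗[k] H) ⊗[k] Y))) :
    𝖠 (𝖫 𝖠 (𝖫 (head21 _ (U.hitRH R)) (𝖫 (𝖫 𝖼) (𝖫 𝖽U w)))) =
      𝖫 (𝖫 (𝖫 𝗫)) (𝖫 (𝖫 𝖼) (𝖠 (𝖫 (𝖫 𝖠) w))) := by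
  rw [lift43 (assoc_hitRH_braid hψ), assocMap_lTensor, assocMap_lTensor]

/-- Since U acts trivially on R, an element of R moving left crosses U by the braiding and H by the
smash twist; everything else is the product of H # U. -/
theorem assoc_mulRH_hitRH (hψ : U.IsComoduleAlgebra ψ)
    (s : (R ⊗[k] H) ⊗[k] (U.carrier ⊗[k] ((R ⊗[k] H) ⊗[k] Y))) :
    𝖠 (head21 _ (U.mulRH ψ) (𝖫 (head21 _ (U.hitRH R)) (𝖫 (𝖫 𝖼) (𝖫 𝖽U s)))) =
      𝖫 𝗆 (𝖫 (𝖫 𝗫) (𝖬 (𝖫 𝖳 (𝖫 (𝖫 𝖼) (𝖠 (𝖫 (𝖫 𝖠) s)))))) := by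
  rw [assoc_head21_mulRH, assoc_lTensor_hitRH_braid hψ,
    lift22 (fun s => head22_lTensor (smashTwist ψ) (headCross U Y) s), head21_lTensor]

theorem assoc_head21_mulHU (t : (H ⊗[k] U.carrier) ⊗[k] ((H ⊗[k] U.carrier) ⊗[k] Z)) :
    𝖠 (head21 Z U.mulHU t) = 𝗘 (𝖠 (𝖫 𝖠 t)) :=
  tensor3_ext (f := 𝖠 ∘ₗ head21 Z U.mulHU) (g := 𝗘 ∘ₗ 𝖠 ∘ₗ 𝖫 𝖠)
    (fun a b z => by
      simpa only [LinearMap.comp_apply, head21_tmul, LinearMap.lTensor_tmul, LinearEquiv.coe_coe]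
        using st_mulHU a b z) t

theorem st_mulHU_mulHU (a b : H ⊗[k] U.carrier) (s : H ⊗[k] (U.carrier ⊗[k] Z)) :
    𝗘 (𝖺 (U.mulHU (a ⊗ₜ b) ⊗ₜ s)) = 𝗘 (𝖺 (a ⊗ₜ 𝗘 (𝖺 (b ⊗ₜ s)))) := by
  rw [st_mulHU, st_mulHU_assoc, ← assoc_lTensor, LinearMap.lTensor_tmul]

theorem mulHU_assoc (a b c : H ⊗[k] U.carrier) :
    U.mulHU (U.mulHU (a ⊗ₜ b) ⊗ₜ c) = U.mulHU (a ⊗ₜ U.mulHU (b ⊗ₜ c)) := by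
  apply tmul_one_injective (k := k)
  apply (TensorProduct.assoc k H U.carrier k).injective
  rw [st_mulHU, st_mulHU_mulHU, st_mulHU, st_mulHU]

theorem one_mulHU (a : H ⊗[k] U.carrier) : U.mulHU ((1 ⊗ₜ U.one) ⊗ₜ a) = a := by
  apply tmul_one_injective (k := k)
  apply (TensorProduct.assoc k H U.carrier k).injective
  rw [st_mulHU, TensorProduct.assoc_tmul, st_one_mulHU]

theorem mulHU_one (a : H ⊗[k] U.carrier) : U.mulHU (a ⊗ₜ (1 ⊗ₜ U.one)) = a := by
  apply tmul_one_injective (k := k)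
  apply (TensorProduct.assoc k H U.carrier k).injective
  have h : a ⊗ₜ[k] ((1 : H) ⊗ₜ[k] (U.one ⊗ₜ[k] (1 : k))) =
      𝖫 (𝗎 ∘ₗ TensorProduct.mk k U.carrier k U.one) (a ⊗ₜ (1 : k)) := rfl
  rw [st_mulHU, TensorProduct.assoc_tmul, h, assoc_lTensor, st_mulHU_one]

theorem mulHU_hom : IsYDHom k B U.mulHU :=
  smashMul_hom U.isYD (isYD_base k B H) (BraidedDuality.mul_hom k B H)
    BraidedHopfSubalgebra.mul_hom BraidedHopfSubalgebra.comul_hom hit_hom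

theorem isYDAlgebra_mulHU : IsYDAlgebra B U.mulHU (1 ⊗ₜ[k] U.one) where
  isYD := (isYD_base k B H).tensor U.isYD
  assoc := mulHU_assoc
  one_mul := one_mulHU
  mul_one := mulHU_one
  mul_hom := mulHU_hom
  unit_hom := unit_tmul_hom (BraidedDuality.one_hom k B H) BraidedHopfSubalgebra.one_hom

theorem isYDAlgebra_mulRtensorHU (hψ : U.IsComoduleAlgebra ψ) :
    IsYDAlgebra B (U.mulRtensorHU R) (1 ⊗ₜ (1 ⊗ₜ U.one)) :=
  hψ.isYDAlgebra.tensorMul isYDAlgebra_mulHU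

theorem assoc_cr_tensor_left {V W X : Type*} [AddCommMonoid V] [Module k V] [AddCommMonoid W]
    [Module k W] [AddCommMonoid X] [Module k X] [YDData k B V] [YDData k B W] [YDData k B X]
    (hX : IsYD k B X) (t : (V ⊗[k] W) ⊗[k] (X ⊗[k] Z)) :
    𝖫 𝖠 (cr B t) = cr B (𝖫 (cr B) (𝖠 t)) := by
  have h := cr_tensor_left hX (𝖠 t)
  rw [LinearEquiv.coe_coe, LinearEquiv.symm_apply_apply] at h
  rw [LinearEquiv.coe_coe, h]
  exact lift20 (fun t => LinearEquiv.apply_symm_apply _ t) _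

variable (U) in
/-- The left regular action of `H # U`, rebracketed to the right. -/
def regHU : H ⊗[k] (U.carrier ⊗[k] (H ⊗[k] U.carrier)) →ₗ[k] H ⊗[k] U.carrier :=
  U.mulHU ∘ₗ (TensorProduct.assoc k H U.carrier (H ⊗[k] U.carrier)).symm.toLinearMap

theorem regHU_assoc (t : (H ⊗[k] U.carrier) ⊗[k] (H ⊗[k] U.carrier)) :
    U.regHU (𝖠 t) = U.mulHU t := by
  rw [regHU, LinearMap.comp_apply, LinearEquiv.coe_coe, LinearEquiv.coe_coe,
    LinearEquiv.symm_apply_apply]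

theorem regHU_tmul (a b : H ⊗[k] U.carrier) : U.regHU (𝖺 (a ⊗ₜ[k] b)) = U.mulHU (a ⊗ₜ b) :=
  regHU_assoc (a ⊗ₜ b)

theorem regHU_one (a : H ⊗[k] U.carrier) : U.regHU (1 ⊗ₜ (U.one ⊗ₜ a)) = a :=
  (regHU_tmul (1 ⊗ₜ U.one) a).trans (one_mulHU a)

/-- Associativity of H # U in the form of a module law, which is how the conjugation arguments use
it. -/
theorem regHU_mul (t : H ⊗[k] (U.carrier ⊗[k] (H ⊗[k] (U.carrier ⊗[k] (H ⊗[k] U.carrier))))) :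
    U.regHU (𝗘 t) = U.regHU (𝖫 (𝖫 U.regHU) t) := by
  obtain ⟨s, rfl⟩ := (TensorProduct.assoc k H U.carrier _).surjective t
  rw [← assoc_lTensor]
  refine LinearMap.congr_fun (f := U.regHU ∘ₗ 𝗘 ∘ₗ 𝖠) (g := U.regHU ∘ₗ 𝖠 ∘ₗ 𝖫 U.regHU) ?_ s
  refine TensorProduct.ext' fun a y => ?_
  obtain ⟨y, rfl⟩ := (TensorProduct.assoc k H U.carrier _).surjective y
  simp only [LinearMap.comp_apply, LinearEquiv.coe_coe, LinearMap.lTensor_tmul]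
  induction y with
  | zero => simp only [map_zero, tmul_zero]
  | add p q hp hq => simp only [map_add, tmul_add, hp, hq]
  | tmul b c => rw [← st_mulHU, regHU_tmul, regHU_tmul, regHU_tmul, mulHU_assoc]

theorem regHU_hom : IsYDHom k B U.regHU := .comp mulHU_hom (.symm .assoc)

end Symmetric

/-! ### Acting on H # U-modules through maps U → H # U. -/

section Symmetric

variable [IsSymmetricHopf k B H] [hRL : Fact U.RLCondition]

/-- `f ⊗ y ↦ μ (κ f ⊗ y)`, for `κ : U → H # U` and an `H # U`-module `(Y, μ)`. -/
def actBy (κ : U.carrier →ₗ[k] H ⊗[k] U.carrier) (μ : H ⊗[k] (U.carrier ⊗[k] Y) →ₗ[k] Y) :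
    U.carrier ⊗[k] Y →ₗ[k] Y :=
  μ ∘ₗ head12 Y κ

theorem actBy_apply (κ : U.carrier →ₗ[k] H ⊗[k] U.carrier)
    (μ : H ⊗[k] (U.carrier ⊗[k] Y) →ₗ[k] Y) (t : U.carrier ⊗[k] Y) :
    actBy κ μ t = μ (head12 Y κ t) := rfl

section Module

variable {μ : H ⊗[k] (U.carrier ⊗[k] Y) →ₗ[k] Y}

/-- The hypothesis says that Y is a module over H # U; successive actions of elements κ'(f), κ(g)
then combine into one action of their product. -/
theorem actBy_actBy (hμ : ∀ t, μ (𝗘 t) = μ (𝖫 (𝖫 μ) t))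
    (κ κ' : U.carrier →ₗ[k] H ⊗[k] U.carrier) (t : U.carrier ⊗[k] (U.carrier ⊗[k] Y)) :
    actBy κ' μ (𝖫 (actBy κ μ) t) = μ (𝗘 (𝖫 (𝖫 (head12 _ κ)) (head12 _ κ' t))) := by
  rw [actBy_apply, hμ, head12_lTensor]
  simp only [actBy, LinearMap.lTensor_comp, LinearMap.comp_apply]

theorem actBy_inverse (hμ : ∀ t, μ (𝗘 t) = μ (𝖫 (𝖫 μ) t)) (h1 : ∀ y, μ (1 ⊗ₜ (U.one ⊗ₜ y)) = y)
    {κ κ' : U.carrier →ₗ[k] H ⊗[k] U.carrier}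
    (h : ∀ t : U.carrier ⊗[k] Y,
      𝗘 (𝖫 (𝖫 (head12 _ κ)) (head12 _ κ' (𝖽U t))) = 1 ⊗ₜ (U.one ⊗ₜ head10 _ U.counit t))
    (t : U.carrier ⊗[k] Y) :
    actBy κ' μ (𝖫 (actBy κ μ) (𝖽U t)) = head10 _ U.counit t := by
  rw [actBy_actBy hμ, h, h1]

theorem actBy_mul (hμ : ∀ t, μ (𝗘 t) = μ (𝖫 (𝖫 μ) t))
    (t : U.carrier ⊗[k] (U.carrier ⊗[k] Y)) :
    actBy U.rightToLeftInv μ (𝗆U t) =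
      actBy U.rightToLeftInv μ (𝖫 (actBy U.rightToLeftInv μ) t) := by
  rw [actBy_actBy hμ, actBy_apply, st_rightToLeftInv_mul]

theorem act_actBy (hμ : ∀ t, μ (𝗘 t) = μ (𝖫 (𝖫 μ) t)) (κ : U.carrier →ₗ[k] H ⊗[k] U.carrier)
    (t : U.carrier ⊗[k] (H ⊗[k] (U.carrier ⊗[k] Y))) :
    μ (actBy κ 𝗘 t) = actBy κ μ (𝖫 μ t) := by
  rw [actBy_apply, actBy_apply, hμ, head12_lTensor]

/-- The commutation rule of γ carried over to an arbitrary H # U-module. -/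
theorem actBy_regRight (hμ : ∀ t, μ (𝗘 t) = μ (𝖫 (𝖫 μ) t))
    (t : U.carrier ⊗[k] (H ⊗[k] (U.carrier ⊗[k] Y))) :
    actBy U.rightToLeftInv μ (𝖫 μ (𝖫 𝗋 (𝖽U t))) =
      μ (𝖫 (𝖫 (actBy U.rightToLeftInv μ)) (𝖫 𝖼 (𝖼 t))) := by
  rw [← act_actBy hμ, actBy_apply, st_mulHU_rightToLeftInv, hμ]
  simp only [actBy, LinearMap.lTensor_comp, LinearMap.comp_apply]

end Module

theorem braid_mulHU (hψ : U.IsComoduleAlgebra ψ)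
    (s : (H ⊗[k] U.carrier) ⊗[k] ((H ⊗[k] U.carrier) ⊗[k] (R ⊗[k] Z))) :
    cr B (head21 _ U.mulHU s) = 𝖫 (head21 Z U.mulHU) (cr B (𝖫 (cr B) s)) :=
  cr_left21 mulHU_hom hψ.isYD s

theorem lTensor_assoc_braid (hψ : U.IsComoduleAlgebra ψ)
    (s : (H ⊗[k] U.carrier) ⊗[k] ((H ⊗[k] U.carrier) ⊗[k] (R ⊗[k] Z))) :
    𝖫 𝖠 (𝖫 (𝖫 𝖠) (cr B (𝖫 (cr B) s))) =
      𝖼 (𝖫 𝖼 (𝖫 (𝖫 𝖼) (𝖫 (𝖫 (𝖫 𝖼)) (𝖠 (𝖫 𝖠 s))))) := by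
  rw [← cr_lTensor, assoc_cr_tensor_left hψ.isYD, lift23 (assoc_cr_tensor_left hψ.isYD)]
  refine congrArg (fun y => 𝖼 (𝖫 𝖼 y)) ?_
  refine (assoc_lTensor (V := H) (W := U.carrier) (cr B) _).trans (congrArg _ ?_)
  exact assoc_lTensor (V := H) (W := U.carrier) (LinearMap.lTensor H (cr B)) _

theorem headMulHU_braid_assoc (hψ : U.IsComoduleAlgebra ψ)
    (s : (H ⊗[k] U.carrier) ⊗[k] ((H ⊗[k] U.carrier) ⊗[k] (R ⊗[k] Z))) :
    𝖼 (𝖫 𝖼 (𝗘 (𝖠 (𝖫 𝖠 s)))) =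
      𝖫 𝗘 (𝖼 (𝖫 𝖼 (𝖫 (𝖫 𝖼) (𝖫 (𝖫 (𝖫 𝖼)) (𝖠 (𝖫 𝖠 s)))))) := by
  rw [← lTensor_assoc_braid hψ, ← assoc_head21_mulHU, ← assoc_cr_tensor_left hψ.isYD,
    braid_mulHU hψ]
  exact lift23 assoc_head21_mulHU _

/-- The product of H # U is a morphism, so a strand of R may cross the factors before or after they
are multiplied. -/
theorem headMulHU_braid (hψ : U.IsComoduleAlgebra ψ)
    (t : H ⊗[k] (U.carrier ⊗[k] (H ⊗[k] (U.carrier ⊗[k] (R ⊗[k] Z))))) :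
    𝖼 (𝖫 𝖼 (𝗘 t)) = 𝖫 𝗘 (𝖼 (𝖫 𝖼 (𝖫 (𝖫 𝖼) (𝖫 (𝖫 (𝖫 𝖼)) t)))) := by
  obtain ⟨s, rfl⟩ := (TensorProduct.assoc k H U.carrier _).surjective t
  obtain ⟨s, rfl⟩ := ((TensorProduct.assoc k H U.carrier (R ⊗[k] Z)).lTensor
    (H ⊗[k] U.carrier)).surjective s
  exact headMulHU_braid_assoc hψ s

theorem actBy_braid (hψ : U.IsComoduleAlgebra ψ) {κ : U.carrier →ₗ[k] H ⊗[k] U.carrier}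
    (hκ : IsYDHom k B κ) (t : U.carrier ⊗[k] (H ⊗[k] (U.carrier ⊗[k] (R ⊗[k] Z)))) :
    𝖼 (𝖫 𝖼 (actBy κ 𝗘 t)) = 𝖫 (actBy κ 𝗘) (𝖼 (𝖫 𝖼 (𝖫 (𝖫 𝖼) t))) := by
  have h : ∀ s : U.carrier ⊗[k] (R ⊗[k] (H ⊗[k] (U.carrier ⊗[k] Z))),
      𝖼 (𝖫 𝖼 (head12 _ κ s)) = 𝖫 (head12 _ κ) (𝖼 s) := cr_left12 hκ hψ.isYD
  rw [actBy_apply, headMulHU_braid hψ, ← head12_lTensor, ← head12_lTensor, h]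
  simp only [actBy, LinearMap.lTensor_comp, LinearMap.comp_apply]

end Symmetric

/-! ### Untwisting: maps r ⊗ y ↦ ∑ r₀ ⊗ G(r₁ ⊗ y). -/

section Symmetric

local notation "𝖳" => head22 _ (BraidedHopfSubalgebra.smashTwist ψ)

variable [IsSymmetricHopf k B H] [hRL : Fact U.RLCondition]

section Twist

variable {W P : Type*} [AddCommMonoid W] [Module k W] [AddCommMonoid P] [Module k P]

variable (ψ) in
/-- `r ⊗ y ↦ ∑ r₀ ⊗ G (r₁ ⊗ y)`. -/
def coactBy (G : U.carrier ⊗[k] Y →ₗ[k] Y) :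
    R ⊗[k] Y →ₗ[k] R ⊗[k] Y := 𝖫 G ∘ₗ 𝖯

theorem coactBy_apply (G : U.carrier ⊗[k] Y →ₗ[k] Y) (t : R ⊗[k] Y) :
    coactBy ψ G t = 𝖫 G (𝖯 t) := rfl

/-- Coassociativity of ψ turns the composite of two such maps into the convolution of G' and G. -/
theorem coactBy_inverse (hψ : U.IsComoduleAlgebra ψ) {G G' : U.carrier ⊗[k] Y →ₗ[k] Y}
    (h : ∀ t, G' (𝖫 G (𝖽U t)) = head10 _ U.counit t) (t : R ⊗[k] Y) :
    coactBy ψ G' (coactBy ψ G t) = t := by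
  rw [coactBy_apply, coactBy_apply, head12_lTensor, hψ.st_coassoc, lift31 h, hψ.st_counit]

/-- Because ψ is multiplicative, the U-component of r s is r₁ s₁; as G is an action, the two
components can be applied one after the other. -/
theorem coactBy_mul (hψ : U.IsComoduleAlgebra ψ) {G : U.carrier ⊗[k] Y →ₗ[k] Y}
    (hG : ∀ t, G (𝗆U t) = G (𝖫 G t)) (s : R ⊗[k] (R ⊗[k] Y)) :
    coactBy ψ G (𝖬 s) = 𝖫 G (𝖬 (𝖫 𝖼 (𝖯 (𝖫 (coactBy ψ G) s)))) := by
  have h : 𝖫 (coactBy ψ G) s = 𝖫 (𝖫 G) (𝖫 𝖯 s) := by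
    simp only [coactBy, LinearMap.lTensor_comp, LinearMap.comp_apply]
  rw [coactBy_apply, hψ.st_mul, lift22 hG, h, head12_lTensor, head12_lTensor, lT_cr, head21_lTensor,
    head12_lTensor]

/-- If `coactBy ψ G` intertwines two twists, then it is multiplicative. -/
theorem coactBy_twistedMul (hψ : U.IsComoduleAlgebra ψ) {G : U.carrier ⊗[k] Y →ₗ[k] Y}
    {G' : U.carrier ⊗[k] P →ₗ[k] P} {G'' : U.carrier ⊗[k] W →ₗ[k] W} {μ : P →ₗ[k] Y}
    {c τ : W →ₗ[k] R ⊗[k] P} {θ : W →ₗ[k] W} (hG : ∀ t, G (𝗆U t) = G (𝖫 G t))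
    (hc : ∀ t, c (G'' t) = 𝖫 G' (𝖼 (𝖫 c t))) (hμ : ∀ t, μ (G' t) = G (𝖫 μ t))
    (hτ : ∀ u, coactBy ψ G (𝖫 μ (τ u)) = 𝖫 μ (c (θ u))) (t : R ⊗[k] W) :
    coactBy ψ G (𝖫 μ (𝖬 (𝖫 τ t))) = 𝖫 μ (𝖬 (𝖫 c (coactBy ψ G'' (𝖫 θ t)))) := by
  have hr : 𝖫 μ (𝖬 (𝖫 c (coactBy ψ G'' (𝖫 θ t)))) =
      𝖫 G (𝖫 (𝖫 μ) (𝖬 (𝖫 𝖼 (𝖯 (𝖫 c (𝖫 θ t)))))) := by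
    rw [coactBy_apply, lift23 hc, head21_lTensor, lift22 hμ, head12_lTensor, head12_lTensor,
      head12_lTensor]
  rw [hr, ← head21_lTensor, coactBy_mul hψ hG, lift33 hτ, head12_lTensor, lT_cr,
    head21_lTensor]

theorem coact_smashTwist (hψ : U.IsComoduleAlgebra ψ) (u : H ⊗[k] (R ⊗[k] Z)) :
    𝖯 (𝖳 u) = 𝖫 (𝖫 𝗋) (𝖫 𝖽U (𝖯 (𝖼 u))) := by
  rw [st_smashTwist hψ, head12_lTensor, hψ.st_coassoc]

theorem braid_coact (hψ : U.IsComoduleAlgebra ψ) (u : H ⊗[k] (U.carrier ⊗[k] (R ⊗[k] Z))) :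
    𝖼 (𝖫 𝖼 (𝖫 (𝖫 𝖯) u)) = 𝖫 (𝖫 𝖼) (𝖫 𝖼 (𝖯 (𝖼 (𝖫 𝖼 u)))) := by
  rw [lift23 hψ.st_braid_UR, cr_lTensor, hψ.st_braid_HR]

theorem lift44 {M M' M'' M₃ N N' N'' N₃ X : Type*} [AddCommMonoid M] [Module k M]
    [AddCommMonoid M'] [Module k M'] [AddCommMonoid M''] [Module k M''] [AddCommMonoid M₃]
    [Module k M₃] [AddCommMonoid N] [Module k N] [AddCommMonoid N'] [Module k N']
    [AddCommMonoid N''] [Module k N''] [AddCommMonoid N₃] [Module k N₃] [AddCommMonoid X]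
    [Module k X] {a : M' →ₗ[k] M} {b : M'' →ₗ[k] M'} {c : M₃ →ₗ[k] M''} {d : N →ₗ[k] M₃}
    {a' : N' →ₗ[k] M} {b' : N'' →ₗ[k] N'} {c' : N₃ →ₗ[k] N''} {d' : N →ₗ[k] N₃}
    (h : ∀ t, a (b (c (d t))) = a' (b' (c' (d' t)))) (t : X ⊗[k] N) :
    𝖫 a (𝖫 b (𝖫 c (𝖫 d t))) = 𝖫 a' (𝖫 b' (𝖫 c' (𝖫 d' t))) := by
  rw [← LinearMap.lTensor_comp_apply X c' d', lift43 (d' := c' ∘ₗ d') h]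

/-- The twist leaves ρ(r₁) on the H-strand, while the coaction supplies one more component of r. By
the commutation rule for G the two combine and move to the other side, leaving the plain braiding.
-/
theorem coactBy_smashTwist (hψ : U.IsComoduleAlgebra ψ) {G : U.carrier ⊗[k] Y →ₗ[k] Y}
    {μ : H ⊗[k] (U.carrier ⊗[k] Y) →ₗ[k] Y}
    (hG : ∀ t, G (𝖫 μ (𝖫 𝗋 (𝖽U t))) = μ (𝖫 (𝖫 G) (𝖫 𝖼 (𝖼 t))))
    (u : H ⊗[k] (U.carrier ⊗[k] (R ⊗[k] Y))) :
    coactBy ψ G (𝖫 μ (𝖳 (𝖫 𝖼 u))) = 𝖫 μ (𝖼 (𝖫 𝖼 (𝖫 (𝖫 (coactBy ψ G)) u))) := by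
  have h : 𝖫 (𝖫 (coactBy ψ G)) u = 𝖫 (𝖫 (𝖫 G)) (𝖫 (𝖫 𝖯) u) := by
    simp only [coactBy, LinearMap.lTensor_comp, LinearMap.comp_apply]
  rw [coactBy_apply, head12_lTensor, coact_smashTwist hψ, lift44 hG, h, lT_cr, cr_lTensor,
    braid_coact hψ]

end Twist

end Symmetric

end BraidedHopfSubalgebra

/-! ### Smash and braided tensor products in right-nested form. -/

section Products

variable {k B A D P Q V W X : Type*} [Field k] [Ring B] [HopfAlgebra k B] [AddCommMonoid A]
  [Module k A] [AddCommMonoid D] [Module k D] [AddCommMonoid P] [Module k P] [AddCommMonoid Q]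
  [Module k Q] [AddCommMonoid V] [Module k V] [AddCommMonoid W] [Module k W] [AddCommMonoid X]
  [Module k X]

local notation "𝖫" => LinearMap.lTensor _
local notation "𝖠" => LinearEquiv.toLinearMap (TensorProduct.assoc k _ _ _)

theorem map_mid (f : A ⊗[k] W →ₗ[k] P) (g : V ⊗[k] D →ₗ[k] Q) (χ : V ⊗[k] W →ₗ[k] W ⊗[k] V)
    (t : (A ⊗[k] V) ⊗[k] (W ⊗[k] D)) :
    map f g (mid A D χ t) = 𝖫 g (head21 _ f (𝖫 (head22 D χ) (𝖠 t))) := by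
  rw [← LinearMap.lTensor_comp_rTensor]
  rfl

theorem smashMul_apply [YDData k B A] [YDData k B X] (mA : A ⊗[k] A →ₗ[k] A)
    (mX : X ⊗[k] X →ₗ[k] X) (Δ : X →ₗ[k] X ⊗[k] X) (act : X ⊗[k] A →ₗ[k] A)
    (t : (A ⊗[k] X) ⊗[k] (A ⊗[k] X)) :
    smashMul B mA mX Δ act t =
      𝖫 mX (head21 _ mA (𝖫 (head21 _ act) (𝖫 (𝖫 (cr B)) (𝖫 (head12 _ Δ) (𝖠 t))))) := by
  rw [smashMul, LinearMap.comp_apply, map_mid, lift13 (fun t => head22_smash act Δ t)]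

theorem tensorMul_apply [Module.Finite k B] [YDData k B A] [YDData k B V] [YDData k B W] (hA : IsYD k B A)
    (mA : A ⊗[k] A →ₗ[k] A) {mD : (V ⊗[k] W) ⊗[k] (V ⊗[k] W) →ₗ[k] V ⊗[k] W}
    {μ : V ⊗[k] (W ⊗[k] (V ⊗[k] W)) →ₗ[k] V ⊗[k] W} (h : ∀ t, mD t = μ (𝖠 t))
    (t : (A ⊗[k] (V ⊗[k] W)) ⊗[k] (A ⊗[k] (V ⊗[k] W))) :
    tensorMul B mA mD t = 𝖫 μ (head21 _ mA (𝖫 (cr B) (𝖫 (𝖫 (cr B)) (𝖫 𝖠 (𝖠 t))))) := by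
  rw [tensorMul, LinearMap.comp_apply, map_mid, lift12 h, ← head21_lTensor]
  exact congrArg (fun s => 𝖫 μ (head21 _ mA s))
    (lift23 (fun t => BraidedHopfSubalgebra.assoc_cr_tensor_left hA t) _)

end Products

/-! ### The isomorphism (R # H) # U ≅ R ⊗ (H # U). -/

namespace BraidedHopfSubalgebra

variable {k B H : Type*} [Field k] [Ring B] [HopfAlgebra k B] [Module.Finite k B]
  [Ring H] [Algebra k H] [Coalgebra k H] [YDData k B H] [BraidedHopfAlgebra k B H]
  {U : BraidedHopfSubalgebra k B H}
variable {Y Z : Type*} [AddCommMonoid Y] [Module k Y] [AddCommMonoid Z] [Module k Z]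

local notation "𝖫" => LinearMap.lTensor _
local notation "𝖼" => cr B
local notation "𝗆" => head21 _ (mul' k H)
local notation "𝖽U" => head12 _ (BraidedHopfSubalgebra.comul U)

local notation "𝗘" => BraidedHopfSubalgebra.headMulHU U _

variable {R : Type*} [Ring R] [Algebra k R] [YDData k B R] {ψ : R →ₗ[k] R ⊗[k] U.carrier}

local notation "𝖬" => head21 _ (mul' k R)
local notation "𝖺" => TensorProduct.assoc k _ _ _
local notation "𝖠" => LinearEquiv.toLinearMap (TensorProduct.assoc k _ _ _)
local notation "𝖳" => head22 _ (BraidedHopfSubalgebra.smashTwist ψ)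

local notation "𝗫" => headCross U _

section Symmetric

variable [IsSymmetricHopf k B H]

theorem regHU_eq (t : H ⊗[k] (U.carrier ⊗[k] (H ⊗[k] U.carrier))) :
    U.regHU t = 𝖫 U.mul (𝗆 (𝖫 𝗫 t)) := by
  obtain ⟨s, rfl⟩ := (TensorProduct.assoc k H U.carrier _).surjective t
  refine (regHU_assoc s).trans ?_
  rw [mulHU, smashMul_apply]
  simp only [headCross, LinearMap.lTensor_comp, LinearMap.comp_apply, LinearEquiv.coe_coe]

/-- The map `z ↦ p ⊗ z`, rebracketed to the right, for `p` in a threefold tensor product. -/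
def tmulRight {A C D : Type*} [AddCommMonoid A] [Module k A] [AddCommMonoid C] [Module k C]
    [AddCommMonoid D] [Module k D] (p : A ⊗[k] (C ⊗[k] D)) (Z : Type*) [AddCommMonoid Z]
    [Module k Z] : Z →ₗ[k] A ⊗[k] (C ⊗[k] (D ⊗[k] Z)) :=
  𝖫 𝖠 ∘ₗ 𝖠 ∘ₗ TensorProduct.mk k _ Z p

theorem tmulRight_apply {A C D : Type*} [AddCommMonoid A] [Module k A] [AddCommMonoid C]
    [Module k C] [AddCommMonoid D] [Module k D] (p : A ⊗[k] (C ⊗[k] D)) (z : Z) :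
    tmulRight p Z z = 𝖫 𝖠 (𝖠 (p ⊗ₜ[k] z)) := rfl

theorem tmulRight_map {A C D : Type*} [AddCommMonoid A] [Module k A] [AddCommMonoid C]
    [Module k C] [AddCommMonoid D] [Module k D] (p : A ⊗[k] (C ⊗[k] D)) (g : Y →ₗ[k] Z) (y : Y) :
    tmulRight p Z (g y) = 𝖫 (𝖫 (𝖫 g)) (tmulRight p Y y) := by
  have h := assocMap_lTensor g (p ⊗ₜ[k] y)
  rw [LinearMap.lTensor_tmul] at h
  rw [tmulRight_apply, tmulRight_apply, h]
  exact lift22 (assocMap_lTensor g) _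

theorem tmulRight_assoc {A C D : Type*} [AddCommMonoid A] [Module k A] [AddCommMonoid C]
    [Module k C] [AddCommMonoid D] [Module k D] (x : (A ⊗[k] C) ⊗[k] D) (z : Z) :
    tmulRight (𝖺 x) Z z = 𝖠 (𝖠 (x ⊗ₜ[k] z)) := by
  rw [tmulRight_apply]
  induction x with
  | zero => simp only [map_zero, zero_tmul]
  | add p q hp hq => simp only [map_add, add_tmul, hp, hq]
  | tmul x f =>
    induction x with
    | zero => simp only [map_zero, zero_tmul]
    | add p q hp hq => simp only [map_add, add_tmul, hp, hq]
    | tmul r h => rfl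

theorem tmulRight_assoc_map {A C D : Type*} [AddCommMonoid A] [Module k A] [AddCommMonoid C]
    [Module k C] [AddCommMonoid D] [Module k D] (g : Y →ₗ[k] Z) (x : (A ⊗[k] C) ⊗[k] D) (y : Y) :
    tmulRight (𝖺 x) Z (g y) = 𝖠 (𝖫 (𝖫 g) (𝖠 (x ⊗ₜ[k] y))) := by
  rw [tmulRight_assoc, ← assocMap_lTensor, LinearMap.lTensor_tmul]

theorem mulRtensorHU_tmul (hψ : U.IsComoduleAlgebra ψ) (p q : R ⊗[k] (H ⊗[k] U.carrier)) :
    U.mulRtensorHU R (p ⊗ₜ q) =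
      𝖫 U.regHU (𝖬 (𝖫 𝖼 (𝖫 (𝖫 𝖼) (tmulRight p _ q)))) :=
  tensorMul_apply hψ.isYD (mul' k R) (fun t => (regHU_assoc t).symm) (p ⊗ₜ q)

theorem assoc_lTensor_mulRH (hψ : U.IsComoduleAlgebra ψ) {g : U.carrier ⊗[k] Y →ₗ[k] Z}
    {μ : H ⊗[k] (U.carrier ⊗[k] (H ⊗[k] Y)) →ₗ[k] H ⊗[k] Z}
    (hμ : ∀ t, μ t = 𝖫 g (𝗆 (𝖫 𝗫 t)))
    (s : (R ⊗[k] H) ⊗[k] (U.carrier ⊗[k] ((R ⊗[k] H) ⊗[k] Y))) :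
    𝖠 (𝖫 g (head21 _ (U.mulRH ψ) (𝖫 (head21 _ (U.hitRH R)) (𝖫 (𝖫 𝖼) (𝖫 𝖽U s))))) =
      𝖫 μ (𝖬 (𝖫 𝖳 (𝖫 (𝖫 𝖼) (𝖠 (𝖫 (𝖫 𝖠) s))))) := by
  rw [assocMap_lTensor, lift13 hμ, assoc_mulRH_hitRH hψ]

theorem assoc_mulRHU (hψ : U.IsComoduleAlgebra ψ)
    (t : ((R ⊗[k] H) ⊗[k] U.carrier) ⊗[k] ((R ⊗[k] H) ⊗[k] U.carrier)) :
    𝖠 (U.mulRHU ψ t) = 𝖫 U.regHU (𝖬 (𝖫 𝖳 (𝖫 (𝖫 𝖼) (𝖠 (𝖫 (𝖫 𝖠) (𝖠 t)))))) := by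
  rw [mulRHU, smashMul_apply]
  exact assoc_lTensor_mulRH hψ regHU_eq _

theorem assoc_mulRHU_tmul (hψ : U.IsComoduleAlgebra ψ) (x y : (R ⊗[k] H) ⊗[k] U.carrier) :
    𝖠 (U.mulRHU ψ (x ⊗ₜ y)) =
      𝖫 U.regHU (𝖬 (𝖫 𝖳 (𝖫 (𝖫 𝖼) (tmulRight (𝖺 x) _ (𝖺 y))))) := by
  rw [assoc_mulRHU hψ]
  exact congrArg (fun s => 𝖫 U.regHU (𝖬 (𝖫 𝖳 (𝖫 (𝖫 𝖼) s))))
    (tmulRight_assoc_map (TensorProduct.assoc k R H U.carrier).toLinearMap x y).symm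

variable [hRL : Fact U.RLCondition]

variable (ψ) in
/-- `r ⊗ a ↦ ∑ r₀ ⊗ κ (r₁) a` on `R ⊗ (H # U)`, for `κ : U → H # U`. -/
def twist (κ : U.carrier →ₗ[k] H ⊗[k] U.carrier) :
    R ⊗[k] (H ⊗[k] U.carrier) →ₗ[k] R ⊗[k] (H ⊗[k] U.carrier) :=
  coactBy ψ (actBy κ U.regHU)

theorem twist_hom (hψ : U.IsComoduleAlgebra ψ) {κ : U.carrier →ₗ[k] H ⊗[k] U.carrier}
    (hκ : IsYDHom k B κ) : IsYDHom k B (twist ψ κ) :=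
  .comp (.lTensor (.comp regHU_hom (.comp .assoc (.rTensor hκ)))) (.comp .assoc (.rTensor hψ.hom))

theorem coactBy_actBy_inverse (hψ : U.IsComoduleAlgebra ψ)
    {μ : H ⊗[k] (U.carrier ⊗[k] Y) →ₗ[k] Y} (hμ : ∀ t, μ (𝗘 t) = μ (𝖫 (𝖫 μ) t))
    (h1 : ∀ y, μ (1 ⊗ₜ (U.one ⊗ₜ y)) = y) {κ κ' : U.carrier →ₗ[k] H ⊗[k] U.carrier}
    (h : ∀ t : U.carrier ⊗[k] Y,
      𝗘 (𝖫 (𝖫 (head12 _ κ)) (head12 _ κ' (𝖽U t))) = 1 ⊗ₜ (U.one ⊗ₜ head10 _ U.counit t)) :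
    coactBy ψ (actBy κ' μ) ∘ₗ coactBy ψ (actBy κ μ) = LinearMap.id :=
  LinearMap.ext fun p => coactBy_inverse hψ (actBy_inverse hμ h1 h) p

theorem actBy_assoc_tmul (κ : U.carrier →ₗ[k] H ⊗[k] U.carrier) (f : U.carrier)
    (a : H ⊗[k] U.carrier) (z : Z) :
    𝖺 (actBy κ U.regHU (f ⊗ₜ a) ⊗ₜ z) = actBy κ 𝗘 (f ⊗ₜ 𝖺 (a ⊗ₜ z)) := by
  rw [actBy_apply, actBy_apply, head12_tmul, head12_tmul, regHU_tmul, st_mulHU]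

/-- The untwisting map multiplies by γ or w on the left in H # U, so by associativity it may be
applied before or after further factors are attached. -/
theorem tmulRight_twist (κ : U.carrier →ₗ[k] H ⊗[k] U.carrier) (p : R ⊗[k] (H ⊗[k] U.carrier))
    (z : Z) : tmulRight (twist ψ κ p) Z z = coactBy ψ (actBy κ 𝗘) (tmulRight p Z z) := by
  rw [tmulRight_apply, tmulRight_apply, twist, coactBy_apply, coactBy_apply]
  induction p with
  | zero => simp only [map_zero, zero_tmul]
  | add p q hp hq => simp only [map_add, add_tmul, hp, hq]
  | tmul r a =>
    simp only [LinearMap.comp_apply, TensorProduct.assoc_tmul, LinearMap.lTensor_tmul, head12_tmul,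
      LinearEquiv.coe_coe]
    generalize ψ r = q
    induction q with
    | zero => simp only [map_zero, zero_tmul]
    | add p q hp hq => simp only [map_add, add_tmul, hp, hq]
    | tmul r f =>
      simp only [TensorProduct.assoc_tmul, LinearMap.lTensor_tmul, LinearEquiv.coe_coe,
        actBy_assoc_tmul]

/-- `coactBy_twistedMul` applied to γ: its hypotheses are multiplicativity of γ, naturality of the
crossing with R, the module law, and the conversion of the smash twist into the braiding. -/
theorem coactBy_actBy_mul (hψ : U.IsComoduleAlgebra ψ)
    {μ : H ⊗[k] (U.carrier ⊗[k] Y) →ₗ[k] Y} (hμ : ∀ t, μ (𝗘 t) = μ (𝖫 (𝖫 μ) t))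
    (t : R ⊗[k] (H ⊗[k] (U.carrier ⊗[k] (R ⊗[k] Y)))) :
    coactBy ψ (actBy U.rightToLeftInv μ) (𝖫 μ (𝖬 (𝖫 𝖳 (𝖫 (𝖫 𝖼) t)))) =
      𝖫 μ (𝖬 (𝖫 𝖼 (𝖫 (𝖫 𝖼) (coactBy ψ (actBy U.rightToLeftInv 𝗘)
        (𝖫 (𝖫 (𝖫 (coactBy ψ (actBy U.rightToLeftInv μ)))) t))))) := by
  have h := coactBy_twistedMul hψ (c := 𝖼 ∘ₗ 𝖫 𝖼) (τ := 𝖳 ∘ₗ 𝖫 𝖼)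
    (θ := 𝖫 (𝖫 (coactBy ψ (actBy U.rightToLeftInv μ))))
    (actBy_mul hμ) (G'' := actBy U.rightToLeftInv 𝗘) (fun t => by
      rw [LinearMap.lTensor_comp]; exact actBy_braid hψ rightToLeftInv_hom t)
    (act_actBy hμ _) (coactBy_smashTwist hψ (actBy_regRight hμ)) t
  rw [LinearMap.lTensor_comp, LinearMap.lTensor_comp] at h
  exact h

theorem twist_mul (hψ : U.IsComoduleAlgebra ψ) (p q : R ⊗[k] (H ⊗[k] U.carrier)) :
    twist ψ U.rightToLeftInv (𝖫 U.regHU (𝖬 (𝖫 𝖳 (𝖫 (𝖫 𝖼) (tmulRight p _ q))))) =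
      𝖫 U.regHU (𝖬 (𝖫 𝖼 (𝖫 (𝖫 𝖼) (tmulRight (twist ψ U.rightToLeftInv p) _
        (twist ψ U.rightToLeftInv q))))) := by
  rw [tmulRight_twist, tmulRight_map]
  exact coactBy_actBy_mul hψ regHU_mul _

/-- The linear isomorphism `(R # H) # U ≃ R ⊗ (H # U)`. -/
def twistEquiv (hψ : U.IsComoduleAlgebra ψ) :
    ((R ⊗[k] H) ⊗[k] U.carrier) ≃ₗ[k] R ⊗[k] (H ⊗[k] U.carrier) :=
  TensorProduct.assoc k R H U.carrier ≪≫ₗ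
    LinearEquiv.ofLinearMap (twist ψ U.rightToLeftInv) (twist ψ U.rightToLeft)
      (coactBy_actBy_inverse hψ regHU_mul regHU_one st_rightToLeftInv_left)
      (coactBy_actBy_inverse hψ regHU_mul regHU_one st_rightToLeftInv_right)

theorem twistEquiv_apply (hψ : U.IsComoduleAlgebra ψ) (x : (R ⊗[k] H) ⊗[k] U.carrier) :
    twistEquiv hψ x = twist ψ U.rightToLeftInv (𝖠 x) := rfl

/-- The coaction ψ, the map γ, the product of H # U and the associator are all morphisms. -/
theorem twistEquiv_hom (hψ : U.IsComoduleAlgebra ψ) :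
    IsYDHom k B (twistEquiv hψ).toLinearMap :=
  .comp (twist_hom hψ rightToLeftInv_hom) .assoc

theorem twistEquiv_one (hψ : U.IsComoduleAlgebra ψ) :
    twistEquiv hψ ((1 ⊗ₜ 1) ⊗ₜ U.one) = 1 ⊗ₜ (1 ⊗ₜ U.one) := by
  rw [twistEquiv_apply, LinearEquiv.coe_coe, TensorProduct.assoc_tmul, twist, coactBy_apply,
    hψ.st_one, LinearMap.lTensor_tmul, actBy_apply, st_rightToLeftInv_one, regHU_one]

theorem twistEquiv_mul (hψ : U.IsComoduleAlgebra ψ) (x y : (R ⊗[k] H) ⊗[k] U.carrier) :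
    twistEquiv hψ (U.mulRHU ψ (x ⊗ₜ y)) =
      U.mulRtensorHU R (twistEquiv hψ x ⊗ₜ twistEquiv hψ y) := by
  rw [twistEquiv_apply, assoc_mulRHU_tmul hψ, twist_mul hψ, mulRtensorHU_tmul hψ]
  rfl

/-- The equivalence preserves products and units and is a morphism, so all axioms are pulled back
from the braided tensor product. -/
theorem isYDAlgebra_mulRHU (hψ : U.IsComoduleAlgebra ψ) :
    IsYDAlgebra B (U.mulRHU ψ) ((1 ⊗ₜ 1) ⊗ₜ U.one) :=
  (isYDAlgebra_mulRtensorHU hψ).of_equiv ((hψ.isYD.tensor (isYD_base k B H)).tensor U.isYD)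
    (twistEquiv hψ) (twistEquiv_hom hψ) (twistEquiv_one hψ) (twistEquiv_mul hψ)

end Symmetric
end BraidedHopfSubalgebra

end BraidedDuality

end

open BraidedDuality in
theorem corollary2p5 {k B H R : Type*} [Field k] [Ring B] [HopfAlgebra k B] [Module.Finite k B]
    [Ring H] [Algebra k H] [Coalgebra k H] [YDData k B H] [BraidedHopfAlgebra k B H]
    (hsymm : braid k B H H ∘ₗ braid k B H H = LinearMap.id)
    (hS : Function.Bijective (braidedAntipode k B H))
    (U : BraidedHopfSubalgebra k B H) (hRL : U.RLCondition)
    [Ring R] [Algebra k R] [YDData k B R] (ψ : R →ₗ[k] R ⊗[k] U.carrier)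
    (hψ : U.IsComoduleAlgebra ψ) :
    -- `R` is an `H`-module algebra and `R # H` is a `U`-module algebra
    IsModuleAlgebra B (mul' k H) 1 comul counit (mul' k R) 1 (U.alpha ψ) ∧
    IsModuleAlgebra B U.mul U.one U.comul U.counit (U.mulRH ψ) (1 ⊗ₜ 1) (U.hitRH R) ∧
    -- both sides are algebras
    IsYDAlgebra B (U.mulRHU ψ) ((1 ⊗ₜ 1) ⊗ₜ U.one) ∧
    IsYDAlgebra B (U.mulRtensorHU R) (1 ⊗ₜ (1 ⊗ₜ U.one)) ∧
    ∃ Φ : ((R ⊗[k] H) ⊗[k] U.carrier) ≃ₗ[k] R ⊗[k] (H ⊗[k] U.carrier),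
      Φ ((1 ⊗ₜ 1) ⊗ₜ U.one) = 1 ⊗ₜ (1 ⊗ₜ U.one) ∧
      (∀ x y, Φ (U.mulRHU ψ (x ⊗ₜ y)) = U.mulRtensorHU R (Φ x ⊗ₜ Φ y)) ∧
      ((∀ a b : B, a * b = b * a) → IsCocomm k B → IsYDHom k B Φ.toLinearMap) := by
  have : IsSymmetricHopf k B H := ⟨hsymm, hS⟩
  have : Fact U.RLCondition := ⟨hRL⟩
  exact ⟨BraidedHopfSubalgebra.isModuleAlgebra_alpha hψ,
    BraidedHopfSubalgebra.isModuleAlgebra_hitRH hψ,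
    BraidedHopfSubalgebra.isYDAlgebra_mulRHU hψ,
    BraidedHopfSubalgebra.isYDAlgebra_mulRtensorHU hψ,
    BraidedHopfSubalgebra.twistEquiv hψ, BraidedHopfSubalgebra.twistEquiv_one hψ,
    BraidedHopfSubalgebra.twistEquiv_mul hψ,
    fun _ _ => BraidedHopfSubalgebra.twistEquiv_hom hψ⟩
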